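/- **Setting.** Let $\Omega\subseteq\mathbb R^d$ be open. For $t\ge 0$ and $x\in\Omega$ let $b_t(x)\in\mathbb R^d$ and let $D_t(x)\in\mathbb R^{d\times d}$ be symmetric positive semidefinite. Assume that $b$ and $D$ are bounded in $(t,x)$, are $C^2$ in $x$ with derivatives up to order $2$ continuous in $(t,x)\in[0,\infty)\times\Omega$, and are Lipschitz in $x$ on bounded subsets of $\Omega$, uniformly for $t$ in bounded intervals. Let $\rho_0\in C^3(\Omega)$ be a positive probability density on $\Omega$. Let $\rho^*_t>0$ on $[0,\infty)\times\Omega$, $C^3$ in $x$ with derivatives up to order $3$ continuous in $(t,x)$, solve the Fokker–Planck equation $$\partial_t\rho^*_t=-\nabla\cdot\big(b_t\rho^*_t-D_t\nabla\rho^*_t\big),\qquad \rho^*_0=\rho_0 ,$$ and suppose that $|\nabla\log\rho^*_t(x)-\nabla\log\rho^*_t(y)|\le K|x-y|$ for some $K>0$ and all $t\ge0$, $x,y\in\Omega$. We say that a velocity field is *confined to $\Omega$* if none of its integral curves in $\Omega$ converges, forward or backward in finite time, to a point outside $\Omega$ (automatic if $\Omega=\mathbb R^d$). Assume that $b_t-D_t\nabla\log\rho_t^*$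 is confined to $\Omega$. For a time interval $J=[0,\infty)$ or $J=[0,T]$ call $s=(s_t)_{t\in J}$, $s_t:\Omega\to\mathbb R^d$, *admissible on $J$* if it is $C^2$ in $x$ with derivatives up to order $2$ continuous in $(t,x)\in J\times\Omega$, and if $v_t(x)=b_t(x)-D_t(x)s_t(x)$ satisfies, uniformly for $t$ in bounded subsets of $J$, $|v_t(x)|\le C(1+|x|)$, is Lipschitz in $x$ on bounded subsets of $\Omega$, and is confined to $\Omega$. For $x\in\Omega$ and $t\in J$ consider $$\dot X_t(x)=v_t(X_t(x)),\quad X_0(x)=x,\qquad \dot G_t(x)=-[\nabla v_t(X_t(x))]^{\mathsf T}G_t(x)-\nabla\nabla\cdot v_t(X_t(x)),\quad G_0(x)=\nabla\log\rho_0(x),\tag{1}$$ with $X_t(x)\in\Omega$, and put $|w|_D^2=\langle w,Dw\rangle$ and $$L_T(s)=\int_0^T\!\!\int_\Omega\big|s_t(X_t(x))-G_t(x)\big|^2_{D_t(X_t(x))}\,\rho_0(x)\,dx\,dt\in[0,\infty].$$ **Proposition (score-based transport modeling).** 1. Let $s$ be admissible on $[0,\infty)$. Then (1) has a solution for all $t\ge0$.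 For every solution $(X,G)$ of (1), the push-forward $X_t\sharp\rho_0$ has, for each $t\ge0$, a positive density $\rho_t$ on $\Omega$ that is $C^1$ in $x$, with $\rho_t(x)$ and $\nabla\rho_t(x)$ continuous in $(t,x)$; it satisfies the transport equation $\partial_t\rho_t=-\nabla\cdot(v_t\rho_t)$ with $\rho_{t=0}=\rho_0$; and $G_t(x)=\nabla\log\rho_t(X_t(x))$ for all $t\ge0$, $x\in\Omega$. 2. In the situation of 1, for every $T\in[0,\infty)$, $$\mathrm{KL}\big(X_T\sharp\rho_0\,\|\,\rho_T^*\big)\le\tfrac12\,L_T(s).$$ 3. Let $T\in(0,\infty)$ and let $s^*$, with its solution $(X^*,G^*)$ of (1), minimize $L_T$ among all $s$ admissible on $[0,T]$ subject to (1) on $[0,T]$. Then $D_t(x)s^*_t(x)=D_t(x)\nabla\log\rho^*_t(x)$ for all $t\in[0,T]$, $x\in\Omega$, and $X_t^*\sharp\rho_0=\rho_t^*$ for all $t\in[0,T]$, i.e. $x\sim\rho_0$ implies $X_t^*(x)\sim\rho_t^*$. -/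

import Mathlib

open Set Filter Topology MeasureTheory
open scoped ENNReal

namespace SBTM

/-- `ℝ^d` with its Euclidean norm. -/
abbrev E (d : ℕ) : Type := EuclideanSpace ℝ (Fin d)

noncomputable section

/-- The divergence `∑ᵢ ∂ᵢ Fᵢ`. -/
def divergence {d : ℕ} (F : E d → E d) (x : E d) : ℝ :=
  ∑ i : Fin d, (fderiv ℝ F x (EuclideanSpace.single i 1)) i

/-- The score `∇ log ρ` of a density. -/
def score {d : ℕ} (ρ : E d → ℝ) (x : E d) : E d :=
  gradient (fun y => Real.log (ρ y)) x

/-- The velocity field `v_t = b_t - D_t s_t`. -/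
def velocity {d : ℕ} (b : ℝ → E d → E d) (D : ℝ → E d → E d →L[ℝ] E d)
    (s : ℝ → E d → E d) (t : ℝ) (x : E d) : E d :=
  b t x - D t x (s t x)

/-- The measure `ρ(x) dx` on `Ω`. -/
def densityMeasure {d : ℕ} (Ω : Set (E d)) (ρ : E d → ℝ) : Measure (E d) :=
  (volume.restrict Ω).withDensity (fun x => ENNReal.ofReal (ρ x))

/-- The maps `f_t`, `t ∈ J`, are `n` times continuously differentiable in `x ∈ Ω`, and the
space derivatives up to order `n` are continuous in `(t, x) ∈ J × Ω`. -/
def CkInSpace {d : ℕ} {F : Type*} [NormedAddCommGroup F] [NormedSpace ℝ F]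
    (J : Set ℝ) (Ω : Set (E d)) (n : ℕ) (f : ℝ → E d → F) : Prop :=
  (∀ t ∈ J, ContDiffOn ℝ n (f t) Ω) ∧
    ∀ k ≤ n, ContinuousOn (fun p : ℝ × E d => iteratedFDeriv ℝ k (f p.1) p.2) (J ×ˢ Ω)

/-- `f_t` is Lipschitz on bounded subsets of `Ω`, with a constant that is uniform for `t` in
bounded subsets of `J ⊆ [0, ∞)`. If `Ω` is the whole space this holds for every `C¹` function;
otherwise it controls `f` up to the boundary of `Ω`. -/
def LipschitzOnBounded {d : ℕ} {F : Type*} [NormedAddCommGroup F]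
    (J : Set ℝ) (Ω : Set (E d)) (f : ℝ → E d → F) : Prop :=
  ∀ T R : ℝ, ∃ L : ℝ, ∀ t ∈ J, t ≤ T → ∀ x ∈ Ω, ∀ y ∈ Ω, ‖x‖ ≤ R → ‖y‖ ≤ R →
    ‖f t x - f t y‖ ≤ L * ‖x - y‖

/-- No integral curve of `v` inside `Ω` reaches a point outside `Ω` in finite time, forward or
backward. There is nothing to check if `Ω` is the whole space. -/
def NoExit {d : ℕ} (J : Set ℝ) (Ω : Set (E d)) (v : ℝ → E d → E d) : Prop :=
  ∀ (a c : ℝ) (y : ℝ → E d), a < c → Ioo a c ⊆ J →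
    (∀ t ∈ Ioo a c, y t ∈ Ω ∧ HasDerivAt y (v t (y t)) t) →
    ∀ z : E d, Tendsto y (𝓝[<] c) (𝓝 z) ∨ Tendsto y (𝓝[>] a) (𝓝 z) → z ∈ Ω

/-- The Fokker-Planck equation `∂ₜρ = -∇·(b ρ - D ∇ρ)` on `J × Ω`. -/
def SolvesFPE {d : ℕ} (J : Set ℝ) (Ω : Set (E d)) (b : ℝ → E d → E d)
    (D : ℝ → E d → E d →L[ℝ] E d) (ρ : ℝ → E d → ℝ) : Prop :=
  ∀ t ∈ J, ∀ x ∈ Ω, HasDerivWithinAt (fun τ => ρ τ x)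
    (-divergence (fun y => ρ t y • b t y - D t y (gradient (ρ t) y)) x) J t

/-- The transport equation `∂ₜρ = -∇·(v ρ)` on `J × Ω`. -/
def SolvesTE {d : ℕ} (J : Set ℝ) (Ω : Set (E d)) (v : ℝ → E d → E d)
    (ρ : ℝ → E d → ℝ) : Prop :=
  ∀ t ∈ J, ∀ x ∈ Ω, HasDerivWithinAt (fun τ => ρ τ x)
    (-divergence (fun y => ρ t y • v t y) x) J t

/-- The standing assumptions on the domain `Ω`, the drift `b`, the diffusion tensor `D`, the
initial density `ρ₀` and the solution `ρs` of the Fokker-Planck equation. -/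
structure Standing {d : ℕ} (Ω : Set (E d)) (b : ℝ → E d → E d)
    (D : ℝ → E d → E d →L[ℝ] E d) (ρ₀ : E d → ℝ) (ρs : ℝ → E d → ℝ) : Prop where
  isOpen : IsOpen Ω
  b_C2 : CkInSpace (Ici 0) Ω 2 b
  b_bounded : ∃ C : ℝ, ∀ t ∈ Ici (0 : ℝ), ∀ x ∈ Ω, ‖b t x‖ ≤ C
  b_lipschitz : LipschitzOnBounded (Ici 0) Ω b
  D_C2 : CkInSpace (Ici 0) Ω 2 D
  D_bounded : ∃ C : ℝ, ∀ t ∈ Ici (0 : ℝ), ∀ x ∈ Ω, ‖D t x‖ ≤ C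
  D_lipschitz : LipschitzOnBounded (Ici 0) Ω D
  /-- `D_t(x)` is symmetric and positive semidefinite. -/
  D_psd : ∀ t ∈ Ici (0 : ℝ), ∀ x ∈ Ω, (D t x).IsPositive
  ρ₀_C3 : ContDiffOn ℝ 3 ρ₀ Ω
  ρ₀_pos : ∀ x ∈ Ω, 0 < ρ₀ x
  ρ₀_integral : ∫ x in Ω, ρ₀ x = 1
  ρs_init : ∀ x ∈ Ω, ρs 0 x = ρ₀ x
  ρs_C3 : CkInSpace (Ici 0) Ω 3 ρs
  ρs_pos : ∀ t ∈ Ici (0 : ℝ), ∀ x ∈ Ω, 0 < ρs t x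
  ρs_fpe : SolvesFPE (Ici 0) Ω b D ρs
  /-- `log ρs_t` is `K`-smooth, uniformly in time. -/
  ρs_smooth : ∃ K > (0 : ℝ), ∀ t ∈ Ici (0 : ℝ), ∀ x ∈ Ω, ∀ y ∈ Ω,
    ‖score (ρs t) x - score (ρs t) y‖ ≤ K * ‖x - y‖
  /-- The evolution is confined to `Ω`: its probability flow does not cross the boundary. -/
  confined : NoExit (Ici 0) Ω (velocity b D (fun t => score (ρs t)))

/-- Admissible approximate scores on the time interval `J`: `s` is `C²` in space, and the
velocity `b - D s` has at most linear growth, is Lipschitz on bounded sets and does not lead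
out of `Ω`. -/
structure Admissible {d : ℕ} (J : Set ℝ) (Ω : Set (E d)) (b : ℝ → E d → E d)
    (D : ℝ → E d → E d →L[ℝ] E d) (s : ℝ → E d → E d) : Prop where
  s_C2 : CkInSpace J Ω 2 s
  growth : ∀ T : ℝ, ∃ C : ℝ, ∀ t ∈ J, t ≤ T → ∀ x ∈ Ω,
    ‖velocity b D s t x‖ ≤ C * (1 + ‖x‖)
  lipschitz : LipschitzOnBounded J Ω (velocity b D s)
  noExit : NoExit J Ω (velocity b D s)

/-- The system `Ẋ = v(X)`, `Ġ = -[∇v(X)]ᵀ G - ∇(∇·v)(X)` with `X_0(x) = x` and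
`G_0(x) = ∇ log ρ₀(x)`, for initial points `x ∈ Ω` and times in `J ∋ 0`. -/
structure SolvesXG {d : ℕ} (J : Set ℝ) (Ω : Set (E d)) (ρ₀ : E d → ℝ)
    (v : ℝ → E d → E d) (X G : ℝ → E d → E d) : Prop where
  X_mem : ∀ t ∈ J, ∀ x ∈ Ω, X t x ∈ Ω
  X_init : ∀ x ∈ Ω, X 0 x = x
  X_ode : ∀ t ∈ J, ∀ x ∈ Ω, HasDerivWithinAt (fun τ => X τ x) (v t (X t x)) J t
  G_init : ∀ x ∈ Ω, G 0 x = score ρ₀ x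
  G_ode : ∀ t ∈ J, ∀ x ∈ Ω, HasDerivWithinAt (fun τ => G τ x)
    (-(ContinuousLinearMap.adjoint (fderiv ℝ (v t) (X t x)) (G t x))
      - gradient (divergence (v t)) (X t x)) J t

/-- The loss `∫₀ᵀ ∫_Ω |s_t(X_t(x)) - G_t(x)|²_{D_t(X_t(x))} ρ₀(x) dx dt ∈ [0, ∞]`, where
`|w|²_D = ⟨w, D w⟩`. -/
def loss {d : ℕ} (Ω : Set (E d)) (D : ℝ → E d → E d →L[ℝ] E d) (ρ₀ : E d → ℝ) (T : ℝ)
    (s X G : ℝ → E d → E d) : ℝ≥0∞ :=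
  ∫⁻ t in Icc 0 T, ∫⁻ x in Ω, ENNReal.ofReal
    (inner ℝ (s t (X t x) - G t x) (D t (X t x) (s t (X t x) - G t x)) * ρ₀ x)

/-- The feasible set of the constrained problem on `[0, T]`. -/
def Feasible {d : ℕ} (Ω : Set (E d)) (b : ℝ → E d → E d) (D : ℝ → E d → E d →L[ℝ] E d)
    (ρ₀ : E d → ℝ) (T : ℝ) (s X G : ℝ → E d → E d) : Prop :=
  Admissible (Icc 0 T) Ω b D s ∧ SolvesXG (Icc 0 T) Ω ρ₀ (velocity b D s) X G

/-- `s`, with its maps `X` and `G`, minimizes the loss among all feasible competitors. -/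
def IsMinimizer {d : ℕ} (Ω : Set (E d)) (b : ℝ → E d → E d) (D : ℝ → E d → E d →L[ℝ] E d)
    (ρ₀ : E d → ℝ) (T : ℝ) (s X G : ℝ → E d → E d) : Prop :=
  Feasible Ω b D ρ₀ T s X G ∧
    ∀ s' X' G' : ℝ → E d → E d, Feasible Ω b D ρ₀ T s' X' G' →
      loss Ω D ρ₀ T s X G ≤ loss Ω D ρ₀ T s' X' G'

end

end SBTM

namespace SBTM

section CkInSpace

variable {d : ℕ} {J J' : Set ℝ} {Ω : Set (E d)} {n : ℕ}

variable {F F₁ F₂ : Type} [NormedAddCommGroup F] [NormedSpace ℝ F]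
  [NormedAddCommGroup F₁] [NormedSpace ℝ F₁] [NormedAddCommGroup F₂] [NormedSpace ℝ F₂]

theorem CkInSpace.mono_time {f : ℝ → E d → F} (hf : CkInSpace J Ω n f) (h : J' ⊆ J) :
    CkInSpace J' Ω n f :=
  ⟨fun t ht => hf.1 t (h ht), fun k hk => (hf.2 k hk).mono (prod_mono_left h)⟩

theorem CkInSpace.of_le {m : ℕ} {f : ℝ → E d → F} (hf : CkInSpace J Ω n f) (h : m ≤ n) :
    CkInSpace J Ω m f :=
  ⟨fun t ht => (hf.1 t ht).of_le (by exact_mod_cast h), fun k hk => hf.2 k (hk.trans h)⟩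

theorem ckInSpace_zero_iff {f : ℝ → E d → F} :
    CkInSpace J Ω 0 f ↔ ContinuousOn (fun p : ℝ × E d => f p.1 p.2) (J ×ˢ Ω) := by
  constructor
  · intro h
    have := h.2 0 le_rfl
    simp only [iteratedFDeriv_zero_eq_comp, Function.comp_def] at this
    exact (LinearIsometryEquiv.comp_continuousOn_iff _).1 this
  · intro h
    refine ⟨fun t ht => ?_, fun k hk => ?_⟩
    · rw [Nat.cast_zero, contDiffOn_zero]
      exact h.comp (f := fun x => (t, x)) (by fun_prop) (fun x hx => ⟨ht, hx⟩)
    · obtain rfl : k = 0 := by lia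
      simp only [iteratedFDeriv_zero_eq_comp, Function.comp_def]
      exact (LinearIsometryEquiv.comp_continuousOn_iff _).2 h

theorem CkInSpace.continuousOn {f : ℝ → E d → F} (hf : CkInSpace J Ω n f) :
    ContinuousOn (fun p : ℝ × E d => f p.1 p.2) (J ×ˢ Ω) :=
  ckInSpace_zero_iff.1 (hf.of_le (Nat.zero_le n))

theorem continuousOn_iteratedFDeriv_succ_iff {f : ℝ → E d → F} {k : ℕ} :
    ContinuousOn (fun p : ℝ × E d => iteratedFDeriv ℝ (k + 1) (f p.1) p.2) (J ×ˢ Ω) ↔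
      ContinuousOn (fun p : ℝ × E d => iteratedFDeriv ℝ k (fderiv ℝ (f p.1)) p.2) (J ×ˢ Ω) := by
  simp only [iteratedFDeriv_succ_eq_comp_right, Function.comp_def]
  exact LinearIsometryEquiv.comp_continuousOn_iff _

theorem ckInSpace_succ_iff (hΩ : IsOpen Ω) {f : ℝ → E d → F} :
    CkInSpace J Ω (n + 1) f ↔
      (∀ t ∈ J, DifferentiableOn ℝ (f t) Ω) ∧
        ContinuousOn (fun p : ℝ × E d => f p.1 p.2) (J ×ˢ Ω) ∧
          CkInSpace J Ω n (fun t => fderiv ℝ (f t)) := by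
  have key : ∀ t, ContDiffOn ℝ ((n + 1 : ℕ) : WithTop ℕ∞) (f t) Ω ↔
      DifferentiableOn ℝ (f t) Ω ∧ ContDiffOn ℝ n (fderiv ℝ (f t)) Ω := by
    intro t
    rw [Nat.cast_add, Nat.cast_one, contDiffOn_succ_iff_fderiv_of_isOpen hΩ]
    simp
  constructor
  · intro h
    exact ⟨fun t ht => ((key t).1 (h.1 t ht)).1, h.continuousOn,
      fun t ht => ((key t).1 (h.1 t ht)).2,
      fun k hk => continuousOn_iteratedFDeriv_succ_iff.1 (h.2 (k + 1) (by lia))⟩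
  · rintro ⟨h1, h2, h3⟩
    refine ⟨fun t ht => (key t).2 ⟨h1 t ht, h3.1 t ht⟩, fun k hk => ?_⟩
    cases k with
    | zero => exact (ckInSpace_zero_iff.2 h2).2 0 le_rfl
    | succ k => exact continuousOn_iteratedFDeriv_succ_iff.2 (h3.2 k (by lia))

theorem CkInSpace.fderiv (hΩ : IsOpen Ω) {f : ℝ → E d → F} (hf : CkInSpace J Ω (n + 1) f) :
    CkInSpace J Ω n (fun t => fderiv ℝ (f t)) :=
  ((ckInSpace_succ_iff hΩ).1 hf).2.2

theorem CkInSpace.hasFDerivAt (hΩ : IsOpen Ω) {f : ℝ → E d → F} (hf : CkInSpace J Ω (n + 1) f)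
    {t : ℝ} (ht : t ∈ J) {x : E d} (hx : x ∈ Ω) :
    HasFDerivAt (f t) (_root_.fderiv ℝ (f t) x) x :=
  ((((ckInSpace_succ_iff hΩ).1 hf).1 t ht).differentiableAt (hΩ.mem_nhds hx)).hasFDerivAt

theorem CkInSpace.congr (hΩ : IsOpen Ω) {f g : ℝ → E d → F} (hf : CkInSpace J Ω n f)
    (h : ∀ t ∈ J, EqOn (g t) (f t) Ω) : CkInSpace J Ω n g := by
  refine ⟨fun t ht => (hf.1 t ht).congr (h t ht), fun k hk => (hf.2 k hk).congr ?_⟩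
  rintro ⟨t, x⟩ ⟨ht, hx⟩
  exact ((h t ht).eventuallyEq_of_mem (hΩ.mem_nhds hx)).iteratedFDeriv ℝ k |>.self_of_nhds

theorem CkInSpace.add {f g : ℝ → E d → F} (hΩ : IsOpen Ω) (hf : CkInSpace J Ω n f)
    (hg : CkInSpace J Ω n g) : CkInSpace J Ω n (fun t x => f t x + g t x) := by
  induction n generalizing F with
  | zero =>
    rw [ckInSpace_zero_iff] at *
    exact hf.add hg
  | succ n ih =>
    have hf' := hf
    have hg' := hg
    rw [ckInSpace_succ_iff hΩ] at hf hg ⊢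
    refine ⟨fun t ht => (hf.1 t ht).add (hg.1 t ht), hf.2.1.add hg.2.1, ?_⟩
    refine (ih hf.2.2 hg.2.2).congr hΩ fun t ht x hx => ?_
    exact ((hf'.hasFDerivAt hΩ ht hx).add (hg'.hasFDerivAt hΩ ht hx)).fderiv

theorem CkInSpace.bilinear (hΩ : IsOpen Ω) (B : F₁ →L[ℝ] F₂ →L[ℝ] F) {f : ℝ → E d → F₁}
    {g : ℝ → E d → F₂} (hf : CkInSpace J Ω n f) (hg : CkInSpace J Ω n g) :
    CkInSpace J Ω n (fun t x => B (f t x) (g t x)) := by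
  induction n generalizing F F₁ F₂ with
  | zero =>
    rw [ckInSpace_zero_iff] at *
    exact (B.continuous.comp_continuousOn hf).clm_apply hg
  | succ n ih =>
    have hd : ∀ t ∈ J, ∀ x ∈ Ω, HasFDerivAt (fun x => B (f t x) (g t x))
        (B.precompR (E d) (f t x) (_root_.fderiv ℝ (g t) x) +
          B.precompL (E d) (_root_.fderiv ℝ (f t) x) (g t x)) x := fun t ht x hx =>
      B.hasFDerivAt_of_bilinear (hf.hasFDerivAt hΩ ht hx) (hg.hasFDerivAt hΩ ht hx)
    rw [ckInSpace_succ_iff hΩ]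
    refine ⟨fun t ht x hx => (hd t ht x hx).differentiableAt.differentiableWithinAt,
      (B.continuous.comp_continuousOn hf.continuousOn).clm_apply hg.continuousOn, ?_⟩
    refine ((ih (B.precompR (E d)) (hf.of_le n.le_succ) (hg.fderiv hΩ)).add hΩ
      (ih (B.precompL (E d)) (hf.fderiv hΩ) (hg.of_le n.le_succ))).congr hΩ fun t ht x hx => ?_
    exact (hd t ht x hx).fderiv

theorem ckInSpace_const (c : F) : CkInSpace J Ω n (fun _ _ => c) := by
  refine ⟨fun t _ => contDiffOn_const, fun k _ => ?_⟩
  cases k with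
  | zero =>
    simp only [iteratedFDeriv_zero_eq_comp, Function.comp_def]
    exact continuousOn_const
  | succ k =>
    simp only [iteratedFDeriv_const_of_ne (Nat.succ_ne_zero k)]
    exact continuousOn_const

theorem CkInSpace.clm_comp (hΩ : IsOpen Ω) (L : F₁ →L[ℝ] F) {f : ℝ → E d → F₁}
    (hf : CkInSpace J Ω n f) : CkInSpace J Ω n (fun t x => L (f t x)) :=
  CkInSpace.bilinear hΩ (ContinuousLinearMap.id ℝ (F₁ →L[ℝ] F)) (ckInSpace_const L) hf

theorem CkInSpace.inv (hΩ : IsOpen Ω) {f : ℝ → E d → ℝ} (hf : CkInSpace J Ω n f)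
    (h0 : ∀ t ∈ J, ∀ x ∈ Ω, f t x ≠ 0) : CkInSpace J Ω n (fun t x => (f t x)⁻¹) := by
  induction n with
  | zero =>
    rw [ckInSpace_zero_iff] at *
    exact hf.inv₀ fun p hp => h0 p.1 hp.1 p.2 hp.2
  | succ n ih =>
    have hd : ∀ t ∈ J, ∀ x ∈ Ω, HasFDerivAt (fun x => (f t x)⁻¹)
        (-(f t x ^ 2)⁻¹ • _root_.fderiv ℝ (f t) x) x := fun t ht x hx =>
      (hasDerivAt_inv (h0 t ht x hx)).comp_hasFDerivAt x (hf.hasFDerivAt hΩ ht hx)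
    rw [ckInSpace_succ_iff hΩ]
    refine ⟨fun t ht x hx => (hd t ht x hx).differentiableAt.differentiableWithinAt,
      hf.continuousOn.inv₀ fun p hp => h0 p.1 hp.1 p.2 hp.2, ?_⟩
    have hi := ih (hf.of_le n.le_succ)
    have h2 := CkInSpace.bilinear hΩ (ContinuousLinearMap.mul ℝ ℝ) hi hi
    have h3 := CkInSpace.clm_comp hΩ (-(ContinuousLinearMap.id ℝ ℝ)) h2
    refine (CkInSpace.bilinear hΩ (ContinuousLinearMap.lsmul ℝ ℝ) h3 (hf.fderiv hΩ)).congr hΩ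
      fun t ht x hx => ?_
    simp only [(hd t ht x hx).fderiv]
    simp [sq]

end CkInSpace

section Velocity

variable {d : ℕ} {J : Set ℝ} {Ω : Set (E d)} {n : ℕ}

theorem CkInSpace.velocity (hΩ : IsOpen Ω) {b s : ℝ → E d → E d} {D : ℝ → E d → E d →L[ℝ] E d}
    (hb : CkInSpace J Ω n b) (hD : CkInSpace J Ω n D) (hs : CkInSpace J Ω n s) :
    CkInSpace J Ω n (velocity b D s) := by
  have h1 := CkInSpace.bilinear hΩ (ContinuousLinearMap.id ℝ (E d →L[ℝ] E d)) hD hs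
  have h2 := CkInSpace.clm_comp hΩ (-(ContinuousLinearMap.id ℝ (E d))) h1
  refine (hb.add hΩ h2).congr hΩ fun t _ x _ => ?_
  simp [SBTM.velocity, sub_eq_add_neg]

theorem hasGradientAt_log {ρ : E d → ℝ} {x g : E d} (hρ : HasGradientAt ρ g x)
    (h0 : ρ x ≠ 0) : HasGradientAt (fun y => Real.log (ρ y)) ((ρ x)⁻¹ • g) x := by
  rw [hasGradientAt_iff_hasFDerivAt] at *
  simpa using hρ.log h0

theorem score_eq {ρ : E d → ℝ} {x : E d} (hρ : DifferentiableAt ℝ ρ x) (h0 : ρ x ≠ 0) :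
    score ρ x = (ρ x)⁻¹ • gradient ρ x :=
  (hasGradientAt_log hρ.hasGradientAt h0).gradient

theorem CkInSpace.score (hΩ : IsOpen Ω) {ρ : ℝ → E d → ℝ} (hρ : CkInSpace J Ω (n + 1) ρ)
    (h0 : ∀ t ∈ J, ∀ x ∈ Ω, ρ t x ≠ 0) : CkInSpace J Ω n (fun t => score (ρ t)) := by
  have h1 := CkInSpace.bilinear hΩ (ContinuousLinearMap.lsmul ℝ ℝ)
    ((hρ.of_le n.le_succ).inv hΩ h0) (hρ.fderiv hΩ)
  have h2 := CkInSpace.clm_comp hΩ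
    ((InnerProductSpace.toDual ℝ (E d)).symm.toContinuousLinearEquiv.toContinuousLinearMap) h1
  refine h2.congr hΩ fun t ht x hx => ?_
  simp only [score_eq (hρ.hasFDerivAt hΩ ht hx).differentiableAt (h0 t ht x hx), gradient]
  simp

end Velocity

section Existence

theorem le_exp_mul_of_abs_deriv_le {φ φ' : ℝ → ℝ} {a b K : ℝ} (hab : a ≤ b)
    (hc : ContinuousOn φ (Icc a b)) (hd : ∀ t ∈ Ioo a b, HasDerivAt φ (φ' t) t)
    (hb : ∀ t ∈ Ioo a b, |φ' t| ≤ K * φ t) :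
    φ b ≤ Real.exp (K * (b - a)) * φ a ∧ φ a ≤ Real.exp (K * (b - a)) * φ b := by
  have hexp : ∀ (c t : ℝ), HasDerivAt (fun t => Real.exp (c * t)) (Real.exp (c * t) * c) t := by
    intro c t
    simpa using ((hasDerivAt_id t).const_mul c).exp
  have hder : ∀ (c : ℝ), ∀ t ∈ Ioo a b, HasDerivAt (fun t => Real.exp (c * t) * φ t)
      (Real.exp (c * t) * (c * φ t + φ' t)) t := by
    intro c t ht
    exact ((hexp c t).mul (hd t ht)).congr_deriv (by ring)
  have hcont : ∀ c : ℝ, ContinuousOn (fun t => Real.exp (c * t) * φ t) (Icc a b) := fun c =>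
    (Continuous.continuousOn (by fun_prop)).mul hc
  have h1 : AntitoneOn (fun t => Real.exp (-K * t) * φ t) (Icc a b) := by
    refine antitoneOn_of_deriv_nonpos (convex_Icc a b) (hcont _) ?_ ?_ <;> rw [interior_Icc]
    · exact fun t ht => (hder _ t ht).differentiableAt.differentiableWithinAt
    · intro t ht
      rw [(hder _ t ht).deriv]
      have := abs_le.1 (hb t ht)
      exact mul_nonpos_of_nonneg_of_nonpos (Real.exp_pos _).le (by linarith)
  have h2 : MonotoneOn (fun t => Real.exp (K * t) * φ t) (Icc a b) := by
    refine monotoneOn_of_deriv_nonneg (convex_Icc a b) (hcont _) ?_ ?_ <;> rw [interior_Icc]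
    · exact fun t ht => (hder _ t ht).differentiableAt.differentiableWithinAt
    · intro t ht
      rw [(hder _ t ht).deriv]
      have := abs_le.1 (hb t ht)
      exact mul_nonneg (Real.exp_pos _).le (by linarith)
  have h1' := h1 (left_mem_Icc.2 hab) (right_mem_Icc.2 hab) hab
  have h2' := h2 (left_mem_Icc.2 hab) (right_mem_Icc.2 hab) hab
  simp only at h1' h2'
  constructor
  · have := mul_le_mul_of_nonneg_left h1' (Real.exp_pos (K * b)).le
    rw [← mul_assoc, ← mul_assoc, ← Real.exp_add, ← Real.exp_add, neg_mul, add_neg_cancel,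
      Real.exp_zero, one_mul] at this
    rwa [show K * (b - a) = K * b + -K * a by ring]
  · have := mul_le_mul_of_nonneg_left h2' (Real.exp_pos (-K * a)).le
    rw [← mul_assoc, ← mul_assoc, ← Real.exp_add, ← Real.exp_add, neg_mul, neg_add_cancel,
      Real.exp_zero, one_mul] at this
    rwa [show K * (b - a) = -(K * a) + K * b by ring]

variable {F : Type*} [NormedAddCommGroup F] [NormedSpace ℝ F]

/-- `y` is an integral curve of `v` in `Ω` over the time set `J`. -/
def IsSol (J : Set ℝ) (Ω : Set F) (v : ℝ → F → F) (y : ℝ → F) : Prop :=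
  ∀ t ∈ J, y t ∈ Ω ∧ HasDerivWithinAt y (v t (y t)) J t

variable {Ω : Set F} {v : ℝ → F → F} {J J' : Set ℝ} {y : ℝ → F}

theorem IsSol.mono (h : IsSol J Ω v y) (hJ : J' ⊆ J) : IsSol J' Ω v y :=
  fun t ht => ⟨(h t (hJ ht)).1, (h t (hJ ht)).2.mono hJ⟩

theorem IsSol.continuousOn (h : IsSol J Ω v y) : ContinuousOn y J :=
  fun t ht => (h t ht).2.continuousWithinAt

theorem IsSol.hasDerivAt (h : IsSol J Ω v y) {t : ℝ} (ht : J ∈ 𝓝 t) :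
    HasDerivAt y (v t (y t)) t :=
  (h t (mem_of_mem_nhds ht)).2.hasDerivAt ht

theorem IsSol.congr {z : ℝ → F} (h : IsSol J Ω v y) (hz : EqOn z y J) : IsSol J Ω v z := by
  intro t ht
  rw [hz ht]
  exact ⟨(h t ht).1, (h t ht).2.congr (fun s hs => hz hs) (hz ht)⟩

theorem IsSol.append {a b c : ℝ} {z : ℝ → F} (hy : IsSol (Icc a b) Ω v y)
    (hz : IsSol (Icc b c) Ω v z) (h : y b = z b) (hab : a ≤ b) (hbc : b ≤ c) :
    IsSol (Icc a c) Ω v (fun t => if t ≤ b then y t else z t) := by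
  have h1 : IsSol (Icc a b) Ω v (fun t => if t ≤ b then y t else z t) :=
    hy.congr fun t ht => by simp [ht.2]
  have h2 : IsSol (Icc b c) Ω v (fun t => if t ≤ b then y t else z t) := by
    refine hz.congr fun t ht => ?_
    rcases ht.1.eq_or_lt with rfl | hlt
    · simpa using h
    · simp [hlt]
  intro t ht
  rw [← Icc_union_Icc_eq_Icc hab hbc]
  rcases lt_trichotomy t b with hlt | rfl | hlt
  · refine ⟨(h1 t ⟨ht.1, hlt.le⟩).1, (h1 t ⟨ht.1, hlt.le⟩).2.mono_of_mem_nhdsWithin ?_⟩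
    refine mem_nhdsWithin.2 ⟨Iio b, isOpen_Iio, hlt, ?_⟩
    rintro s ⟨hs, hs'⟩
    rcases hs' with hs' | hs'
    · exact hs'
    · exact absurd hs (not_lt.2 hs'.1)
  · exact ⟨(h1 t ⟨ht.1, le_rfl⟩).1, (h1 t ⟨ht.1, le_rfl⟩).2.union (h2 t ⟨le_rfl, ht.2⟩).2⟩
  · refine ⟨(h2 t ⟨hlt.le, ht.2⟩).1, (h2 t ⟨hlt.le, ht.2⟩).2.mono_of_mem_nhdsWithin ?_⟩
    refine mem_nhdsWithin.2 ⟨Ioi b, isOpen_Ioi, hlt, ?_⟩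
    rintro s ⟨hs, hs'⟩
    rcases hs' with hs' | hs'
    · exact absurd hs (not_lt.2 hs'.2)
    · exact hs'

theorem IsSol.eqOn_Icc {z : ℝ → F} {a b : ℝ} (hy : IsSol (Icc a b) Ω v y)
    (hz : IsSol (Icc a b) Ω v z)
    (hlip : ∀ R, ∃ L, ∀ t ∈ Icc a b, ∀ x ∈ Ω, ∀ y ∈ Ω, ‖x‖ ≤ R → ‖y‖ ≤ R →
      ‖v t x - v t y‖ ≤ L * ‖x - y‖)
    (h : y a = z a) : EqOn y z (Icc a b) := by
  obtain ⟨R₁, hR₁⟩ := (isCompact_Icc.image_of_continuousOn hy.continuousOn).isBounded.exists_norm_le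
  obtain ⟨R₂, hR₂⟩ := (isCompact_Icc.image_of_continuousOn hz.continuousOn).isBounded.exists_norm_le
  obtain ⟨L, hL⟩ := hlip (max R₁ R₂)
  refine ODE_solution_unique_of_mem_Icc_right (v := v) (K := L.toNNReal)
    (s := fun t => {x | x ∈ Ω ∧ ‖x‖ ≤ max R₁ R₂}) ?_ hy.continuousOn ?_ ?_ hz.continuousOn ?_ ?_ h
  · intro t ht
    refine LipschitzOnWith.of_dist_le_mul fun x hx z hz => ?_
    rw [dist_eq_norm, dist_eq_norm]
    exact (hL t ⟨ht.1, ht.2.le⟩ x hx.1 z hz.1 hx.2 hz.2).trans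
      (mul_le_mul_of_nonneg_right (Real.le_coe_toNNReal L) (norm_nonneg _))
  · intro t ht
    exact ((hy t ⟨ht.1, ht.2.le⟩).2).mono_of_mem_nhdsWithin (Icc_mem_nhdsGE_of_mem ht)
  · intro t ht
    exact ⟨(hy t ⟨ht.1, ht.2.le⟩).1,
      (hR₁ _ (mem_image_of_mem _ ⟨ht.1, ht.2.le⟩)).trans (le_max_left _ _)⟩
  · intro t ht
    exact ((hz t ⟨ht.1, ht.2.le⟩).2).mono_of_mem_nhdsWithin (Icc_mem_nhdsGE_of_mem ht)
  · intro t ht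
    exact ⟨(hz t ⟨ht.1, ht.2.le⟩).1,
      (hR₂ _ (mem_image_of_mem _ ⟨ht.1, ht.2.le⟩)).trans (le_max_right _ _)⟩

variable [CompleteSpace F]

theorem exists_isSol_local {T τ : ℝ} (hΩ : IsOpen Ω) (hτ : 0 ≤ τ) (hτT : τ < T)
    (hcont : ∀ x ∈ Ω, ContinuousOn (fun t => v t x) (Icc 0 T))
    (hlip : ∀ R, ∃ L, ∀ t ∈ Icc 0 T, ∀ x ∈ Ω, ∀ y ∈ Ω, ‖x‖ ≤ R → ‖y‖ ≤ R →
      ‖v t x - v t y‖ ≤ L * ‖x - y‖)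
    (hgrow : ∃ C, ∀ t ∈ Icc 0 T, ∀ x ∈ Ω, ‖v t x‖ ≤ C * (1 + ‖x‖))
    {z : F} (hz : z ∈ Ω) :
    ∃ σ, τ < σ ∧ σ ≤ T ∧ ∃ y, y τ = z ∧ IsSol (Icc τ σ) Ω v y := by
  obtain ⟨r, hr, hball⟩ := Metric.nhds_basis_closedBall.mem_iff.1 (hΩ.mem_nhds hz)
  have hnorm : ∀ x ∈ Metric.closedBall z r, ‖x‖ ≤ ‖z‖ + r := fun x hx => by
    have := norm_le_norm_add_norm_sub' x z
    rw [mem_closedBall_iff_norm] at hx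
    linarith
  obtain ⟨L, hL⟩ := hlip (‖z‖ + r)
  obtain ⟨C, hC⟩ := hgrow
  set B : ℝ := max C 0 * (1 + (‖z‖ + r)) with hB
  have hB0 : 0 ≤ B := by positivity
  set ε : ℝ := min (T - τ) (r / (B + 1)) with hε
  have hε0 : 0 < ε := lt_min (by linarith) (by positivity)
  have hεr : B * ε ≤ r := by
    calc B * ε ≤ (B + 1) * (r / (B + 1)) := by
          gcongr
          · linarith
          · exact min_le_right _ _
      _ = r := by field_simp
  have hεT : τ + ε ≤ T := by linarith [min_le_left (T - τ) (r / (B + 1))]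
  have hsub : Icc τ (τ + ε) ⊆ Icc 0 T := Icc_subset_Icc hτ hεT
  have hPL : IsPicardLindelof v (tmin := τ) (tmax := τ + ε) ⟨τ, le_rfl, by linarith⟩ z
      r.toNNReal 0 B.toNNReal L.toNNReal := by
    constructor
    · intro t ht
      rw [Real.coe_toNNReal r hr.le]
      refine LipschitzOnWith.of_dist_le_mul fun x hx y hy => ?_
      rw [dist_eq_norm, dist_eq_norm]
      exact (hL t (hsub ht) x (hball hx) y (hball hy) (hnorm x hx) (hnorm y hy)).trans
        (mul_le_mul_of_nonneg_right (Real.le_coe_toNNReal L) (norm_nonneg _))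
    · intro x hx
      rw [Real.coe_toNNReal r hr.le] at hx
      exact (hcont x (hball hx)).mono hsub
    · intro t ht x hx
      rw [Real.coe_toNNReal r hr.le] at hx
      rw [Real.coe_toNNReal B hB0]
      refine (hC t (hsub ht) x (hball hx)).trans ?_
      rw [hB]
      gcongr
      · exact le_max_left _ _
      · exact hnorm x hx
    · simp only [Real.coe_toNNReal r hr.le, Real.coe_toNNReal B hB0]
      simpa [hε0.le] using hεr
  obtain ⟨y, hy0, hy⟩ := hPL.exists_eq_forall_mem_Icc_hasDerivWithinAt₀
  simp only at hy0
  have hyc : ContinuousWithinAt y (Icc τ (τ + ε)) τ :=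
    (hy τ ⟨le_rfl, by linarith⟩).continuousWithinAt
  have hmem : ∀ᶠ t in 𝓝[Icc τ (τ + ε)] τ, y t ∈ Ω := by
    apply hyc
    rw [hy0]
    exact hΩ.mem_nhds hz
  obtain ⟨δ, hδ, hδ'⟩ := Metric.mem_nhdsWithin_iff.1 hmem
  set σ := τ + min ε (δ / 2)
  have hσ : 0 < min ε (δ / 2) := lt_min hε0 (by linarith)
  have hsub2 : Icc τ σ ⊆ Icc τ (τ + ε) :=
    Icc_subset_Icc_right (by simp only [σ]; linarith [min_le_left ε (δ / 2)])
  refine ⟨σ, by simp only [σ]; linarith,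
    by simp only [σ]; linarith [min_le_left ε (δ / 2)], y, hy0, fun t ht => ⟨?_, ?_⟩⟩
  · refine hδ' ⟨?_, hsub2 ht⟩
    rw [Metric.mem_ball, Real.dist_eq, abs_of_nonneg (by linarith [ht.1])]
    have := ht.2
    simp only [σ] at this
    linarith [min_le_right ε (δ / 2)]
  · exact (hy t (hsub2 ht)).mono hsub2

theorem exists_isSol_closed_aux {T : ℝ} {x₀ : F}
    (hcont : ContinuousOn (fun p : ℝ × F => v p.1 p.2) (Icc 0 T ×ˢ Ω))
    (hlip : ∀ R, ∃ L, ∀ t ∈ Icc 0 T, ∀ x ∈ Ω, ∀ y ∈ Ω, ‖x‖ ≤ R → ‖y‖ ≤ R →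
      ‖v t x - v t y‖ ≤ L * ‖x - y‖)
    (hgrow : ∃ C, ∀ t ∈ Icc 0 T, ∀ x ∈ Ω, ‖v t x‖ ≤ C * (1 + ‖x‖))
    (hexit : ∀ c y, 0 < c → c ≤ T → (∀ t ∈ Ioo 0 c, y t ∈ Ω ∧ HasDerivAt y (v t (y t)) t) →
      ∀ z, Tendsto y (𝓝[<] c) (𝓝 z) → z ∈ Ω)
    {c : ℝ} (hc : 0 < c) (hcT : c ≤ T)
    (hS : ∀ τ ∈ Ico 0 c, ∃ y, y 0 = x₀ ∧ IsSol (Icc 0 τ) Ω v y) :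
    ∃ y, y 0 = x₀ ∧ IsSol (Icc 0 c) Ω v y := by
  choose! Y hY0 hY using hS
  have hcons : ∀ τ ∈ Ico 0 c, ∀ σ ∈ Ico 0 c, τ ≤ σ → EqOn (Y τ) (Y σ) (Icc 0 τ) := by
    intro τ hτ σ hσ hle
    refine (hY τ hτ).eqOn_Icc ((hY σ hσ).mono (Icc_subset_Icc_right hle)) ?_
      ((hY0 τ hτ).trans (hY0 σ hσ).symm)
    intro R
    obtain ⟨L, hL⟩ := hlip R
    exact ⟨L, fun t ht => hL t ⟨ht.1, ht.2.trans (hτ.2.le.trans hcT)⟩⟩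
  set y : ℝ → F := fun t => Y t t with hy
  have hyeq : ∀ τ ∈ Ico 0 c, EqOn y (Y τ) (Icc 0 τ) := fun τ hτ t ht =>
    hcons t ⟨ht.1, ht.2.trans_lt hτ.2⟩ τ hτ ht.2 ⟨ht.1, le_rfl⟩
  have hsol : ∀ τ ∈ Ico 0 c, IsSol (Icc 0 τ) Ω v y := fun τ hτ => (hY τ hτ).congr (hyeq τ hτ)
  have hy0 : y 0 = x₀ := hY0 0 ⟨le_rfl, hc⟩
  have hder : ∀ t ∈ Ioo 0 c, y t ∈ Ω ∧ HasDerivAt y (v t (y t)) t := by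
    intro t ht
    have hmid : (t + c) / 2 ∈ Ico 0 c := ⟨by linarith [ht.1, hc], by linarith [ht.2]⟩
    have hn : Icc 0 ((t + c) / 2) ∈ 𝓝 t := Icc_mem_nhds ht.1 (by linarith [ht.2])
    exact ⟨(hsol _ hmid t (mem_of_mem_nhds hn)).1, (hsol _ hmid).hasDerivAt hn⟩
  have hder' : ∀ t ∈ Ico 0 c, y t ∈ Ω ∧ HasDerivWithinAt y (v t (y t)) (Ici t) t := by
    intro t ht
    have hmid : (t + c) / 2 ∈ Ico 0 c := ⟨by linarith [ht.1, hc], by linarith [ht.2]⟩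
    have hn : Icc 0 ((t + c) / 2) ∈ 𝓝[≥] t := Icc_mem_nhdsGE_of_mem ⟨ht.1, by linarith [ht.2]⟩
    have := hsol _ hmid t ⟨ht.1, by linarith [ht.2]⟩
    exact ⟨this.1, this.2.mono_of_mem_nhdsWithin hn⟩
  have hycont : ContinuousOn y (Ico 0 c) := by
    intro t ht
    have hmid : (t + c) / 2 ∈ Ico 0 c := ⟨by linarith [ht.1, hc], by linarith [ht.2]⟩
    refine ((hsol _ hmid).continuousOn t ⟨ht.1, by linarith [ht.2]⟩).mono_of_mem_nhdsWithin ?_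
    refine mem_nhdsWithin.2 ⟨Iio ((t + c) / 2), isOpen_Iio, by simp; linarith [ht.2], ?_⟩
    rintro s ⟨hs, hs'⟩
    exact ⟨hs'.1, le_of_lt hs⟩
  obtain ⟨C, hC⟩ := hgrow
  set C' := max C 0
  have hbound : ∀ t ∈ Ico 0 c, ‖y t‖ ≤ gronwallBound ‖x₀‖ C' C' c := by
    intro t ht
    have hsub : Icc 0 t ⊆ Ico 0 c := fun s hs => ⟨hs.1, hs.2.trans_lt ht.2⟩
    have := norm_le_gronwallBound_of_norm_deriv_right_le (f := y) (f' := fun t => v t (y t))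
      (δ := ‖x₀‖) (K := C') (ε := C') (a := 0) (b := t) (hycont.mono hsub)
      (fun s hs => (hder' s (hsub ⟨hs.1, hs.2.le⟩)).2) (by rw [hy0]) ?_ t ⟨ht.1, le_rfl⟩
    · refine this.trans ?_
      rw [sub_zero]
      exact gronwallBound_mono (norm_nonneg _) (le_max_right _ _) (le_max_right _ _) ht.2.le
    · intro s hs
      have hs' := hsub ⟨hs.1, hs.2.le⟩
      have := hC s ⟨hs'.1, hs'.2.le.trans hcT⟩ (y s) (hder' s hs').1
      have h2 : C * (1 + ‖y s‖) ≤ C' * (1 + ‖y s‖) := by gcongr; exact le_max_left _ _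
      linarith
  set V := C' * (1 + gronwallBound ‖x₀‖ C' C' c) with hV
  have hVb : ∀ t ∈ Ico 0 c, ‖v t (y t)‖ ≤ V := by
    intro t ht
    refine (hC t ⟨ht.1, ht.2.le.trans hcT⟩ (y t) (hder' t ht).1).trans ?_
    rw [hV]
    gcongr
    · exact le_max_left _ _
    · exact hbound t ht
  have hLip : LipschitzOnWith V.toNNReal y (Ioo 0 c) := by
    refine (convex_Ioo 0 c).lipschitzOnWith_of_nnnorm_hasDerivWithin_le (f' := fun t => v t (y t))
      (fun t ht => (hder t ht).2.hasDerivWithinAt) fun t ht => ?_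
    rw [← NNReal.coe_le_coe, coe_nnnorm]
    exact (hVb t ⟨ht.1.le, ht.2⟩).trans (Real.le_coe_toNNReal V)
  obtain ⟨z, hz⟩ : ∃ z, Tendsto y (𝓝[<] c) (𝓝 z) := by
    have hcau : Cauchy (map y (𝓝[<] c)) := by
      rw [← nhdsWithin_Ioo_eq_nhdsLT hc]
      have : (𝓝[Ioo 0 c] c).NeBot := by
        rw [nhdsWithin_Ioo_eq_nhdsLT hc]
        infer_instance
      have hcauchy : Cauchy (𝓝[Ioo 0 c] c) :=
        (cauchy_nhds (a := c)).mono nhdsWithin_le_nhds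
      exact hcauchy.map_of_le hLip.uniformContinuousOn inf_le_right
    exact cauchy_map_iff_exists_tendsto.1 hcau
  have hzΩ : z ∈ Ω := hexit c y hc hcT hder z hz
  set w : ℝ → F := Function.update y c z with hw
  have hweq : EqOn w y (Ico 0 c) := fun t ht => by
    rw [hw, Function.update_of_ne ht.2.ne]
  have hwc : w c = z := Function.update_self ..
  refine ⟨w, by rw [hweq ⟨le_rfl, hc⟩, hy0], fun t ht => ?_⟩
  rcases ht.2.eq_or_lt with rfl | htc
  · rw [hwc]
    refine ⟨hzΩ, ?_⟩
    have hev : w =ᶠ[𝓝[<] t] y := by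
      filter_upwards [self_mem_nhdsWithin] with s hs
      rw [hw, Function.update_of_ne (ne_of_lt hs)]
    have hwcont : Tendsto w (𝓝[<] t) (𝓝 z) := hz.congr' hev.symm
    have hderw : ∀ s ∈ Ioo 0 t, HasDerivAt w (v s (y s)) s := fun s hs =>
      (hder s hs).2.congr_of_eventuallyEq <| by
        filter_upwards [Ioo_mem_nhds hs.1 hs.2] with r hr
        exact hweq ⟨hr.1.le, hr.2⟩
    have hlim : Tendsto (fun s => v s (y s)) (𝓝[<] t) (𝓝 (v t z)) := by
      have h1 : Tendsto (fun s => ((s, y s) : ℝ × F)) (𝓝[<] t) (𝓝[Icc 0 T ×ˢ Ω] (t, z)) := by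
        refine tendsto_nhdsWithin_iff.2 ⟨?_, ?_⟩
        · exact (tendsto_id.mono_left nhdsWithin_le_nhds).prodMk_nhds hz
        · filter_upwards [Ioo_mem_nhdsLT hc] with s hs
          exact ⟨⟨hs.1.le, hs.2.le.trans hcT⟩, (hder s hs).1⟩
      exact (hcont (t, z) ⟨⟨ht.1, hcT⟩, hzΩ⟩).tendsto.comp h1
    have := hasDerivWithinAt_Iic_of_tendsto_deriv (s := Ioo 0 t) (a := t) (f := w) (e := v t z)
      (fun s hs => (hderw s hs).differentiableAt.differentiableWithinAt)
      (by
        change Tendsto w _ _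
        rw [hwc]
        exact hwcont.mono_left (nhdsWithin_mono _ fun s hs => hs.2))
      (Ioo_mem_nhdsLT hc)
      (hlim.congr' <| by
        filter_upwards [Ioo_mem_nhdsLT hc] with s hs
        exact (hderw s hs).deriv.symm)
    exact this.mono fun s hs => hs.2
  · have hs := hder' t ⟨ht.1, htc⟩
    rw [hweq ⟨ht.1, htc⟩]
    refine ⟨hs.1, ?_⟩
    have hmid : (t + c) / 2 ∈ Ico 0 c := ⟨by linarith [ht.1, hc], by linarith [ht.2]⟩
    have h2 := (hsol _ hmid t ⟨ht.1, by linarith⟩).2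
    have h3 : HasDerivWithinAt w (v t (y t)) (Icc 0 ((t + c) / 2)) t :=
      h2.congr (fun s hs => hweq ⟨hs.1, hs.2.trans_lt hmid.2⟩) (hweq ⟨ht.1, htc⟩)
    refine h3.mono_of_mem_nhdsWithin ?_
    refine mem_nhdsWithin.2 ⟨Iio ((t + c) / 2), isOpen_Iio, by simp; linarith, ?_⟩
    rintro s ⟨hs, hs'⟩
    exact ⟨hs'.1, le_of_lt hs⟩

/-- Global existence for a locally Lipschitz field of linear growth whose integral curves do not
leave `Ω`. -/
theorem exists_isSol_Icc {T : ℝ} (hT : 0 ≤ T) (hΩ : IsOpen Ω)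
    (hcont : ContinuousOn (fun p : ℝ × F => v p.1 p.2) (Icc 0 T ×ˢ Ω))
    (hlip : ∀ R, ∃ L, ∀ t ∈ Icc 0 T, ∀ x ∈ Ω, ∀ y ∈ Ω, ‖x‖ ≤ R → ‖y‖ ≤ R →
      ‖v t x - v t y‖ ≤ L * ‖x - y‖)
    (hgrow : ∃ C, ∀ t ∈ Icc 0 T, ∀ x ∈ Ω, ‖v t x‖ ≤ C * (1 + ‖x‖))
    (hexit : ∀ c y, 0 < c → c ≤ T → (∀ t ∈ Ioo 0 c, y t ∈ Ω ∧ HasDerivAt y (v t (y t)) t) →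
      ∀ z, Tendsto y (𝓝[<] c) (𝓝 z) → z ∈ Ω)
    {x₀ : F} (hx₀ : x₀ ∈ Ω) : ∃ y, y 0 = x₀ ∧ IsSol (Icc 0 T) Ω v y := by
  set S : Set ℝ := {τ | ∃ y, y 0 = x₀ ∧ IsSol (Icc 0 τ) Ω v y} with hSdef
  have hmono : ∀ τ ∈ S, ∀ σ ≤ τ, σ ∈ S := by
    rintro τ ⟨y, hy0, hy⟩ σ hσ
    exact ⟨y, hy0, hy.mono (Icc_subset_Icc_right hσ)⟩
  have h0 : (0 : ℝ) ∈ S := by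
    refine ⟨fun _ => x₀, rfl, fun t ht => ?_⟩
    have : t = 0 := by simpa using ht
    subst this
    refine ⟨hx₀, ?_⟩
    simp only [Icc_self]
    exact hasDerivWithinAt_iff_hasFDerivWithinAt.2
      (HasFDerivWithinAt.of_subsingleton subsingleton_singleton)
  suffices Icc 0 T ⊆ S from this (right_mem_Icc.2 hT)
  refine IsClosed.Icc_subset_of_forall_exists_gt ?_ h0 ?_
  · rw [← isSeqClosed_iff_isClosed]
    intro u c hu huc
    have hcI : c ∈ Icc 0 T := isClosed_Icc.mem_of_tendsto huc (Eventually.of_forall fun n => (hu n).2)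
    refine ⟨?_, hcI⟩
    rcases hcI.1.eq_or_lt with rfl | hc
    · exact h0
    · refine exists_isSol_closed_aux hcont hlip hgrow hexit hc hcI.2 fun τ hτ => ?_
      obtain ⟨n, hn⟩ := (huc.eventually (lt_mem_nhds hτ.2)).exists
      exact hmono _ (hu n).1 τ hn.le
  · rintro τ ⟨⟨y, hy0, hy⟩, hτ⟩ σ hσ
    obtain ⟨r, hτr, hrT, z, hz0, hz⟩ := exists_isSol_local hΩ hτ.1 hτ.2
      (fun x hx => hcont.comp (f := fun t => (t, x)) (by fun_prop) fun t ht => ⟨ht, hx⟩)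
      hlip hgrow (hy τ ⟨hτ.1, le_rfl⟩).1
    have happ := hy.append hz hz0.symm hτ.1 hτr.le
    refine ⟨min r σ, hmono r ⟨_, ?_, happ⟩ _ (min_le_left _ _), lt_min hτr hσ, min_le_right _ _⟩
    simp [hτ.1, hy0]

end Existence

/-- An interval of nonnegative times that starts at `0`. -/
structure TimeDomain (J : Set ℝ) : Prop where
  ordConnected : J.OrdConnected
  zero_mem : (0 : ℝ) ∈ J
  nonneg : ∀ t ∈ J, 0 ≤ t

theorem timeDomain_Ici : TimeDomain (Ici 0) :=
  ⟨ordConnected_Ici, self_mem_Ici, fun _ ht => ht⟩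

theorem timeDomain_Icc {T : ℝ} (hT : 0 ≤ T) : TimeDomain (Icc 0 T) :=
  ⟨ordConnected_Icc, left_mem_Icc.2 hT, fun _ ht => ht.1⟩

section TimeDomain

variable {J : Set ℝ}

theorem TimeDomain.Icc_subset (hJ : TimeDomain J) {t : ℝ} (ht : t ∈ J) : Icc 0 t ⊆ J :=
  hJ.ordConnected.out hJ.zero_mem ht

theorem TimeDomain.mem_nhds (hJ : TimeDomain J) {a b t : ℝ} (ha : a ∈ J) (hb : b ∈ J)
    (ht : t ∈ Ioo a b) : J ∈ 𝓝 t :=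
  mem_of_superset (Icc_mem_nhds ht.1 ht.2) (hJ.ordConnected.out ha hb)

theorem exists_isSol_of_forall_Icc (hJ : TimeDomain J)
    {F : Type*} [NormedAddCommGroup F] [NormedSpace ℝ F]
    {Ω : Set F} {v : ℝ → F → F} {x₀ : F}
    (hlip : ∀ T ∈ J, ∀ R, ∃ L, ∀ t ∈ Icc 0 T, ∀ x ∈ Ω, ∀ y ∈ Ω, ‖x‖ ≤ R → ‖y‖ ≤ R →
      ‖v t x - v t y‖ ≤ L * ‖x - y‖)
    (h : ∀ T ∈ J, ∃ y, y 0 = x₀ ∧ IsSol (Icc 0 T) Ω v y) :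
    ∃ y, y 0 = x₀ ∧ IsSol J Ω v y := by
  choose! Y hY0 hY using h
  have hyeq : ∀ τ ∈ J, EqOn (fun t => Y t t) (Y τ) (Icc 0 τ) := fun τ hτ t ht =>
    have htJ : t ∈ J := hJ.Icc_subset hτ ht
    (hY t htJ).eqOn_Icc ((hY τ hτ).mono (Icc_subset_Icc_right ht.2)) (hlip t htJ)
      ((hY0 t htJ).trans (hY0 τ hτ).symm) ⟨ht.1, le_rfl⟩
  have hsol : ∀ τ ∈ J, IsSol (Icc 0 τ) Ω v (fun t => Y t t) := fun τ hτ =>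
    (hY τ hτ).congr (hyeq τ hτ)
  refine ⟨fun t => Y t t, hY0 0 hJ.zero_mem, fun t ht => ?_⟩
  refine ⟨(hsol t ht t ⟨hJ.nonneg t ht, le_rfl⟩).1, ?_⟩
  by_cases hmax : ∃ t' ∈ J, t < t'
  · obtain ⟨t', ht', hlt⟩ := hmax
    refine (hsol t' ht' t ⟨hJ.nonneg t ht, hlt.le⟩).2.mono_of_mem_nhdsWithin ?_
    refine mem_nhdsWithin.2 ⟨Iio t', isOpen_Iio, hlt, ?_⟩
    rintro s ⟨hs, hs'⟩
    exact ⟨hJ.nonneg s hs', le_of_lt hs⟩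
  · push Not at hmax
    exact (hsol t ht t ⟨hJ.nonneg t ht, le_rfl⟩).2.mono fun s hs => ⟨hJ.nonneg s hs, hmax s hs⟩

theorem exists_linear_ode (hJ : TimeDomain J)
    {F : Type*} [NormedAddCommGroup F] [NormedSpace ℝ F] [CompleteSpace F]
    {A : ℝ → F →L[ℝ] F} {c : ℝ → F} (hA : ContinuousOn A J) (hc : ContinuousOn c J) (y₀ : F) :
    ∃ y : ℝ → F, y 0 = y₀ ∧ ∀ t ∈ J, HasDerivWithinAt y (A t (y t) + c t) J t := by
  have hbd : ∀ T ∈ J, ∃ C, ∀ t ∈ Icc 0 T, ‖A t‖ ≤ C ∧ ‖c t‖ ≤ C := by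
    intro T hT
    obtain ⟨C₁, h₁⟩ := isCompact_Icc.exists_bound_of_continuousOn (hA.mono (hJ.Icc_subset hT))
    obtain ⟨C₂, h₂⟩ := isCompact_Icc.exists_bound_of_continuousOn (hc.mono (hJ.Icc_subset hT))
    exact ⟨max C₁ C₂, fun t ht => ⟨(h₁ t ht).trans (le_max_left _ _),
      (h₂ t ht).trans (le_max_right _ _)⟩⟩
  have hlip : ∀ T ∈ J, ∀ R : ℝ, ∃ L, ∀ t ∈ Icc 0 T, ∀ x ∈ (univ : Set F), ∀ y ∈ (univ : Set F),
      ‖x‖ ≤ R → ‖y‖ ≤ R → ‖(A t x + c t) - (A t y + c t)‖ ≤ L * ‖x - y‖ := by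
    intro T hT R
    obtain ⟨C, hC⟩ := hbd T hT
    refine ⟨C, fun t ht x _ y _ _ _ => ?_⟩
    rw [add_sub_add_right_eq_sub, ← map_sub]
    exact (A t).le_of_opNorm_le (hC t ht).1 _
  obtain ⟨y, hy0, hy⟩ := exists_isSol_of_forall_Icc (v := fun t x => A t x + c t) (x₀ := y₀)
    hJ hlip fun T hT => by
    refine exists_isSol_Icc (hJ.nonneg T hT) isOpen_univ ?_ (hlip T hT) ?_
      (fun _ _ _ _ _ _ _ => mem_univ _) (mem_univ _)
    · have h1 : ContinuousOn (fun p : ℝ × F => A p.1) (Icc 0 T ×ˢ univ) :=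
        (hA.mono (hJ.Icc_subset hT)).comp continuousOn_fst fun p hp => hp.1
      have h2 : ContinuousOn (fun p : ℝ × F => c p.1) (Icc 0 T ×ˢ univ) :=
        (hc.mono (hJ.Icc_subset hT)).comp continuousOn_fst fun p hp => hp.1
      exact (h1.clm_apply continuousOn_snd).add h2
    · obtain ⟨C, hC⟩ := hbd T hT
      refine ⟨C, fun t ht x _ => (norm_add_le _ _).trans ?_⟩
      have := (A t).le_of_opNorm_le (hC t ht).1 x
      linarith [(hC t ht).2]
  exact ⟨y, hy0, fun t ht => (hy t ht).2⟩

end TimeDomain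

/-- The hypotheses on a velocity field under which its flow is a family of diffeomorphisms
of `Ω`. -/
structure FlowField {d : ℕ} (J : Set ℝ) (Ω : Set (E d)) (v : ℝ → E d → E d) : Prop where
  isOpen : IsOpen Ω
  C2 : CkInSpace J Ω 2 v
  growth : ∀ T : ℝ, ∃ C : ℝ, ∀ t ∈ J, t ≤ T → ∀ x ∈ Ω, ‖v t x‖ ≤ C * (1 + ‖x‖)
  lipschitz : LipschitzOnBounded J Ω v
  noExit : NoExit J Ω v

/-- `X_t(x)`, `t ∈ J`, is the integral curve of `v` in `Ω` that starts at `x`. -/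
structure IsFlow {d : ℕ} (J : Set ℝ) (Ω : Set (E d)) (v : ℝ → E d → E d)
    (X : ℝ → E d → E d) : Prop where
  init : ∀ x ∈ Ω, X 0 x = x
  sol : ∀ x ∈ Ω, IsSol J Ω v (fun t => X t x)

section Flow

variable {d : ℕ} {J : Set ℝ} {Ω : Set (E d)} {v : ℝ → E d → E d} {X : ℝ → E d → E d}

theorem le_exp_mul_abs_sub_of_abs_deriv_le (hJ : TimeDomain J) {φ φ' : ℝ → ℝ} {T K : ℝ}
    (hd : ∀ t ∈ J, HasDerivWithinAt φ (φ' t) J t) (hb : ∀ t ∈ J, t ≤ T → |φ' t| ≤ K * φ t)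
    {s t : ℝ} (hs : s ∈ J) (ht : t ∈ J) (hsT : s ≤ T) (htT : t ≤ T) :
    φ t ≤ Real.exp (K * |t - s|) * φ s := by
  have key : ∀ a ∈ J, ∀ b ∈ J, a ≤ b → b ≤ T →
      φ b ≤ Real.exp (K * (b - a)) * φ a ∧ φ a ≤ Real.exp (K * (b - a)) * φ b := by
    intro a ha b hb' hab hbT
    have hsub : Icc a b ⊆ J := hJ.ordConnected.out ha hb'
    exact le_exp_mul_of_abs_deriv_le hab
      (fun r hr => (hd r (hsub hr)).continuousWithinAt.mono hsub)
      (fun r hr => (hd r (hsub ⟨hr.1.le, hr.2.le⟩)).hasDerivAt (hJ.mem_nhds ha hb' hr))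
      (fun r hr => hb r (hsub ⟨hr.1.le, hr.2.le⟩) (hr.2.le.trans hbT))
  rcases le_total s t with h | h
  · rw [abs_of_nonneg (sub_nonneg.2 h)]
    exact (key s hs t ht h htT).1
  · rw [abs_of_nonpos (sub_nonpos.2 h), neg_sub]
    exact (key t ht s hs h hsT).2

theorem FlowField.exists_norm_sq_le (hv : FlowField J Ω v) (hJ : TimeDomain J) (T : ℝ) :
    ∃ C ≥ 0, ∀ y, IsSol J Ω v y → ∀ s ∈ J, s ≤ T → ∀ t ∈ J, t ≤ T →
      1 + ‖y t‖ ^ 2 ≤ Real.exp (C * |t - s|) * (1 + ‖y s‖ ^ 2) := by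
  obtain ⟨C, hC⟩ := hv.growth T
  refine ⟨4 * max C 0, by positivity, fun y hy s hs hsT t ht htT => ?_⟩
  refine le_exp_mul_abs_sub_of_abs_deriv_le (φ := fun t => 1 + ‖y t‖ ^ 2)
    (φ' := fun t => 2 * inner ℝ (y t) (v t (y t))) hJ
    (fun r hr => ((hy r hr).2.norm_sq).const_add 1) (fun r hr hrT => ?_) hs ht hsT htT
  have h1 := abs_real_inner_le_norm (y r) (v r (y r))
  have h2 : ‖v r (y r)‖ ≤ max C 0 * (1 + ‖y r‖) :=
    (hC r hr hrT _ (hy r hr).1).trans (by gcongr; exact le_max_left _ _)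
  rw [abs_mul, abs_of_pos (two_pos : (0 : ℝ) < 2)]
  have h3 : ‖y r‖ * ‖v r (y r)‖ ≤ ‖y r‖ * (max C 0 * (1 + ‖y r‖)) := by gcongr
  have h4 : ‖y r‖ * (1 + ‖y r‖) ≤ 2 * (1 + ‖y r‖ ^ 2) := by nlinarith [sq_nonneg (‖y r‖ - 1)]
  have h5 := mul_le_mul_of_nonneg_left h4 (le_max_right C 0)
  nlinarith

theorem FlowField.exists_dist_le (hv : FlowField J Ω v) (hJ : TimeDomain J) (T R : ℝ) :
    ∃ L ≥ 0, ∀ y z, IsSol J Ω v y → IsSol J Ω v z → (∀ t ∈ J, t ≤ T → ‖y t‖ ≤ R) →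
      (∀ t ∈ J, t ≤ T → ‖z t‖ ≤ R) → ∀ s ∈ J, s ≤ T → ∀ t ∈ J, t ≤ T →
      ‖y t - z t‖ ≤ Real.exp (L * |t - s|) * ‖y s - z s‖ := by
  obtain ⟨L, hL⟩ := hv.lipschitz T R
  refine ⟨max L 0, le_max_right _ _, fun y z hy hz hyR hzR s hs hsT t ht htT => ?_⟩
  have h := le_exp_mul_abs_sub_of_abs_deriv_le (φ := fun t => ‖y t - z t‖ ^ 2) (T := T) (K := 2 * max L 0)
    (φ' := fun t => 2 * inner ℝ (y t - z t) (v t (y t) - v t (z t))) hJ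
    (fun r hr => ((hy r hr).2.sub (hz r hr).2).norm_sq) (fun r hr hrT => ?_) hs ht hsT htT
  · refine (pow_le_pow_iff_left₀ (norm_nonneg _) (by positivity) two_ne_zero).1 ?_
    rw [mul_pow, ← Real.exp_nat_mul, Nat.cast_ofNat, ← mul_assoc]
    exact h
  · have h1 := abs_real_inner_le_norm (y r - z r) (v r (y r) - v r (z r))
    have h2 : ‖v r (y r) - v r (z r)‖ ≤ max L 0 * ‖y r - z r‖ :=
      (hL r hr hrT _ (hy r hr).1 _ (hz r hr).1 (hyR r hr hrT) (hzR r hr hrT)).trans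
        (by gcongr; exact le_max_left _ _)
    rw [abs_mul, abs_of_pos (two_pos : (0 : ℝ) < 2)]
    have h3 : ‖y r - z r‖ * ‖v r (y r) - v r (z r)‖ ≤ ‖y r - z r‖ * (max L 0 * ‖y r - z r‖) := by
      gcongr
    nlinarith

theorem FlowField.exists_norm_le (hv : FlowField J Ω v) (hJ : TimeDomain J) (T R : ℝ) :
    ∃ R' ≥ 0, ∀ y, IsSol J Ω v y → ∀ s ∈ J, s ≤ T → ‖y s‖ ≤ R → ∀ t ∈ J, t ≤ T → ‖y t‖ ≤ R' := by
  obtain ⟨C, hC0, hC⟩ := hv.exists_norm_sq_le hJ T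
  refine ⟨Real.exp (C * T) * (1 + R ^ 2), by positivity, fun y hy s hs hsT hR t ht htT => ?_⟩
  have h1 := hC y hy s hs hsT t ht htT
  have h2 : |t - s| ≤ T := by
    have := hJ.nonneg s hs
    have := hJ.nonneg t ht
    exact abs_le.2 ⟨by linarith, by linarith⟩
  have h3 : Real.exp (C * |t - s|) * (1 + ‖y s‖ ^ 2) ≤ Real.exp (C * T) * (1 + R ^ 2) := by
    gcongr
  nlinarith [sq_nonneg (‖y t‖ - 1), norm_nonneg (y t)]

/-- Integral curves that are bounded at some time depend on their position at any time in a
Lipschitz manner. -/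
theorem IsFlow.exists_dist_le (hX : IsFlow J Ω v X) (hv : FlowField J Ω v) (hJ : TimeDomain J)
    (T R : ℝ) : ∃ L ≥ 0, ∀ x ∈ Ω, ∀ x' ∈ Ω, ∀ r ∈ J, r ≤ T → ∀ r' ∈ J, r' ≤ T →
      ‖X r x‖ ≤ R → ‖X r' x'‖ ≤ R → ∀ s ∈ J, s ≤ T → ∀ t ∈ J, t ≤ T →
      ‖X t x - X t x'‖ ≤ Real.exp (L * |t - s|) * ‖X s x - X s x'‖ := by
  obtain ⟨R', -, hR'⟩ := hv.exists_norm_le hJ T R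
  obtain ⟨L, hL0, hL⟩ := hv.exists_dist_le hJ T R'
  exact ⟨L, hL0, fun x hx x' hx' r hr hrT r' hr' hrT' hxR hxR' => hL _ _ (hX.sol x hx)
    (hX.sol x' hx') (hR' _ (hX.sol x hx) r hr hrT hxR) (hR' _ (hX.sol x' hx') r' hr' hrT' hxR')⟩

theorem FlowField.lipschitz_Icc (hv : FlowField J Ω v) (hJ : TimeDomain J) {T : ℝ} (hT : T ∈ J)
    (R : ℝ) : ∃ L, ∀ t ∈ Icc 0 T, ∀ x ∈ Ω, ∀ y ∈ Ω, ‖x‖ ≤ R → ‖y‖ ≤ R →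
      ‖v t x - v t y‖ ≤ L * ‖x - y‖ := by
  obtain ⟨L, hL⟩ := hv.lipschitz T R
  exact ⟨L, fun t ht => hL t (hJ.Icc_subset hT ht) ht.2⟩

theorem FlowField.exists_isFlow (hv : FlowField J Ω v) (hJ : TimeDomain J) :
    ∃ X, IsFlow J Ω v X := by
  have : ∀ x ∈ Ω, ∃ y, y 0 = x ∧ IsSol J Ω v y := by
    intro x hx
    refine exists_isSol_of_forall_Icc hJ (fun T hT => hv.lipschitz_Icc hJ hT) fun T hT => ?_
    have hsub := hJ.Icc_subset hT
    refine exists_isSol_Icc (hJ.nonneg T hT) hv.isOpen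
      (hv.C2.continuousOn.mono (prod_mono_left hsub)) (hv.lipschitz_Icc hJ hT) ?_ ?_ hx
    · obtain ⟨C, hC⟩ := hv.growth T
      exact ⟨C, fun t ht => hC t (hsub ht) ht.2⟩
    · intro c y hc hcT hy z hz
      exact hv.noExit 0 c y hc (fun r hr => hsub ⟨hr.1.le, hr.2.le.trans hcT⟩) hy z (Or.inl hz)
  choose! y hy0 hy using this
  exact ⟨fun t x => y x t, hy0, hy⟩

theorem IsFlow.surjOn (hX : IsFlow J Ω v X) (hv : FlowField J Ω v) (hJ : TimeDomain J)
    {T : ℝ} (hT : T ∈ J) : SurjOn (X T) Ω Ω := by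
  intro p hp
  have hsub := hJ.Icc_subset hT
  have hT0 := hJ.nonneg T hT
  have hrev : ∀ t ∈ Icc 0 T, T - t ∈ Icc 0 T := fun t ht => ⟨by linarith [ht.2], by linarith [ht.1]⟩
  obtain ⟨z, hz0, hz⟩ := exists_isSol_Icc (v := fun t x => -v (T - t) x) (x₀ := p) hT0 hv.isOpen
    (by
      have : ContinuousOn (fun q : ℝ × E d => (T - q.1, q.2)) (Icc 0 T ×ˢ Ω) := by fun_prop
      exact (hv.C2.continuousOn.comp this fun q hq => ⟨hsub (hrev _ hq.1), hq.2⟩).neg)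
    (fun R => by
      obtain ⟨L, hL⟩ := hv.lipschitz_Icc hJ hT R
      refine ⟨L, fun t ht x hx y hy hxR hyR => ?_⟩
      rw [neg_sub_neg, norm_sub_rev]
      exact hL _ (hrev t ht) x hx y hy hxR hyR)
    (by
      obtain ⟨C, hC⟩ := hv.growth T
      refine ⟨C, fun t ht x hx => ?_⟩
      rw [norm_neg]
      exact hC _ (hsub (hrev t ht)) (hrev t ht).2 x hx)
    (by
      intro c y hc hcT hy q hq
      refine hv.noExit (T - c) T (fun t => y (T - t)) (by linarith)
        (fun r hr => hsub ⟨by linarith [hr.1], hr.2.le⟩) (fun t ht => ?_) q (Or.inr ?_)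
      · have ht' : T - t ∈ Ioo 0 c := ⟨by linarith [ht.2], by linarith [ht.1]⟩
        refine ⟨(hy _ ht').1, ?_⟩
        have h1 := (hy _ ht').2.scomp t ((hasDerivAt_id t).const_sub T)
        simpa [Function.comp_def] using h1
      · refine hq.comp (tendsto_nhdsWithin_iff.2 ⟨?_, ?_⟩)
        · have : Tendsto (fun t => T - t) (𝓝 (T - c)) (𝓝 (T - (T - c))) :=
            (continuous_const.sub continuous_id).tendsto _
          rw [sub_sub_cancel] at this
          exact this.mono_left nhdsWithin_le_nhds
        · filter_upwards [self_mem_nhdsWithin] with t ht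
          simp only [mem_Ioi, mem_Iio] at *
          linarith)
    hp
  have hy : IsSol (Icc 0 T) Ω v (fun t => z (T - t)) := by
    intro t ht
    refine ⟨(hz _ (hrev t ht)).1, ?_⟩
    have h1 := (hz _ (hrev t ht)).2.scomp t (((hasDerivWithinAt_id t (Icc 0 T)).const_sub T))
      (fun s hs => hrev s hs)
    simpa [Function.comp_def] using h1
  have hx : z T ∈ Ω := (hz T ⟨hT0, le_rfl⟩).1
  refine ⟨z T, hx, ?_⟩
  have := ((hX.sol _ hx).mono hsub).eqOn_Icc hy (hv.lipschitz_Icc hJ hT)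
    (by simp [hX.init _ hx]) ⟨hT0, le_rfl⟩
  simpa [hz0] using this

theorem IsFlow.mapsTo (hX : IsFlow J Ω v X) {t : ℝ} (ht : t ∈ J) : MapsTo (X t) Ω Ω :=
  fun x hx => (hX.sol x hx t ht).1

theorem IsFlow.injOn (hX : IsFlow J Ω v X) (hv : FlowField J Ω v) (hJ : TimeDomain J)
    {t : ℝ} (ht : t ∈ J) : InjOn (X t) Ω := by
  intro x hx x' hx' h
  obtain ⟨L, -, hL⟩ := hX.exists_dist_le hv hJ t (max ‖X t x‖ ‖X t x'‖)
  have := hL x hx x' hx' t ht le_rfl t ht le_rfl (le_max_left _ _) (le_max_right _ _) t ht le_rfl 0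
    hJ.zero_mem (hJ.nonneg t ht)
  rw [hX.init x hx, hX.init x' hx', h, sub_self, norm_zero, mul_zero] at this
  exact sub_eq_zero.1 (norm_le_zero_iff.1 this)

theorem IsFlow.image_eq (hX : IsFlow J Ω v X) (hv : FlowField J Ω v) (hJ : TimeDomain J)
    {t : ℝ} (ht : t ∈ J) : X t '' Ω = Ω :=
  (hX.surjOn hv hJ ht).image_eq_of_mapsTo (hX.mapsTo ht)

theorem IsFlow.continuousOn (hX : IsFlow J Ω v X) (hv : FlowField J Ω v) (hJ : TimeDomain J) :
    ContinuousOn (fun p : ℝ × E d => X p.1 p.2) (J ×ˢ Ω) := by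
  rintro ⟨t₀, x₀⟩ ⟨ht₀, hx₀⟩
  obtain ⟨L, hL0, hL⟩ := hX.exists_dist_le hv hJ (t₀ + 1) (‖x₀‖ + 1)
  rw [ContinuousWithinAt, tendsto_iff_norm_sub_tendsto_zero]
  have hbound : ∀ᶠ p : ℝ × E d in 𝓝[J ×ˢ Ω] (t₀, x₀), ‖X p.1 p.2 - X t₀ x₀‖ ≤
      Real.exp (L * (t₀ + 1)) * ‖p.2 - x₀‖ + ‖X p.1 x₀ - X t₀ x₀‖ := by
    have h1 : ∀ᶠ p : ℝ × E d in 𝓝[J ×ˢ Ω] (t₀, x₀), p.1 < t₀ + 1 :=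
      nhdsWithin_le_nhds (continuous_fst.continuousAt.eventually (gt_mem_nhds (by simp)))
    have h2 : ∀ᶠ p : ℝ × E d in 𝓝[J ×ˢ Ω] (t₀, x₀), ‖p.2‖ < ‖x₀‖ + 1 :=
      nhdsWithin_le_nhds
        (continuous_snd.norm.continuousAt.eventually (gt_mem_nhds (by simp)))
    filter_upwards [h1, h2, self_mem_nhdsWithin] with p hp1 hp2 hp
    have h3 := hL p.2 hp.2 x₀ hx₀ 0 hJ.zero_mem (by linarith [hJ.nonneg t₀ ht₀]) 0 hJ.zero_mem
      (by linarith [hJ.nonneg t₀ ht₀]) (by rw [hX.init _ hp.2]; exact hp2.le)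
      (by rw [hX.init _ hx₀]; linarith) 0 hJ.zero_mem (by linarith [hJ.nonneg t₀ ht₀]) p.1 hp.1
      hp1.le
    rw [hX.init _ hp.2, hX.init _ hx₀, sub_zero, abs_of_nonneg (hJ.nonneg _ hp.1)] at h3
    have h4 : Real.exp (L * p.1) ≤ Real.exp (L * (t₀ + 1)) := by gcongr
    have h5 := mul_le_mul_of_nonneg_right h4 (norm_nonneg (p.2 - x₀))
    have h6 := norm_sub_le_norm_sub_add_norm_sub (X p.1 p.2) (X p.1 x₀) (X t₀ x₀)
    linarith
  refine squeeze_zero' (Eventually.of_forall fun _ => norm_nonneg _) hbound ?_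
  have h1 : Tendsto (fun p : ℝ × E d => Real.exp (L * (t₀ + 1)) * ‖p.2 - x₀‖)
      (𝓝[J ×ˢ Ω] (t₀, x₀)) (𝓝 0) := by
    have : Continuous (fun p : ℝ × E d => Real.exp (L * (t₀ + 1)) * ‖p.2 - x₀‖) := by fun_prop
    have h := this.tendsto (t₀, x₀)
    simp only [sub_self, norm_zero, mul_zero] at h
    exact h.mono_left nhdsWithin_le_nhds
  have h2 : Tendsto (fun p : ℝ × E d => ‖X p.1 x₀ - X t₀ x₀‖) (𝓝[J ×ˢ Ω] (t₀, x₀)) (𝓝 0) := by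
    have h := ((hX.sol x₀ hx₀).continuousOn t₀ ht₀).tendsto
    have hf : Tendsto (Prod.fst : ℝ × E d → ℝ) (𝓝[J ×ˢ Ω] (t₀, x₀)) (𝓝[J] t₀) :=
      tendsto_nhdsWithin_iff.2 ⟨continuous_fst.continuousWithinAt,
        eventually_mem_nhdsWithin.mono fun p hp => hp.1⟩
    exact (tendsto_iff_norm_sub_tendsto_zero.1 h).comp hf
  simpa using h1.add h2

/-- The inverse maps of a flow. -/
noncomputable def flowInv {d : ℕ} (Ω : Set (E d)) (X : ℝ → E d → E d) (t : ℝ) : E d → E d :=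
  Function.invFunOn (X t) Ω

theorem IsFlow.flowInv_mem (hX : IsFlow J Ω v X) (hv : FlowField J Ω v) (hJ : TimeDomain J)
    {t : ℝ} (ht : t ∈ J) {p : E d} (hp : p ∈ Ω) : flowInv Ω X t p ∈ Ω :=
  (hX.surjOn hv hJ ht).mapsTo_invFunOn hp

theorem IsFlow.apply_flowInv (hX : IsFlow J Ω v X) (hv : FlowField J Ω v) (hJ : TimeDomain J)
    {t : ℝ} (ht : t ∈ J) {p : E d} (hp : p ∈ Ω) : X t (flowInv Ω X t p) = p :=
  (hX.surjOn hv hJ ht).rightInvOn_invFunOn hp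

theorem IsFlow.flowInv_apply (hX : IsFlow J Ω v X) (hv : FlowField J Ω v) (hJ : TimeDomain J)
    {t : ℝ} (ht : t ∈ J) {x : E d} (hx : x ∈ Ω) : flowInv Ω X t (X t x) = x :=
  (hX.injOn hv hJ ht).leftInvOn_invFunOn hx

theorem IsFlow.continuousOn_flowInv (hX : IsFlow J Ω v X) (hv : FlowField J Ω v)
    (hJ : TimeDomain J) :
    ContinuousOn (fun p : ℝ × E d => flowInv Ω X p.1 p.2) (J ×ˢ Ω) := by
  rintro ⟨t₀, p₀⟩ ⟨ht₀, hp₀⟩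
  set x₀ := flowInv Ω X t₀ p₀ with hx₀def
  have hx₀ : x₀ ∈ Ω := hX.flowInv_mem hv hJ ht₀ hp₀
  obtain ⟨L, hL0, hL⟩ := hX.exists_dist_le hv hJ (t₀ + 1) (max (‖p₀‖ + 1) ‖x₀‖)
  rw [ContinuousWithinAt, tendsto_iff_norm_sub_tendsto_zero]
  simp only [← hx₀def]
  have hbound : ∀ᶠ p : ℝ × E d in 𝓝[J ×ˢ Ω] (t₀, p₀), ‖flowInv Ω X p.1 p.2 - x₀‖ ≤
      Real.exp (L * (t₀ + 1)) * ‖p.2 - X p.1 x₀‖ := by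
    have h1 : ∀ᶠ p : ℝ × E d in 𝓝[J ×ˢ Ω] (t₀, p₀), p.1 < t₀ + 1 :=
      nhdsWithin_le_nhds (continuous_fst.continuousAt.eventually (gt_mem_nhds (by simp)))
    have h2 : ∀ᶠ p : ℝ × E d in 𝓝[J ×ˢ Ω] (t₀, p₀), ‖p.2‖ < ‖p₀‖ + 1 :=
      nhdsWithin_le_nhds
        (continuous_snd.norm.continuousAt.eventually (gt_mem_nhds (by simp)))
    filter_upwards [h1, h2, self_mem_nhdsWithin] with p hp1 hp2 hp
    have hm := hX.flowInv_mem hv hJ hp.1 hp.2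
    have ha := hX.apply_flowInv hv hJ hp.1 hp.2
    have h3 := hL _ hm x₀ hx₀ p.1 hp.1 hp1.le 0 hJ.zero_mem (by linarith [hJ.nonneg t₀ ht₀])
      (by rw [ha]; exact hp2.le.trans (le_max_left _ _))
      (by rw [hX.init _ hx₀]; exact le_max_right _ _) p.1 hp.1 hp1.le 0 hJ.zero_mem
      (by linarith [hJ.nonneg t₀ ht₀])
    rw [hX.init _ hm, hX.init _ hx₀, ha, zero_sub, abs_neg, abs_of_nonneg (hJ.nonneg _ hp.1)] at h3
    refine h3.trans ?_
    gcongr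
  refine squeeze_zero' (Eventually.of_forall fun _ => norm_nonneg _) hbound ?_
  have h2 : Tendsto (fun p : ℝ × E d => X p.1 x₀) (𝓝[J ×ˢ Ω] (t₀, p₀)) (𝓝 p₀) := by
    have h := ((hX.sol x₀ hx₀).continuousOn t₀ ht₀).tendsto
    have hf : Tendsto (Prod.fst : ℝ × E d → ℝ) (𝓝[J ×ˢ Ω] (t₀, p₀)) (𝓝[J] t₀) :=
      tendsto_nhdsWithin_iff.2 ⟨continuous_fst.continuousWithinAt,
        eventually_mem_nhdsWithin.mono fun p hp => hp.1⟩
    have := h.comp hf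
    rwa [hX.apply_flowInv hv hJ ht₀ hp₀] at this
  have h1 : Tendsto (fun p : ℝ × E d => p.2) (𝓝[J ×ˢ Ω] (t₀, p₀)) (𝓝 p₀) :=
    continuous_snd.continuousWithinAt
  simpa using ((h1.sub h2).norm).const_mul (Real.exp (L * (t₀ + 1)))

end Flow

section LinearDependence

variable {J : Set ℝ} {d : ℕ} {Ω : Set (E d)}

theorem TimeDomain.exists_Icc_mem_nhdsWithin (hJ : TimeDomain J) {t : ℝ} (ht : t ∈ J) :
    ∃ T ∈ J, t ≤ T ∧ Icc 0 T ∈ 𝓝[J] t := by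
  by_cases hmax : ∃ t' ∈ J, t < t'
  · obtain ⟨t', ht', hlt⟩ := hmax
    refine ⟨t', ht', hlt.le, mem_nhdsWithin.2 ⟨Iio t', isOpen_Iio, hlt, ?_⟩⟩
    rintro s ⟨hs, hs'⟩
    exact ⟨hJ.nonneg s hs', le_of_lt hs⟩
  · push Not at hmax
    exact ⟨t, ht, le_rfl,
      mem_of_superset self_mem_nhdsWithin fun s hs => ⟨hJ.nonneg s hs, hmax s hs⟩⟩

theorem exists_forall_dist_lt_of_isCompact {H : Type*} [PseudoMetricSpace H] (hΩ : IsOpen Ω)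
    {I : Set ℝ} (hI : IsCompact I) {K : Set (E d)} (hK : IsCompact K) (hKΩ : K ⊆ Ω)
    {f : ℝ → E d → H} (hf : ContinuousOn (fun p : ℝ × E d => f p.1 p.2) (I ×ˢ Ω))
    {ε : ℝ} (hε : 0 < ε) :
    ∃ r > 0, ∀ t ∈ I, ∀ x ∈ K, ∀ y, dist y x < r → y ∈ Ω ∧ dist (f t y) (f t x) < ε := by
  obtain ⟨δ, hδ, hsub⟩ := hK.exists_cthickening_subset_open hΩ hKΩ
  have hcomp : IsCompact (I ×ˢ Metric.cthickening δ K) := hI.prod hK.cthickening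
  have hu := hcomp.uniformContinuousOn_of_continuous (hf.mono (prod_mono_right hsub))
  obtain ⟨r, hr, hr'⟩ := Metric.uniformContinuousOn_iff.1 hu ε hε
  refine ⟨min r δ, lt_min hr hδ, fun t ht x hx y hy => ?_⟩
  have hyK : y ∈ Metric.cthickening δ K :=
    Metric.mem_cthickening_of_dist_le y x δ K hx (hy.le.trans (min_le_right _ _))
  refine ⟨hsub hyK, hr' (t, y) ⟨ht, hyK⟩ (t, x) ⟨ht, Metric.self_subset_cthickening K hx⟩ ?_⟩
  rw [Prod.dist_eq, dist_self, max_eq_right dist_nonneg]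
  exact hy.trans_le (min_le_left _ _)

theorem gronwallBound_smul (η K x : ℝ) : gronwallBound η K η x = η * gronwallBound 1 K 1 x := by
  by_cases hK : K = 0
  · subst hK
    simp only [gronwallBound_K0]
    ring
  · simp only [gronwallBound_of_K_ne_0 hK]
    ring

variable {F : Type*} [NormedAddCommGroup F] [NormedSpace ℝ F]

theorem norm_le_mul_gronwallBound {f f' : ℝ → F} {T K η : ℝ} (hK : 0 ≤ K) (hη : 0 ≤ η)
    (hf : ∀ t ∈ Icc 0 T, HasDerivWithinAt f (f' t) (Icc 0 T) t) (h0 : ‖f 0‖ ≤ η)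
    (hb : ∀ t ∈ Icc 0 T, ‖f' t‖ ≤ K * ‖f t‖ + η) :
    ∀ t ∈ Icc 0 T, ‖f t‖ ≤ η * gronwallBound 1 K 1 T := by
  intro t ht
  have := norm_le_gronwallBound_of_norm_deriv_right_le (f := f) (f' := f') (δ := η) (K := K)
    (ε := η) (a := 0) (b := T) (fun s hs => (hf s hs).continuousWithinAt)
    (fun s hs => (hf s ⟨hs.1, hs.2.le⟩).mono_of_mem_nhdsWithin (Icc_mem_nhdsGE_of_mem hs)) h0
    (fun s hs => hb s ⟨hs.1, hs.2.le⟩) t ht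
  rw [sub_zero] at this
  refine this.trans ?_
  rw [← gronwallBound_smul]
  exact gronwallBound_mono hη hη hK ht.2

theorem gronwallBound_one_nonneg {K T : ℝ} (hK : 0 ≤ K) (hT : 0 ≤ T) :
    0 ≤ gronwallBound 1 K 1 T := by
  have := gronwallBound_mono zero_le_one zero_le_one hK hT
  rw [gronwallBound_x0] at this
  linarith

/-- Solutions of linear equations depend continuously on parameters. -/
theorem continuousOn_of_linear_ode (hJ : TimeDomain J) (hΩ : IsOpen Ω)
    {A : ℝ → E d → F →L[ℝ] F} {c y : ℝ → E d → F}
    (hA : ContinuousOn (fun p : ℝ × E d => A p.1 p.2) (J ×ˢ Ω))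
    (hc : ContinuousOn (fun p : ℝ × E d => c p.1 p.2) (J ×ˢ Ω))
    (hy0 : ContinuousOn (y 0) Ω)
    (hy : ∀ x ∈ Ω, ∀ t ∈ J, HasDerivWithinAt (fun τ => y τ x) (A t x (y t x) + c t x) J t) :
    ContinuousOn (fun p : ℝ × E d => y p.1 p.2) (J ×ˢ Ω) := by
  rintro ⟨t₀, x₀⟩ ⟨ht₀, hx₀⟩
  obtain ⟨T, hT, ht₀T, hnhds⟩ := hJ.exists_Icc_mem_nhdsWithin ht₀
  have hsub := hJ.Icc_subset hT
  have hT0 := hJ.nonneg T hT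
  have hyc : ContinuousOn (fun t => y t x₀) (Icc 0 T) := fun t ht =>
    (hy x₀ hx₀ t (hsub ht)).continuousWithinAt.mono hsub
  obtain ⟨B, hB⟩ := isCompact_Icc.exists_bound_of_continuousOn hyc
  have hAc : ContinuousOn (fun t => A t x₀) (Icc 0 T) :=
    hA.comp (f := fun t => (t, x₀)) (by fun_prop) fun t ht => ⟨hsub ht, hx₀⟩
  obtain ⟨K, hK⟩ := isCompact_Icc.exists_bound_of_continuousOn hAc
  have hK0 : 0 ≤ K := (norm_nonneg _).trans (hK 0 ⟨le_rfl, hT0⟩)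
  have hB0 : 0 ≤ B := (norm_nonneg _).trans (hB 0 ⟨le_rfl, hT0⟩)
  set g := gronwallBound 1 (K + 1) 1 T
  have hg : 0 ≤ g := gronwallBound_one_nonneg (by linarith) hT0
  have hunif : ∀ η > 0, ∀ᶠ x in 𝓝[Ω] x₀, ∀ t ∈ Icc 0 T, ‖y t x - y t x₀‖ ≤ η * g := by
    intro η hη
    set ε := min 1 (η / (B + 1)) with hεdef
    have hε : 0 < ε := lt_min one_pos (by positivity)
    have hεB : ε * B + ε ≤ η := by
      have h1 : ε ≤ η / (B + 1) := min_le_right _ _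
      rw [le_div_iff₀ (by positivity)] at h1
      linarith
    obtain ⟨r₁, hr₁, h₁⟩ := exists_forall_dist_lt_of_isCompact hΩ (isCompact_Icc (a := 0) (b := T))
      (isCompact_singleton (x := x₀)) (by simpa using hx₀) (hA.mono (prod_mono_left hsub)) hε
    obtain ⟨r₂, hr₂, h₂⟩ := exists_forall_dist_lt_of_isCompact hΩ (isCompact_Icc (a := 0) (b := T))
      (isCompact_singleton (x := x₀)) (by simpa using hx₀) (hc.mono (prod_mono_left hsub)) hε
    have h0 : ∀ᶠ x in 𝓝[Ω] x₀, dist (y 0 x) (y 0 x₀) < η := Metric.tendsto_nhds.1 (hy0 x₀ hx₀) η hη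
    filter_upwards [h0, self_mem_nhdsWithin, nhdsWithin_le_nhds (Metric.ball_mem_nhds x₀ hr₁),
      nhdsWithin_le_nhds (Metric.ball_mem_nhds x₀ hr₂)] with x hx0 hxΩ hx1 hx2
    refine norm_le_mul_gronwallBound (f := fun t => y t x - y t x₀) (by linarith) hη.le
      (fun t ht => ((hy x hxΩ t (hsub ht)).sub (hy x₀ hx₀ t (hsub ht))).mono hsub)
      (by rw [← dist_eq_norm]; exact hx0.le) fun t ht => ?_
    have e : A t x (y t x) + c t x - (A t x₀ (y t x₀) + c t x₀) =
        A t x (y t x - y t x₀) + ((A t x - A t x₀) (y t x₀) + (c t x - c t x₀)) := by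
      simp only [map_sub, sub_apply]
      abel
    rw [e]
    have ha := (h₁ t ht x₀ rfl x hx1).2
    have hcc := (h₂ t ht x₀ rfl x hx2).2
    rw [dist_eq_norm] at ha hcc
    have hAx : ‖A t x‖ ≤ K + 1 := by
      have h3 := norm_le_norm_add_norm_sub' (A t x) (A t x₀)
      have h4 : ε ≤ 1 := min_le_left _ _
      linarith [hK t ht]
    have h5 := (A t x).le_of_opNorm_le hAx (y t x - y t x₀)
    have h6 := (A t x - A t x₀).le_of_opNorm_le ha.le (y t x₀)
    have h7 : ε * ‖y t x₀‖ ≤ ε * B := mul_le_mul_of_nonneg_left (hB t ht) hε.le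
    refine (norm_add_le _ _).trans (add_le_add h5 ((norm_add_le _ _).trans ?_))
    linarith
  rw [ContinuousWithinAt, Metric.tendsto_nhds]
  intro ε hε
  have hη : 0 < ε / (2 * (g + 1)) := by positivity
  have hfst : Tendsto (Prod.fst : ℝ × E d → ℝ) (𝓝[J ×ˢ Ω] (t₀, x₀)) (𝓝[J] t₀) :=
    tendsto_nhdsWithin_iff.2 ⟨continuous_fst.continuousWithinAt,
      eventually_mem_nhdsWithin.mono fun p hp => hp.1⟩
  have hsnd : Tendsto (Prod.snd : ℝ × E d → E d) (𝓝[J ×ˢ Ω] (t₀, x₀)) (𝓝[Ω] x₀) :=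
    tendsto_nhdsWithin_iff.2 ⟨continuous_snd.continuousWithinAt,
      eventually_mem_nhdsWithin.mono fun p hp => hp.2⟩
  have hcont : ∀ᶠ t in 𝓝[J] t₀, dist (y t x₀) (y t₀ x₀) < ε / 2 :=
    Metric.tendsto_nhds.1 (hy x₀ hx₀ t₀ ht₀).continuousWithinAt (ε / 2) (half_pos hε)
  filter_upwards [hsnd.eventually (hunif _ hη), hfst.eventually hcont, hfst.eventually hnhds]
    with p hp1 hp2 hp3
  have h1 := hp1 p.1 hp3
  rw [← dist_eq_norm] at h1
  have h2 : ε / (2 * (g + 1)) * g ≤ ε / 2 := by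
    rw [div_mul_eq_mul_div, div_le_div_iff₀ (by positivity) two_pos]
    nlinarith
  exact (dist_triangle _ (y p.1 x₀) _).trans_lt (by linarith)

end LinearDependence

section FlowDeriv

variable {d : ℕ} {J : Set ℝ} {Ω : Set (E d)} {v X : ℝ → E d → E d}

/-- The trace of a linear map on `ℝ^d`, as the sum of its diagonal entries. -/
noncomputable def diagSum (d : ℕ) : (E d →L[ℝ] E d) →L[ℝ] ℝ :=
  ∑ i : Fin d, (EuclideanSpace.proj i : E d →L[ℝ] ℝ) ∘L
    ContinuousLinearMap.apply ℝ (E d) (EuclideanSpace.single i (1 : ℝ))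

theorem diagSum_apply (H : E d →L[ℝ] E d) :
    diagSum d H = ∑ i : Fin d, (H (EuclideanSpace.single i 1)) i := by
  simp [diagSum]

theorem divergence_eq_diagSum (F : E d → E d) (x : E d) :
    divergence F x = diagSum d (fderiv ℝ F x) := by
  rw [diagSum_apply, divergence]

theorem FlowField.divergence_C1 (hv : FlowField J Ω v) :
    CkInSpace J Ω 1 (fun t => divergence (v t)) :=
  ((hv.C2.fderiv hv.isOpen).clm_comp hv.isOpen (diagSum d)).congr hv.isOpen
    fun t _ x _ => divergence_eq_diagSum (v t) x

theorem IsFlow.continuousOn_comp {H : Type*} [TopologicalSpace H] (hX : IsFlow J Ω v X)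
    (hv : FlowField J Ω v) (hJ : TimeDomain J) {f : ℝ → E d → H}
    (hf : ContinuousOn (fun p : ℝ × E d => f p.1 p.2) (J ×ˢ Ω)) :
    ContinuousOn (fun p : ℝ × E d => f p.1 (X p.1 p.2)) (J ×ˢ Ω) :=
  hf.comp (continuousOn_fst.prodMk (hX.continuousOn hv hJ)) fun _ hp =>
    ⟨hp.1, hX.mapsTo hp.1 hp.2⟩

/-- `M_t(x)` solves the equation of variation `Ṁ = ∇v(X) M`, `M_0 = 1`. -/
structure IsFlowDeriv (J : Set ℝ) (Ω : Set (E d)) (v X : ℝ → E d → E d)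
    (M : ℝ → E d → E d →L[ℝ] E d) : Prop where
  init : ∀ x ∈ Ω, M 0 x = ContinuousLinearMap.id ℝ (E d)
  ode : ∀ x ∈ Ω, ∀ t ∈ J,
    HasDerivWithinAt (fun τ => M τ x) (fderiv ℝ (v t) (X t x) ∘L M t x) J t

theorem IsFlow.exists_isFlowDeriv (hX : IsFlow J Ω v X) (hv : FlowField J Ω v)
    (hJ : TimeDomain J) : ∃ M, IsFlowDeriv J Ω v X M := by
  have hA := hX.continuousOn_comp hv hJ (f := fun t => fderiv ℝ (v t))
    (hv.C2.fderiv hv.isOpen).continuousOn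
  have : ∀ x ∈ Ω, ∃ y : ℝ → E d →L[ℝ] E d, y 0 = ContinuousLinearMap.id ℝ (E d) ∧
      ∀ t ∈ J, HasDerivWithinAt y (fderiv ℝ (v t) (X t x) ∘L y t) J t := by
    intro x hx
    have hAx : ContinuousOn (fun t => fderiv ℝ (v t) (X t x)) J :=
      hA.comp (f := fun t => (t, x)) (by fun_prop) fun t ht => ⟨ht, hx⟩
    obtain ⟨y, hy0, hy⟩ := exists_linear_ode hJ
      (A := fun t => ContinuousLinearMap.compL ℝ (E d) (E d) (E d) (fderiv ℝ (v t) (X t x)))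
      (c := fun _ => 0) ((ContinuousLinearMap.continuous _).comp_continuousOn hAx)
      continuousOn_const (ContinuousLinearMap.id ℝ (E d))
    exact ⟨y, hy0, fun t ht => by simpa using hy t ht⟩
  choose! M hM0 hM using this
  exact ⟨fun t x => M x t, hM0, hM⟩

theorem exists_forall_norm_sub_sub_le {H : Type*} [NormedAddCommGroup H] [NormedSpace ℝ H]
    {f : ℝ → E d → H} {f' : ℝ → E d → E d →L[ℝ] H} (hΩ : IsOpen Ω)
    {I : Set ℝ} (hI : IsCompact I) {K : Set (E d)} (hK : IsCompact K) (hKΩ : K ⊆ Ω)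
    (hf : ∀ t ∈ I, ∀ x ∈ Ω, HasFDerivAt (f t) (f' t x) x)
    (hf' : ContinuousOn (fun p : ℝ × E d => f' p.1 p.2) (I ×ˢ Ω)) {ε : ℝ} (hε : 0 < ε) :
    ∃ r > 0, ∀ t ∈ I, ∀ x ∈ K, ∀ y, ‖y - x‖ < r →
      ‖f t y - f t x - f' t x (y - x)‖ ≤ ε * ‖y - x‖ := by
  obtain ⟨r, hr, h⟩ := exists_forall_dist_lt_of_isCompact hΩ hI hK hKΩ hf' hε
  refine ⟨r, hr, fun t ht x hx y hy => ?_⟩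
  refine (convex_ball x r).norm_image_sub_le_of_norm_hasFDerivWithin_le' (f' := f' t)
    (fun z hz => (hf t ht z (h t ht x hx z hz).1).hasFDerivWithinAt) (fun z hz => ?_)
    (Metric.mem_ball_self hr) (mem_ball_iff_norm.2 hy)
  rw [← dist_eq_norm]
  exact (h t ht x hx z hz).2.le

theorem IsFlow.exists_eventually_norm_sub_le (hX : IsFlow J Ω v X) (hv : FlowField J Ω v)
    (hJ : TimeDomain J) {T : ℝ} (hT : T ∈ J) {x₀ : E d} (hx₀ : x₀ ∈ Ω) :
    ∃ C > 0, ∀ᶠ x in 𝓝 x₀, x ∈ Ω ∧ ∀ t ∈ Icc 0 T, ‖X t x - X t x₀‖ ≤ C * ‖x - x₀‖ := by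
  obtain ⟨L, hL0, hL⟩ := hX.exists_dist_le hv hJ T (‖x₀‖ + 1)
  refine ⟨Real.exp (L * T), Real.exp_pos _, ?_⟩
  filter_upwards [hv.isOpen.mem_nhds hx₀,
    continuous_norm.continuousAt.eventually (gt_mem_nhds (lt_add_one ‖x₀‖))] with x hx hn
  refine ⟨hx, fun t ht => ?_⟩
  have hT0 := hJ.nonneg T hT
  have := hL x hx x₀ hx₀ 0 hJ.zero_mem hT0 0 hJ.zero_mem hT0 (by rw [hX.init x hx]; exact hn.le)
    (by rw [hX.init x₀ hx₀]; linarith) 0 hJ.zero_mem hT0 t (hJ.Icc_subset hT ht) ht.2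
  rw [hX.init x hx, hX.init x₀ hx₀, sub_zero, abs_of_nonneg ht.1] at this
  refine this.trans ?_
  gcongr
  exact ht.2

theorem IsFlow.isCompact_orbit (hX : IsFlow J Ω v X) (hJ : TimeDomain J) {T : ℝ} (hT : T ∈ J)
    {x : E d} (hx : x ∈ Ω) :
    IsCompact ((fun t => X t x) '' Icc 0 T) ∧ (fun t => X t x) '' Icc 0 T ⊆ Ω :=
  ⟨isCompact_Icc.image_of_continuousOn ((hX.sol x hx).continuousOn.mono (hJ.Icc_subset hT)),
    image_subset_iff.2 fun _ ht => hX.mapsTo (hJ.Icc_subset hT ht) hx⟩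

/-- The flow is differentiable in the starting point, uniformly on compact time intervals. -/
theorem IsFlowDeriv.eventually_norm_sub_sub_le {M : ℝ → E d → E d →L[ℝ] E d}
    (hM : IsFlowDeriv J Ω v X M) (hX : IsFlow J Ω v X) (hv : FlowField J Ω v)
    (hJ : TimeDomain J) {T : ℝ} (hT : T ∈ J) {x₀ : E d} (hx₀ : x₀ ∈ Ω) {ε : ℝ} (hε : 0 < ε) :
    ∀ᶠ x in 𝓝 x₀, ∀ t ∈ Icc 0 T,
      ‖X t x - X t x₀ - M t x₀ (x - x₀)‖ ≤ ε * ‖x - x₀‖ := by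
  have hsub := hJ.Icc_subset hT
  have hT0 := hJ.nonneg T hT
  obtain ⟨C, hC, hlip⟩ := hX.exists_eventually_norm_sub_le hv hJ hT hx₀
  have hA := hX.continuousOn_comp hv hJ (f := fun t => fderiv ℝ (v t))
    (hv.C2.fderiv hv.isOpen).continuousOn
  have hAx : ContinuousOn (fun t => fderiv ℝ (v t) (X t x₀)) (Icc 0 T) :=
    hA.comp (f := fun t => (t, x₀)) (by fun_prop) fun t ht => ⟨hsub ht, hx₀⟩
  obtain ⟨K, hK⟩ := isCompact_Icc.exists_bound_of_continuousOn hAx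
  have hK0 : 0 ≤ K := (norm_nonneg _).trans (hK 0 ⟨le_rfl, hT0⟩)
  set g := gronwallBound 1 K 1 T
  have hg : 0 ≤ g := gronwallBound_one_nonneg hK0 hT0
  set ε' := ε / (C * (g + 1))
  have hε' : 0 < ε' := by positivity
  obtain ⟨hKc, hKΩ⟩ := hX.isCompact_orbit hJ hT hx₀
  obtain ⟨r, hr, h⟩ := exists_forall_norm_sub_sub_le hv.isOpen (isCompact_Icc (a := 0) (b := T))
    hKc hKΩ (fun t ht x hx => hv.C2.hasFDerivAt hv.isOpen (hsub ht) hx)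
    ((hv.C2.fderiv hv.isOpen).continuousOn.mono (prod_mono_left hsub)) hε'
  filter_upwards [hlip, Metric.ball_mem_nhds x₀ (div_pos hr hC)] with x hx hxr
  obtain ⟨hxΩ, hx⟩ := hx
  rw [mem_ball_iff_norm, lt_div_iff₀' hC] at hxr
  intro t ht
  have hη : 0 ≤ ε' * (C * ‖x - x₀‖) := by positivity
  have := norm_le_mul_gronwallBound (f := fun t => X t x - X t x₀ - M t x₀ (x - x₀))
    (f' := fun t => v t (X t x) - v t (X t x₀) -
      (fderiv ℝ (v t) (X t x₀) ∘L M t x₀) (x - x₀)) hK0 hη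
    (fun s hs => ((((hX.sol x hxΩ s (hsub hs)).2.sub (hX.sol x₀ hx₀ s (hsub hs)).2)).sub
      ((hM.ode x₀ hx₀ s (hsub hs)).clm_apply (hasDerivWithinAt_const s J (x - x₀)) |>.congr_deriv
        (by simp))).mono hsub)
    (by simpa [hX.init x hxΩ, hX.init x₀ hx₀, hM.init x₀ hx₀] using hη)
    (fun s hs => by
      have e : v s (X s x) - v s (X s x₀) - (fderiv ℝ (v s) (X s x₀) ∘L M s x₀) (x - x₀) =
          fderiv ℝ (v s) (X s x₀) (X s x - X s x₀ - M s x₀ (x - x₀)) +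
          (v s (X s x) - v s (X s x₀) - fderiv ℝ (v s) (X s x₀) (X s x - X s x₀)) := by
        simp only [map_sub, ContinuousLinearMap.comp_apply]
        abel
      rw [e]
      refine (norm_add_le _ _).trans (add_le_add
        ((fderiv ℝ (v s) (X s x₀)).le_of_opNorm_le (hK s hs) _) ?_)
      refine (h s hs _ (mem_image_of_mem _ hs) _ ((hx s hs).trans_lt hxr)).trans ?_
      gcongr
      exact hx s hs) t ht
  refine this.trans ?_
  have e : ε' * (C * ‖x - x₀‖) * g = ε * ‖x - x₀‖ * (g / (g + 1)) := by
    simp only [ε']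
    field_simp
  rw [e]
  refine mul_le_of_le_one_right (by positivity) ?_
  rw [div_le_one (by positivity)]
  linarith

theorem IsFlowDeriv.hasFDerivAt {M : ℝ → E d → E d →L[ℝ] E d}
    (hM : IsFlowDeriv J Ω v X M) (hX : IsFlow J Ω v X) (hv : FlowField J Ω v)
    (hJ : TimeDomain J) {t : ℝ} (ht : t ∈ J) {x : E d} (hx : x ∈ Ω) :
    HasFDerivAt (X t) (M t x) x := by
  refine HasFDerivAt.of_isLittleO (Asymptotics.isLittleO_iff.2 fun ε hε => ?_)
  filter_upwards [hM.eventually_norm_sub_sub_le hX hv hJ ht hx hε] with y hy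
  exact hy t ⟨hJ.nonneg t ht, le_rfl⟩

theorem eqOn_of_hasDerivWithinAt_zero {H : Type*} [NormedAddCommGroup H] [NormedSpace ℝ H]
    (hJ : TimeDomain J) {f : ℝ → H} (hf : ∀ t ∈ J, HasDerivWithinAt f 0 J t) {t : ℝ}
    (ht : t ∈ J) : f t = f 0 := by
  have hsub := hJ.Icc_subset ht
  refine constant_of_has_deriv_right_zero (fun s hs => (hf s (hsub hs)).continuousWithinAt.mono hsub)
    (fun s hs => ?_) t ⟨hJ.nonneg t ht, le_rfl⟩
  exact ((hf s (hsub ⟨hs.1, hs.2.le⟩)).mono hsub).mono_of_mem_nhdsWithin (Icc_mem_nhdsGE_of_mem hs)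

theorem IsFlowDeriv.exists_inverse {M : ℝ → E d → E d →L[ℝ] E d}
    (hM : IsFlowDeriv J Ω v X M) (hX : IsFlow J Ω v X) (hv : FlowField J Ω v)
    (hJ : TimeDomain J) {t : ℝ} (ht : t ∈ J) {x : E d} (hx : x ∈ Ω) :
    ∃ N : E d →L[ℝ] E d, N ∘L M t x = ContinuousLinearMap.id ℝ (E d) ∧
      M t x ∘L N = ContinuousLinearMap.id ℝ (E d) := by
  have hA := hX.continuousOn_comp hv hJ (f := fun t => fderiv ℝ (v t))
    (hv.C2.fderiv hv.isOpen).continuousOn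
  have hAx : ContinuousOn (fun t => fderiv ℝ (v t) (X t x)) J :=
    hA.comp (f := fun t => (t, x)) (by fun_prop) fun t ht => ⟨ht, hx⟩
  obtain ⟨N, hN0, hN⟩ := exists_linear_ode hJ
    (A := fun t => -((ContinuousLinearMap.compL ℝ (E d) (E d) (E d)).flip (fderiv ℝ (v t) (X t x))))
    (c := fun _ => 0) (((ContinuousLinearMap.continuous _).comp_continuousOn hAx).neg)
    continuousOn_const (ContinuousLinearMap.id ℝ (E d))
  have h1 : N t ∘L M t x = ContinuousLinearMap.id ℝ (E d) := by
    have := eqOn_of_hasDerivWithinAt_zero hJ (f := fun t => N t ∘L M t x) (fun s hs => ?_) ht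
    · simpa [hN0, hM.init x hx] using this
    · refine ((hN s hs).clm_comp (hM.ode x hx s hs)).congr_deriv ?_
      ext k
      simp
  refine ⟨N t, h1, ?_⟩
  have h2 : (N t : E d →ₗ[ℝ] E d) * (M t x : E d →ₗ[ℝ] E d) = 1 := by
    ext k : 1
    exact congrArg (fun f : E d →L[ℝ] E d => f k) h1
  have h3 := mul_eq_one_comm.1 h2
  ext k : 1
  exact congrArg (fun f : E d →ₗ[ℝ] E d => f k) h3

end FlowDeriv

section Determinant

variable {d : ℕ}

theorem det_eq_matrix_det (H : E d →L[ℝ] E d) :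
    H.det = Matrix.det (Matrix.of fun i j => (H (EuclideanSpace.single j 1)) i) := by
  rw [ContinuousLinearMap.det, ← LinearMap.det_toMatrix (EuclideanSpace.basisFun (Fin d) ℝ).toBasis]
  congr 1

theorem differentiable_det : Differentiable ℝ (fun H : E d →L[ℝ] E d => H.det) := by
  have h1 : ∀ i j : Fin d, Differentiable ℝ
      (fun H : E d →L[ℝ] E d => (H (EuclideanSpace.single j 1)) i) := fun i j =>
    ((EuclideanSpace.proj i : E d →L[ℝ] ℝ) ∘L
      ContinuousLinearMap.apply ℝ (E d) (EuclideanSpace.single j (1 : ℝ))).differentiable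
  simp only [det_eq_matrix_det, Matrix.det_apply, Matrix.of_apply]
  refine Differentiable.fun_sum fun σ _ => Differentiable.const_smul ?_ _
  exact fun H => (HasFDerivAt.finsetProd (g := fun i (H : E d →L[ℝ] E d) =>
    (H (EuclideanSpace.single i 1)) (σ i)) fun i _ => (h1 (σ i) i H).hasFDerivAt).differentiableAt

theorem fderiv_det_id (H : E d →L[ℝ] E d) :
    fderiv ℝ (fun H : E d →L[ℝ] E d => H.det) (ContinuousLinearMap.id ℝ (E d)) H = diagSum d H := by
  have h1 : HasDerivAt (fun r : ℝ => (ContinuousLinearMap.id ℝ (E d) + r • H).det)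
      (fderiv ℝ (fun H : E d →L[ℝ] E d => H.det) (ContinuousLinearMap.id ℝ (E d)) H) 0 := by
    have hc : HasDerivAt (fun r : ℝ => ContinuousLinearMap.id ℝ (E d) + r • H) H 0 := by
      simpa using ((hasDerivAt_id (0 : ℝ)).smul_const H).const_add (ContinuousLinearMap.id ℝ (E d))
    exact (differentiable_det (d := d) (ContinuousLinearMap.id ℝ (E d))).hasFDerivAt
      |>.comp_hasDerivAt_of_eq (0 : ℝ) hc (by ext k i; simp)
  have h2 : HasDerivAt (fun r : ℝ => (ContinuousLinearMap.id ℝ (E d) + r • H).det)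
      (diagSum d H) 0 := by
    set B : Matrix (Fin d) (Fin d) ℝ := Matrix.of fun i j => (H (EuclideanSpace.single j 1)) i
    have e : ∀ r : ℝ, (ContinuousLinearMap.id ℝ (E d) + r • H).det = Matrix.det (1 + r • B) := by
      intro r
      rw [det_eq_matrix_det]
      congr 1
      ext i j
      simp [B, Matrix.one_apply]
    set q := (Matrix.det (1 + (Polynomial.X : Polynomial ℝ) • B.map Polynomial.C)).divX.divX
    have e' : (fun r : ℝ => (ContinuousLinearMap.id ℝ (E d) + r • H).det) =
        fun r : ℝ => 1 + B.trace * r + q.eval r * r ^ 2 :=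
      funext fun r => by rw [e, Matrix.det_one_add_smul]
    rw [e']
    have h3 : HasDerivAt (fun r : ℝ => 1 + B.trace * r + q.eval r * r ^ 2)
        (B.trace * 1 + (q.derivative.eval 0 * 0 ^ 2 + q.eval 0 * (2 * 0))) 0 := by
      refine ((((hasDerivAt_id (0 : ℝ)).const_mul B.trace).const_add 1)).add ?_
      exact ((q.hasDerivAt 0).fun_mul (hasDerivAt_pow 2 (0 : ℝ))).congr_deriv (by simp)
    refine h3.congr_deriv ?_
    simp [diagSum_apply, Matrix.trace, B]
  exact h1.unique h2

variable {J : Set ℝ} {Ω : Set (E d)} {v X : ℝ → E d → E d} {M : ℝ → E d → E d →L[ℝ] E d}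

/-- Liouville's formula in differential form. -/
theorem IsFlowDeriv.hasDerivWithinAt_det (hM : IsFlowDeriv J Ω v X M) (hX : IsFlow J Ω v X)
    (hv : FlowField J Ω v) (hJ : TimeDomain J) {t : ℝ} (ht : t ∈ J) {x : E d} (hx : x ∈ Ω) :
    HasDerivWithinAt (fun τ => (M τ x).det) (divergence (v t) (X t x) * (M t x).det) J t := by
  obtain ⟨N, hN1, hN2⟩ := hM.exists_inverse hX hv hJ ht hx
  have e : ∀ τ, (M τ x).det = (M τ x ∘L N).det * (M t x).det := by
    intro τ
    have h : M τ x = (M τ x ∘L N) ∘L M t x := by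
      rw [ContinuousLinearMap.comp_assoc, hN1, ContinuousLinearMap.comp_id]
    conv_lhs => rw [h]
    exact LinearMap.det_comp _ _
  have hc : HasDerivWithinAt (fun τ => M τ x ∘L N) (fderiv ℝ (v t) (X t x)) J t := by
    refine ((hM.ode x hx t ht).clm_comp (hasDerivWithinAt_const t J N)).congr_deriv ?_
    rw [ContinuousLinearMap.comp_zero, add_zero, ContinuousLinearMap.comp_assoc, hN2,
      ContinuousLinearMap.comp_id]
  have hd := (differentiable_det (d := d) (M t x ∘L N)).hasFDerivAt.comp_hasDerivWithinAt t hc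
  rw [hN2, fderiv_det_id, ← divergence_eq_diagSum] at hd
  exact (hd.mul_const ((M t x).det)).congr (fun τ _ => e τ) (e t)

end Determinant

section Density

variable {d : ℕ} {J : Set ℝ} {Ω : Set (E d)} {v X G : ℝ → E d → E d}
  {M : ℝ → E d → E d →L[ℝ] E d} {I : ℝ → E d → ℝ} {ρ₀ : E d → ℝ}

/-- `I_t(x) = ∫₀ᵗ (∇·v_s)(X_s(x)) ds`, the logarithm of the Jacobian of the flow. -/
structure IsLogJacobian (J : Set ℝ) (Ω : Set (E d)) (v X : ℝ → E d → E d)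
    (I : ℝ → E d → ℝ) : Prop where
  init : ∀ x ∈ Ω, I 0 x = 0
  ode : ∀ x ∈ Ω, ∀ t ∈ J, HasDerivWithinAt (fun τ => I τ x) (divergence (v t) (X t x)) J t

theorem IsFlow.exists_isLogJacobian (hX : IsFlow J Ω v X) (hv : FlowField J Ω v)
    (hJ : TimeDomain J) : ∃ I, IsLogJacobian J Ω v X I := by
  have hc := hX.continuousOn_comp hv hJ (f := fun t => divergence (v t))
    hv.divergence_C1.continuousOn
  have : ∀ x ∈ Ω, ∃ y : ℝ → ℝ, y 0 = 0 ∧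
      ∀ t ∈ J, HasDerivWithinAt y (divergence (v t) (X t x)) J t := by
    intro x hx
    obtain ⟨y, hy0, hy⟩ := exists_linear_ode hJ (A := fun _ => (0 : ℝ →L[ℝ] ℝ))
      (c := fun t => divergence (v t) (X t x)) continuousOn_const
      (hc.comp (f := fun t => (t, x)) (by fun_prop) fun t ht => ⟨ht, hx⟩) 0
    exact ⟨y, hy0, fun t ht => by simpa using hy t ht⟩
  choose! I hI0 hI using this
  exact ⟨fun t x => I x t, hI0, hI⟩

theorem IsLogJacobian.continuousOn (hI : IsLogJacobian J Ω v X I) (hX : IsFlow J Ω v X)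
    (hv : FlowField J Ω v) (hJ : TimeDomain J) :
    ContinuousOn (fun p : ℝ × E d => I p.1 p.2) (J ×ˢ Ω) := by
  refine continuousOn_of_linear_ode hJ hv.isOpen (A := fun _ _ => (0 : ℝ →L[ℝ] ℝ))
    (c := fun t x => divergence (v t) (X t x)) continuousOn_const
    (hX.continuousOn_comp hv hJ (f := fun t => divergence (v t)) hv.divergence_C1.continuousOn)
    (continuousOn_const.congr hI.init) fun x hx t ht => ?_
  simpa using hI.ode x hx t ht

/-- Liouville's formula. -/
theorem IsLogJacobian.det_eq (hI : IsLogJacobian J Ω v X I) (hM : IsFlowDeriv J Ω v X M)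
    (hX : IsFlow J Ω v X) (hv : FlowField J Ω v) (hJ : TimeDomain J) {t : ℝ} (ht : t ∈ J)
    {x : E d} (hx : x ∈ Ω) : (M t x).det = Real.exp (I t x) := by
  have h := eqOn_of_hasDerivWithinAt_zero hJ (f := fun t => (M t x).det * Real.exp (-I t x))
    (fun s hs => ((hM.hasDerivWithinAt_det hX hv hJ hs hx).mul
      ((hI.ode x hx s hs).neg.exp)).congr_deriv (by simp only [Pi.neg_apply]; ring)) ht
  simp only [hM.init x hx, hI.init x hx] at h
  rw [Real.exp_neg, ← div_eq_mul_inv, div_eq_iff (Real.exp_ne_zero _)] at h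
  rw [h]
  simp [ContinuousLinearMap.det]

/-- The equation for `G` along the flow. -/
def IsScoreSol (J : Set ℝ) (Ω : Set (E d)) (v X G : ℝ → E d → E d) : Prop :=
  ∀ t ∈ J, ∀ x ∈ Ω, HasDerivWithinAt (fun τ => G τ x)
    (-(ContinuousLinearMap.adjoint (fderiv ℝ (v t) (X t x)) (G t x))
      - gradient (divergence (v t)) (X t x)) J t

theorem FlowField.continuousOn_gradient_divergence (hv : FlowField J Ω v) :
    ContinuousOn (fun p : ℝ × E d => gradient (divergence (v p.1)) p.2) (J ×ˢ Ω) :=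
  ((InnerProductSpace.toDual ℝ (E d)).symm.continuous.comp_continuousOn
    (hv.divergence_C1.fderiv hv.isOpen).continuousOn)

theorem IsFlow.exists_isScoreSol (hX : IsFlow J Ω v X) (hv : FlowField J Ω v) (hJ : TimeDomain J)
    (g : E d → E d) : ∃ G, (∀ x ∈ Ω, G 0 x = g x) ∧ IsScoreSol J Ω v X G := by
  have hA := hX.continuousOn_comp hv hJ (f := fun t => fderiv ℝ (v t))
    (hv.C2.fderiv hv.isOpen).continuousOn
  have hc := hX.continuousOn_comp hv hJ (f := fun t => gradient (divergence (v t)))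
    hv.continuousOn_gradient_divergence
  have : ∀ x ∈ Ω, ∃ y : ℝ → E d, y 0 = g x ∧ ∀ t ∈ J, HasDerivWithinAt y
      (-(ContinuousLinearMap.adjoint (fderiv ℝ (v t) (X t x)) (y t))
      - gradient (divergence (v t)) (X t x)) J t := by
    intro x hx
    have hmap : ContinuousOn (fun t => (t, x)) J := by fun_prop
    have hA' : ContinuousOn (fun t => -(ContinuousLinearMap.adjoint (fderiv ℝ (v t) (X t x)))) J :=
      ((ContinuousLinearMap.adjoint (𝕜 := ℝ) (E := E d) (F := E d)).continuous.comp_continuousOn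
        (hA.comp hmap fun t ht => ⟨ht, hx⟩)).neg
    obtain ⟨y, hy0, hy⟩ := exists_linear_ode hJ hA'
      (hc.comp hmap fun t ht => ⟨ht, hx⟩).neg (g x)
    exact ⟨y, hy0, fun t ht => by simpa [sub_eq_add_neg] using hy t ht⟩
  choose! G hG0 hG using this
  exact ⟨fun t x => G x t, hG0, fun t ht x hx => hG x hx t ht⟩

theorem IsScoreSol.continuousOn (hG : IsScoreSol J Ω v X G) (hX : IsFlow J Ω v X)
    (hv : FlowField J Ω v) (hJ : TimeDomain J) (hG0 : ContinuousOn (G 0) Ω) :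
    ContinuousOn (fun p : ℝ × E d => G p.1 p.2) (J ×ˢ Ω) := by
  have hA := hX.continuousOn_comp hv hJ (f := fun t => fderiv ℝ (v t))
    (hv.C2.fderiv hv.isOpen).continuousOn
  have hc := hX.continuousOn_comp hv hJ (f := fun t => gradient (divergence (v t)))
    hv.continuousOn_gradient_divergence
  have hA' : ContinuousOn (fun p : ℝ × E d =>
      -(ContinuousLinearMap.adjoint (fderiv ℝ (v p.1) (X p.1 p.2)))) (J ×ˢ Ω) :=
    ((ContinuousLinearMap.adjoint (𝕜 := ℝ) (E := E d) (F := E d)).continuous.comp_continuousOn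
      hA).neg
  refine continuousOn_of_linear_ode hJ hv.isOpen
    (A := fun t x => -(ContinuousLinearMap.adjoint (fderiv ℝ (v t) (X t x))))
    (c := fun t x => -gradient (divergence (v t)) (X t x)) hA' hc.neg hG0 fun x hx t ht => ?_
  simpa [sub_eq_add_neg] using hG t ht x hx

theorem inner_gradient_eq {f : E d → ℝ} {x k : E d} :
    inner ℝ (gradient f x) k = fderiv ℝ f x k := by
  rw [gradient, InnerProductSpace.toDual_symm_apply]

theorem IsLogJacobian.hasFDerivAt (hI : IsLogJacobian J Ω v X I) (hG : IsScoreSol J Ω v X G)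
    (hM : IsFlowDeriv J Ω v X M) (hX : IsFlow J Ω v X) (hv : FlowField J Ω v)
    (hJ : TimeDomain J) {T : ℝ} (hT : T ∈ J) {x₀ : E d} (hx₀ : x₀ ∈ Ω) :
    HasFDerivAt (I T) (innerSL ℝ (G 0 x₀) - innerSL ℝ (G T x₀) ∘L M T x₀) x₀ := by
  have hsub := hJ.Icc_subset hT
  have hT0 := hJ.nonneg T hT
  obtain ⟨C, hC, hlip⟩ := hX.exists_eventually_norm_sub_le hv hJ hT hx₀
  have hA := hX.continuousOn_comp hv hJ (f := fun t => fderiv ℝ (divergence (v t)))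
    (hv.divergence_C1.fderiv hv.isOpen).continuousOn
  have hAx : ContinuousOn (fun t => fderiv ℝ (divergence (v t)) (X t x₀)) (Icc 0 T) :=
    hA.comp (f := fun t => (t, x₀)) (by fun_prop) fun t ht => ⟨hsub ht, hx₀⟩
  obtain ⟨K, hK⟩ := isCompact_Icc.exists_bound_of_continuousOn hAx
  have hK0 : 0 ≤ K := (norm_nonneg _).trans (hK 0 ⟨le_rfl, hT0⟩)
  set g := gronwallBound 1 0 1 T
  have hg : 0 ≤ g := gronwallBound_one_nonneg le_rfl hT0
  obtain ⟨hKc, hKΩ⟩ := hX.isCompact_orbit hJ hT hx₀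
  refine HasFDerivAt.of_isLittleO (Asymptotics.isLittleO_iff.2 fun ε hε => ?_)
  set ε' := ε / ((C + K) * (g + 1))
  have hε' : 0 < ε' := by positivity
  obtain ⟨r, hr, h⟩ := exists_forall_norm_sub_sub_le hv.isOpen (isCompact_Icc (a := 0) (b := T))
    hKc hKΩ (fun t ht x hx => hv.divergence_C1.hasFDerivAt hv.isOpen (hsub ht) hx)
    ((hv.divergence_C1.fderiv hv.isOpen).continuousOn.mono (prod_mono_left hsub)) hε'
  filter_upwards [hlip, Metric.ball_mem_nhds x₀ (div_pos hr hC),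
    hM.eventually_norm_sub_sub_le hX hv hJ hT hx₀ hε'] with x hx hxr hxM
  obtain ⟨hxΩ, hx⟩ := hx
  rw [mem_ball_iff_norm, lt_div_iff₀' hC] at hxr
  have hη : 0 ≤ ε' * ((C + K) * ‖x - x₀‖) := by positivity
  have := norm_le_mul_gronwallBound (K := 0)
    (f := fun t => I t x - I t x₀ - inner ℝ (G 0 x₀) (x - x₀) + inner ℝ (G t x₀) (M t x₀ (x - x₀)))
    (f' := fun t => divergence (v t) (X t x) - divergence (v t) (X t x₀) -
      fderiv ℝ (divergence (v t)) (X t x₀) (M t x₀ (x - x₀))) le_rfl hη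
    (fun s hs => by
      have h1 := (hM.ode x₀ hx₀ s (hsub hs)).clm_apply (hasDerivWithinAt_const s J (x - x₀))
      have h2 := (hG s (hsub hs) x₀ hx₀).inner ℝ h1
      refine (((((hI.ode x hxΩ s (hsub hs)).sub (hI.ode x₀ hx₀ s (hsub hs))).sub_const
        (inner ℝ (G 0 x₀) (x - x₀))).add h2).congr_deriv ?_).mono hsub
      simp only [map_zero, add_zero, inner_sub_left, inner_neg_left,
        ContinuousLinearMap.adjoint_inner_left, inner_gradient_eq, ContinuousLinearMap.comp_apply]
      ring)
    (by simpa [hI.init x hxΩ, hI.init x₀ hx₀, hM.init x₀ hx₀] using hη)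
    (fun s hs => by
      have e : divergence (v s) (X s x) - divergence (v s) (X s x₀) -
          fderiv ℝ (divergence (v s)) (X s x₀) (M s x₀ (x - x₀)) =
          fderiv ℝ (divergence (v s)) (X s x₀) (X s x - X s x₀ - M s x₀ (x - x₀)) +
          (divergence (v s) (X s x) - divergence (v s) (X s x₀) -
            fderiv ℝ (divergence (v s)) (X s x₀) (X s x - X s x₀)) := by
        simp only [map_sub]
        ring
      rw [e, zero_mul, zero_add]
      have h1 := (fderiv ℝ (divergence (v s)) (X s x₀)).le_of_opNorm_le (hK s hs)
        (X s x - X s x₀ - M s x₀ (x - x₀))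
      have h2 := h s hs _ (mem_image_of_mem _ hs) _ ((hx s hs).trans_lt hxr)
      have h3 := mul_le_mul_of_nonneg_left (hx s hs) hε'.le
      have h4 := mul_le_mul_of_nonneg_left (hxM s hs) hK0
      refine (norm_add_le _ _).trans ?_
      linarith) T ⟨hT0, le_rfl⟩
  have e1 : I T x - I T x₀ - (innerSL ℝ (G 0 x₀) - innerSL ℝ (G T x₀) ∘L M T x₀) (x - x₀) =
      I T x - I T x₀ - inner ℝ (G 0 x₀) (x - x₀) + inner ℝ (G T x₀) (M T x₀ (x - x₀)) := by
    simp only [sub_apply, ContinuousLinearMap.comp_apply, innerSL_apply_apply]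
    ring
  rw [e1]
  refine this.trans ?_
  have e : ε' * ((C + K) * ‖x - x₀‖) * g = ε * ‖x - x₀‖ * (g / (g + 1)) := by
    simp only [ε']
    field_simp
  rw [e]
  refine mul_le_of_le_one_right (by positivity) ?_
  rw [div_le_one (by positivity)]
  linarith

theorem IsFlow.hasFDerivAt_flowInv (hX : IsFlow J Ω v X) (hM : IsFlowDeriv J Ω v X M)
    (hv : FlowField J Ω v) (hJ : TimeDomain J) {t : ℝ} (ht : t ∈ J) {p : E d} (hp : p ∈ Ω) :
    ∃ N : E d →L[ℝ] E d, M t (flowInv Ω X t p) ∘L N = ContinuousLinearMap.id ℝ (E d) ∧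
      HasFDerivAt (flowInv Ω X t) N p := by
  have hx := hX.flowInv_mem hv hJ ht hp
  obtain ⟨N, hN1, hN2⟩ := hM.exists_inverse hX hv hJ ht hx
  refine ⟨N, hN2, ?_⟩
  set e : E d ≃L[ℝ] E d := ContinuousLinearEquiv.equivOfInverse (M t (flowInv Ω X t p)) N
    (fun k => congrArg (fun f : E d →L[ℝ] E d => f k) hN1)
    (fun k => congrArg (fun f : E d →L[ℝ] E d => f k) hN2)
  have hc : ContinuousAt (flowInv Ω X t) p :=
    (((hX.continuousOn_flowInv hv hJ).comp (f := fun p => (t, p)) (by fun_prop)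
      fun p hp => ⟨ht, hp⟩).continuousAt (hv.isOpen.mem_nhds hp) :)
  exact HasFDerivAt.of_local_left_inverse (f' := e) hc (hM.hasFDerivAt hX hv hJ ht hx)
    (by
      filter_upwards [hv.isOpen.mem_nhds hp] with q hq
      exact hX.apply_flowInv hv hJ ht hq)

/-- The density of the push-forward of `ρ₀` under the flow. -/
noncomputable def flowDensity (Ω : Set (E d)) (X : ℝ → E d → E d) (I : ℝ → E d → ℝ)
    (ρ₀ : E d → ℝ) (t : ℝ) (p : E d) : ℝ :=
  ρ₀ (flowInv Ω X t p) * Real.exp (-I t (flowInv Ω X t p))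

end Density

section Transport

variable {d : ℕ} {J : Set ℝ} {Ω : Set (E d)} {v X G : ℝ → E d → E d}
  {M : ℝ → E d → E d →L[ℝ] E d} {I : ℝ → E d → ℝ} {ρ₀ : E d → ℝ}

/-- A density `ρ₀`, the flow `X` of `v` with its derivative `M` and logarithmic Jacobian `I`, and
the solution `G` of the equation for the score along the flow. -/
structure Transport (J : Set ℝ) (Ω : Set (E d)) (ρ₀ : E d → ℝ) (v X G : ℝ → E d → E d)
    (M : ℝ → E d → E d →L[ℝ] E d) (I : ℝ → E d → ℝ) : Prop where
  time : TimeDomain J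
  field : FlowField J Ω v
  flow : IsFlow J Ω v X
  deriv : IsFlowDeriv J Ω v X M
  logJac : IsLogJacobian J Ω v X I
  score_init : ∀ x ∈ Ω, G 0 x = score ρ₀ x
  score_sol : IsScoreSol J Ω v X G
  ρ₀_C1 : ContDiffOn ℝ 1 ρ₀ Ω
  ρ₀_pos : ∀ x ∈ Ω, 0 < ρ₀ x

theorem FlowField.exists_transport (hv : FlowField J Ω v) (hJ : TimeDomain J)
    (hX : IsFlow J Ω v X) (hG0 : ∀ x ∈ Ω, G 0 x = score ρ₀ x) (hG : IsScoreSol J Ω v X G)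
    (hρ : ContDiffOn ℝ 1 ρ₀ Ω) (hpos : ∀ x ∈ Ω, 0 < ρ₀ x) :
    ∃ M I, Transport J Ω ρ₀ v X G M I := by
  obtain ⟨M, hM⟩ := hX.exists_isFlowDeriv hv hJ
  obtain ⟨I, hI⟩ := hX.exists_isLogJacobian hv hJ
  exact ⟨M, I, hJ, hv, hX, hM, hI, hG0, hG, hρ, hpos⟩

theorem Transport.continuousOn_score (h : Transport J Ω ρ₀ v X G M I) :
    ContinuousOn (fun p : ℝ × E d => G p.1 p.2) (J ×ˢ Ω) := by
  refine h.score_sol.continuousOn h.flow h.field h.time ?_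
  have h1 : ContinuousOn (fun x => (ρ₀ x)⁻¹ • gradient ρ₀ x) Ω :=
    (h.ρ₀_C1.continuousOn.inv₀ fun x hx => (h.ρ₀_pos x hx).ne').smul
      ((InnerProductSpace.toDual ℝ (E d)).symm.continuous.comp_continuousOn
        (h.ρ₀_C1.continuousOn_fderiv_of_isOpen h.field.isOpen le_rfl))
  refine h1.congr fun x hx => ?_
  rw [h.score_init x hx, score_eq _ (h.ρ₀_pos x hx).ne']
  exact (h.ρ₀_C1.differentiableOn one_ne_zero).differentiableAt (h.field.isOpen.mem_nhds hx)

theorem Transport.flowDensity_pos (h : Transport J Ω ρ₀ v X G M I) {t : ℝ} (ht : t ∈ J)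
    {p : E d} (hp : p ∈ Ω) : 0 < flowDensity Ω X I ρ₀ t p :=
  mul_pos (h.ρ₀_pos _ (h.flow.flowInv_mem h.field h.time ht hp)) (Real.exp_pos _)

theorem Transport.flowDensity_apply (h : Transport J Ω ρ₀ v X G M I) {t : ℝ} (ht : t ∈ J)
    {x : E d} (hx : x ∈ Ω) : flowDensity Ω X I ρ₀ t (X t x) = ρ₀ x * Real.exp (-I t x) := by
  rw [flowDensity, h.flow.flowInv_apply h.field h.time ht hx]

theorem Transport.flowDensity_zero (h : Transport J Ω ρ₀ v X G M I)
    {x : E d} (hx : x ∈ Ω) : flowDensity Ω X I ρ₀ 0 x = ρ₀ x := by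
  have := h.flowDensity_apply h.time.zero_mem hx
  rwa [h.flow.init x hx, h.logJac.init x hx, neg_zero, Real.exp_zero, mul_one] at this

theorem Transport.hasGradientAt_log_flowDensity (h : Transport J Ω ρ₀ v X G M I) {t : ℝ}
    (ht : t ∈ J) {p : E d} (hp : p ∈ Ω) :
    HasGradientAt (fun q => Real.log (flowDensity Ω X I ρ₀ t q)) (G t (flowInv Ω X t p)) p := by
  have hx := h.flow.flowInv_mem h.field h.time ht hp
  set x := flowInv Ω X t p with hxdef
  obtain ⟨N, hN, hY⟩ := h.flow.hasFDerivAt_flowInv h.deriv h.field h.time ht hp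
  have h1 : HasFDerivAt (fun x => Real.log (ρ₀ x)) (innerSL ℝ (score ρ₀ x)) x := by
    have hd : DifferentiableAt ℝ ρ₀ x :=
      (h.ρ₀_C1.differentiableOn one_ne_zero).differentiableAt (h.field.isOpen.mem_nhds hx)
    exact (hd.log (h.ρ₀_pos x hx).ne').hasGradientAt.hasFDerivAt
  have h2 := h.logJac.hasFDerivAt h.score_sol h.deriv h.flow h.field h.time ht hx
  have h3 := (h1.sub h2).comp p hY
  rw [hasGradientAt_iff_hasFDerivAt]
  refine (h3.congr_of_eventuallyEq ?_).congr_fderiv ?_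
  · filter_upwards [h.field.isOpen.mem_nhds hp] with q hq
    have hq' := h.flow.flowInv_mem h.field h.time ht hq
    rw [flowDensity, Real.log_mul (h.ρ₀_pos _ hq').ne' (Real.exp_ne_zero _), Real.log_exp,
      ← sub_eq_add_neg]
    rfl
  · rw [h.score_init x hx, sub_sub_cancel, ContinuousLinearMap.comp_assoc, hN,
      ContinuousLinearMap.comp_id]
    rfl

theorem Transport.score_flowDensity (h : Transport J Ω ρ₀ v X G M I) {t : ℝ} (ht : t ∈ J)
    {p : E d} (hp : p ∈ Ω) : score (flowDensity Ω X I ρ₀ t) p = G t (flowInv Ω X t p) :=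
  (h.hasGradientAt_log_flowDensity ht hp).gradient

theorem Transport.hasFDerivAt_flowDensity (h : Transport J Ω ρ₀ v X G M I) {t : ℝ}
    (ht : t ∈ J) {p : E d} (hp : p ∈ Ω) :
    HasFDerivAt (flowDensity Ω X I ρ₀ t)
      (flowDensity Ω X I ρ₀ t p • innerSL ℝ (G t (flowInv Ω X t p))) p := by
  have h1 := (h.hasGradientAt_log_flowDensity ht hp).hasFDerivAt.exp
  rw [Real.exp_log (h.flowDensity_pos ht hp)] at h1
  refine h1.congr_of_eventuallyEq ?_
  filter_upwards [h.field.isOpen.mem_nhds hp] with q hq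
  rw [Real.exp_log (h.flowDensity_pos ht hq)]

theorem Transport.continuousOn_score_flowInv (h : Transport J Ω ρ₀ v X G M I) :
    ContinuousOn (fun p : ℝ × E d => G p.1 (flowInv Ω X p.1 p.2)) (J ×ˢ Ω) :=
  h.continuousOn_score.comp (f := fun p : ℝ × E d => (p.1, flowInv Ω X p.1 p.2))
    (continuousOn_fst.prodMk (h.flow.continuousOn_flowInv h.field h.time))
    fun _ hp => ⟨hp.1, h.flow.flowInv_mem h.field h.time hp.1 hp.2⟩

theorem Transport.flowDensity_C1 (h : Transport J Ω ρ₀ v X G M I) :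
    CkInSpace J Ω 1 (flowDensity Ω X I ρ₀) := by
  have hY := h.flow.continuousOn_flowInv h.field h.time
  have hmem : ∀ p ∈ J ×ˢ Ω, flowInv Ω X p.1 p.2 ∈ Ω := fun p hp =>
    h.flow.flowInv_mem h.field h.time hp.1 hp.2
  have hc : ContinuousOn (fun p : ℝ × E d => flowDensity Ω X I ρ₀ p.1 p.2) (J ×ˢ Ω) :=
    (h.ρ₀_C1.continuousOn.comp hY hmem).mul
      (((h.logJac.continuousOn h.flow h.field h.time).comp
        (f := fun p : ℝ × E d => (p.1, flowInv Ω X p.1 p.2)) (continuousOn_fst.prodMk hY)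
        fun p hp => ⟨hp.1, hmem p hp⟩).neg.rexp)
  refine (ckInSpace_succ_iff h.field.isOpen).2 ⟨fun t ht p hp =>
    (h.hasFDerivAt_flowDensity ht hp).differentiableAt.differentiableWithinAt, hc, ?_⟩
  rw [ckInSpace_zero_iff]
  have h1 : ContinuousOn (fun p : ℝ × E d => flowDensity Ω X I ρ₀ p.1 p.2 •
      innerSL ℝ (G p.1 (flowInv Ω X p.1 p.2))) (J ×ˢ Ω) :=
    hc.smul ((innerSL ℝ (E := E d)).continuous.comp_continuousOn h.continuousOn_score_flowInv)
  exact h1.congr fun p hp => (h.hasFDerivAt_flowDensity hp.1 hp.2).fderiv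

/-- If `F` is `C¹` in space, then moving its argument along a differentiable curve contributes the
spatial derivative to the total derivative. -/
theorem hasDerivWithinAt_sub_of_C1 {F : ℝ → E d → ℝ} {F' : ℝ → E d → E d →L[ℝ] ℝ}
    (hΩ : IsOpen Ω) (hF : ∀ t ∈ J, ∀ x ∈ Ω, HasFDerivAt (F t) (F' t x) x)
    (hF' : ContinuousOn (fun p : ℝ × E d => F' p.1 p.2) (J ×ˢ Ω)) {t : ℝ} (ht : t ∈ J)
    {z : ℝ → E d} {z' : E d} (hzt : z t ∈ Ω) (hz : HasDerivWithinAt z z' J t) :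
    HasDerivWithinAt (fun τ => F τ (z τ) - F τ (z t)) (F' t (z t) z') J t := by
  have key : (fun τ => F τ (z τ) - F τ (z t) - F' t (z t) (z τ - z t)) =o[𝓝[J] t]
      fun τ => z τ - z t := by
    refine Asymptotics.isLittleO_iff.2 fun ε hε => ?_
    have h1 : ∀ᶠ p in 𝓝[J ×ˢ Ω] (t, z t), dist (F' p.1 p.2) (F' t (z t)) < ε :=
      Metric.tendsto_nhds.1 (hF' (t, z t) ⟨ht, hzt⟩) ε hε
    rw [nhdsWithin_prod_eq, eventually_prod_iff] at h1
    obtain ⟨pa, hpa, pb, hpb, hab⟩ := h1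
    rw [hΩ.nhdsWithin_eq hzt] at hpb
    obtain ⟨r, hr, hball⟩ := Metric.eventually_nhds_iff_ball.1 (hpb.and (hΩ.mem_nhds hzt))
    have h2 : ∀ᶠ τ in 𝓝[J] t, z τ ∈ Metric.ball (z t) r :=
      hz.continuousWithinAt (Metric.ball_mem_nhds _ hr)
    filter_upwards [hpa, h2, self_mem_nhdsWithin] with τ h3 h4 h5
    refine (convex_ball (z t) r).norm_image_sub_le_of_norm_hasFDerivWithin_le' (f' := F' τ)
      (fun q hq => (hF τ h5 q (hball q hq).2).hasFDerivWithinAt) (fun q hq => ?_)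
      (Metric.mem_ball_self hr) h4
    rw [← dist_eq_norm]
    exact (hab h3 (hball q hq).1).le
  have hO : (fun τ => z τ - z t) =O[𝓝[J] t] fun τ => τ - t := hz.hasFDerivWithinAt.isBigO_sub
  have h2 : HasDerivWithinAt (fun τ => F' t (z t) (z τ - z t)) (F' t (z t) z') J t :=
    (F' t (z t)).hasFDerivAt.comp_hasDerivWithinAt t (hz.sub_const (z t))
  have h3 : HasDerivWithinAt (fun τ => F τ (z τ) - F τ (z t) - F' t (z t) (z τ - z t)) 0 J t := by
    rw [hasDerivWithinAt_iff_isLittleO]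
    simpa using key.trans_isBigO hO
  have h4 := h3.add h2
  rw [zero_add] at h4
  exact h4.congr (fun τ _ => by simp) (by simp)

theorem divergence_smul {ρ : E d → ℝ} {w : E d → E d} {x : E d} {ρ' : E d →L[ℝ] ℝ}
    (hρ : HasFDerivAt ρ ρ' x) (hw : DifferentiableAt ℝ w x) :
    divergence (fun y => ρ y • w y) x = ρ x * divergence w x + ρ' (w x) := by
  have h1 := hρ.fun_smul hw.hasFDerivAt
  have h2 : ρ' (w x) = ∑ i, ρ' (EuclideanSpace.single i 1) * w x i := by
    have h3 : w x = ∑ i, w x i • EuclideanSpace.single i (1 : ℝ) := by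
      conv_lhs => rw [← (EuclideanSpace.basisFun (Fin d) ℝ).sum_repr (w x)]
      simp
    conv_lhs => rw [h3, map_sum]
    simp [mul_comm]
  rw [divergence, h1.fderiv, h2, divergence, Finset.mul_sum, ← Finset.sum_add_distrib]
  simp

theorem Transport.solvesTE (h : Transport J Ω ρ₀ v X G M I) :
    SolvesTE J Ω v (flowDensity Ω X I ρ₀) := by
  intro t ht p hp
  set x := flowInv Ω X t p with hx_def
  have hx : x ∈ Ω := h.flow.flowInv_mem h.field h.time ht hp
  have hXx : X t x = p := h.flow.apply_flowInv h.field h.time ht hp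
  have h1 : HasDerivWithinAt (fun τ => Real.log (flowDensity Ω X I ρ₀ τ (X τ x)))
      (-divergence (v t) p) J t := by
    have h2 := ((h.logJac.ode x hx t ht).const_sub (Real.log (ρ₀ x)))
    rw [hXx] at h2
    have e : ∀ τ ∈ J, Real.log (flowDensity Ω X I ρ₀ τ (X τ x)) = Real.log (ρ₀ x) - I τ x := by
      intro τ hτ
      rw [h.flowDensity_apply hτ hx, Real.log_mul (h.ρ₀_pos x hx).ne' (Real.exp_ne_zero _),
        Real.log_exp, sub_eq_add_neg]
    exact h2.congr e (e t ht)
  have h2 := hasDerivWithinAt_sub_of_C1 (F := fun t q => Real.log (flowDensity Ω X I ρ₀ t q))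
    (F' := fun t q => innerSL ℝ (G t (flowInv Ω X t q))) h.field.isOpen
    (fun t ht q hq => (h.hasGradientAt_log_flowDensity ht hq).hasFDerivAt)
    ((innerSL ℝ (E := E d)).continuous.comp_continuousOn h.continuousOn_score_flowInv) ht
    (z := fun τ => X τ x) (h.flow.mapsTo ht hx) (h.flow.sol x hx t ht).2
  simp only [hXx, ← hx_def] at h2
  have h3 := (h1.sub h2).exp
  simp only [Pi.sub_apply, sub_sub_cancel, hXx] at h3
  rw [divergence_smul (h.hasFDerivAt_flowDensity ht hp)
    (h.field.C2.hasFDerivAt h.field.isOpen ht hp).differentiableAt]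
  rw [Real.exp_log (h.flowDensity_pos ht hp)] at h3
  refine (h3.congr (fun τ hτ => (Real.exp_log (h.flowDensity_pos hτ hp)).symm)
    (Real.exp_log (h.flowDensity_pos ht hp)).symm).congr_deriv ?_
  simp only [← hx_def, smul_apply, smul_eq_mul]
  ring

theorem IsFlow.continuousOn_apply (hX : IsFlow J Ω v X) (hv : FlowField J Ω v)
    (hJ : TimeDomain J) {t : ℝ} (ht : t ∈ J) : ContinuousOn (X t) Ω :=
  (hX.continuousOn hv hJ).comp (f := fun x => (t, x)) (by fun_prop) fun _ hx => ⟨ht, hx⟩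

theorem aemeasurable_ofReal_of_continuousOn (hΩ : IsOpen Ω) {ρ : E d → ℝ}
    (hρ : ContinuousOn ρ Ω) : AEMeasurable (fun x => ENNReal.ofReal (ρ x)) (volume.restrict Ω) :=
  (hρ.aemeasurable hΩ.measurableSet).ennreal_ofReal

theorem lintegral_densityMeasure (hΩ : IsOpen Ω) {ρ : E d → ℝ} (hρ : ContinuousOn ρ Ω)
    (f : E d → ℝ≥0∞) :
    ∫⁻ x, f x ∂(densityMeasure Ω ρ) = ∫⁻ x in Ω, ENNReal.ofReal (ρ x) * f x := by
  rw [densityMeasure, lintegral_withDensity_eq_lintegral_mul_non_measurable₀ _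
    (aemeasurable_ofReal_of_continuousOn hΩ hρ) (Eventually.of_forall fun _ => ENNReal.ofReal_lt_top)]
  rfl

theorem densityMeasure_ac (ρ : E d → ℝ) : densityMeasure Ω ρ ≪ volume.restrict Ω :=
  withDensity_absolutelyContinuous _ _

theorem aemeasurable_densityMeasure (hΩ : IsOpen Ω) {ρ : E d → ℝ} {H : Type*} [TopologicalSpace H]
    [MeasurableSpace H] [BorelSpace H] {f : E d → H} (hf : ContinuousOn f Ω) :
    AEMeasurable f (densityMeasure Ω ρ) :=
  (hf.aemeasurable hΩ.measurableSet).mono_ac (densityMeasure_ac ρ)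

/-- Change of variables along the flow. -/
theorem Transport.map_eq (h : Transport J Ω ρ₀ v X G M I) {t : ℝ} (ht : t ∈ J) {ρ : E d → ℝ}
    (hρ : ContinuousOn ρ Ω) (heq : ∀ x ∈ Ω, ρ (X t x) = ρ₀ x * Real.exp (-I t x)) :
    (densityMeasure Ω ρ₀).map (X t) = densityMeasure Ω ρ := by
  have hΩ := h.field.isOpen
  have hXm : AEMeasurable (X t) (densityMeasure Ω ρ₀) :=
    aemeasurable_densityMeasure hΩ (h.flow.continuousOn_apply h.field h.time ht)
  refine Measure.ext_of_lintegral _ fun f hf => ?_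
  rw [lintegral_map' hf.aemeasurable hXm, lintegral_densityMeasure hΩ h.ρ₀_C1.continuousOn,
    lintegral_densityMeasure hΩ hρ]
  conv_rhs => rw [← h.flow.image_eq h.field h.time ht]
  rw [lintegral_image_eq_lintegral_abs_det_fderiv_mul volume hΩ.measurableSet
    (fun x hx => (h.deriv.hasFDerivAt h.flow h.field h.time ht hx).hasFDerivWithinAt)
    (h.flow.injOn h.field h.time ht)]
  refine setLIntegral_congr_fun hΩ.measurableSet fun x hx => ?_
  rw [← mul_assoc, ← ENNReal.ofReal_mul (abs_nonneg _),
    h.logJac.det_eq h.deriv h.flow h.field h.time ht hx, abs_of_pos (Real.exp_pos _), heq x hx,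
    mul_left_comm, ← Real.exp_add, add_neg_cancel, Real.exp_zero, mul_one]

theorem Transport.map_eq_flowDensity (h : Transport J Ω ρ₀ v X G M I) {t : ℝ} (ht : t ∈ J) :
    (densityMeasure Ω ρ₀).map (X t) = densityMeasure Ω (flowDensity Ω X I ρ₀ t) :=
  h.map_eq ht (h.flowDensity_C1.continuousOn.comp (f := fun x => (t, x)) (by fun_prop)
    fun _ hx => ⟨ht, hx⟩) fun _ hx => h.flowDensity_apply ht hx

/-- A solution of the transport equation is given by the flow. -/
theorem Transport.eq_flowDensity_of_solvesTE (h : Transport J Ω ρ₀ v X G M I) {ρ : ℝ → E d → ℝ}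
    (hρ : CkInSpace J Ω 1 ρ) (h0 : ∀ x ∈ Ω, ρ 0 x = ρ₀ x) (hTE : SolvesTE J Ω v ρ)
    {t : ℝ} (ht : t ∈ J) {p : E d} (hp : p ∈ Ω) : ρ t p = flowDensity Ω X I ρ₀ t p := by
  have hΩ := h.field.isOpen
  have key : ∀ x ∈ Ω, ρ t (X t x) = ρ₀ x * Real.exp (-I t x) := by
    intro x hx
    have hd : ∀ s ∈ J, HasDerivWithinAt (fun τ => ρ τ (X τ x) * Real.exp (I τ x)) 0 J s := by
      intro s hs
      have hXs := h.flow.mapsTo hs hx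
      have h1 := hasDerivWithinAt_sub_of_C1 (F := ρ) (F' := fun t => fderiv ℝ (ρ t)) hΩ
        (fun t ht q hq => hρ.hasFDerivAt hΩ ht hq) (hρ.fderiv hΩ).continuousOn hs
        (z := fun τ => X τ x) hXs (h.flow.sol x hx s hs).2
      have h2 := h1.add (hTE s hs _ hXs)
      have h3 : HasDerivWithinAt (fun τ => ρ τ (X τ x))
          (-(ρ s (X s x) * divergence (v s) (X s x))) J s := by
        refine (h2.congr (fun τ _ => by simp) (by simp)).congr_deriv ?_
        rw [divergence_smul (hρ.hasFDerivAt hΩ hs hXs)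
          (h.field.C2.hasFDerivAt hΩ hs hXs).differentiableAt]
        ring
      refine (h3.mul (h.logJac.ode x hx s hs).exp).congr_deriv ?_
      ring
    have := eqOn_of_hasDerivWithinAt_zero h.time hd ht
    simp only [h.flow.init x hx, h.logJac.init x hx, Real.exp_zero, mul_one, h0 x hx] at this
    rw [← this, mul_assoc, ← Real.exp_add, add_neg_cancel, Real.exp_zero, mul_one]
  rw [flowDensity, ← key _ (h.flow.flowInv_mem h.field h.time ht hp),
    h.flow.apply_flowInv h.field h.time ht hp]

end Transport

section Cutoff

variable {d : ℕ} {J : Set ℝ} {Ω : Set (E d)} {v X : ℝ → E d → E d}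

theorem mem_of_dist_lt_infDist_compl {p q : E d} (h : dist p q < Metric.infDist p Ωᶜ) : q ∈ Ω := by
  by_contra hq
  exact absurd (Metric.infDist_le_dist_of_mem (s := Ωᶜ) (x := p) hq) (not_le.2 h)

theorem infDist_compl_pos (hΩ : IsOpen Ω) (hne : Ωᶜ.Nonempty) {p : E d} (hp : p ∈ Ω) :
    0 < Metric.infDist p Ωᶜ :=
  (hΩ.isClosed_compl.notMem_iff_infDist_pos hne).1 fun h => h hp

/-- The flow changes the distance to the complement of `Ω` at most at an exponential rate: it
extends to a Lipschitz map up to the boundary, and preserves the complement of `Ω`. -/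
theorem IsFlow.exists_infDist_le (hX : IsFlow J Ω v X) (hv : FlowField J Ω v) (hJ : TimeDomain J)
    (T R : ℝ) : ∃ L ≥ 0, ∀ x ∈ Ω, ∀ r ∈ J, r ≤ T → ‖X r x‖ ≤ R → ∀ s ∈ J, s ≤ T → ∀ t ∈ J, t ≤ T →
      Metric.infDist (X t x) Ωᶜ ≤ Real.exp (L * |t - s|) * Metric.infDist (X s x) Ωᶜ := by
  rcases Ωᶜ.eq_empty_or_nonempty with hemp | hne
  · exact ⟨0, le_rfl, fun x _ r _ _ _ s _ _ t _ _ => by simp [hemp]⟩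
  obtain ⟨z₀, hz₀⟩ := hne
  obtain ⟨R₁, hR₁0, hR₁⟩ := hv.exists_norm_le hJ T R
  obtain ⟨L, hL0, hL⟩ := hX.exists_dist_le hv hJ T (R₁ + (R₁ + ‖z₀‖))
  refine ⟨L, hL0, fun x hx r hr hrT hxR s hs hsT t ht htT => ?_⟩
  set p := X s x with hp
  have hpΩ : p ∈ Ω := hX.mapsTo hs hx
  have hpR : ‖p‖ ≤ R₁ := hR₁ _ (hX.sol x hx) r hr hrT hxR s hs hsT
  obtain ⟨z, hz, hpz⟩ := hv.isOpen.isClosed_compl.exists_infDist_eq_dist ⟨z₀, hz₀⟩ p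
  have hδ : 0 < Metric.infDist p Ωᶜ := infDist_compl_pos hv.isOpen ⟨z₀, hz₀⟩ hpΩ
  have hδR : Metric.infDist p Ωᶜ ≤ R₁ + ‖z₀‖ := by
    refine (Metric.infDist_le_dist_of_mem hz₀).trans ?_
    rw [dist_eq_norm]
    exact (norm_sub_le _ _).trans (by linarith)
  set c : ℕ → ℝ := fun n => 1 - 1 / ((n : ℝ) + 1) with hc
  have hclim : Tendsto c atTop (𝓝 1) := by
    have := (tendsto_one_div_add_atTop_nhds_zero_nat (𝕜 := ℝ)).const_sub 1
    rwa [sub_zero] at this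
  have hc01 : ∀ n, 0 ≤ c n ∧ c n < 1 := by
    intro n
    have h1 : 0 < 1 / ((n : ℝ) + 1) := by positivity
    have h2 : 1 / ((n : ℝ) + 1) ≤ 1 := by
      rw [div_le_one (by positivity)]
      have : (0 : ℝ) ≤ n := n.cast_nonneg
      linarith
    exact ⟨by simp only [hc]; linarith, by simp only [hc]; linarith⟩
  set P : ℕ → E d := fun n => AffineMap.lineMap p z (c n) with hP
  have hPdist : ∀ n, dist p (P n) < Metric.infDist p Ωᶜ := by
    intro n
    rw [hP, dist_left_lineMap, Real.norm_of_nonneg (hc01 n).1, ← hpz]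
    exact mul_lt_of_lt_one_left hδ (hc01 n).2
  have hPΩ : ∀ n, P n ∈ Ω := fun n => mem_of_dist_lt_infDist_compl (hPdist n)
  have hPlim : Tendsto P atTop (𝓝 z) := by
    have : Continuous (AffineMap.lineMap p z : ℝ → E d) := AffineMap.lineMap_continuous
    have h := (this.tendsto 1).comp hclim
    rwa [AffineMap.lineMap_apply_one] at h
  have hPR : ∀ n, ‖P n‖ ≤ R₁ + (R₁ + ‖z₀‖) := by
    intro n
    have h1 := norm_le_norm_add_norm_sub' (P n) p
    have h2 := hPdist n
    rw [dist_eq_norm, norm_sub_rev] at h2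
    linarith
  set ξ : ℕ → E d := fun n => flowInv Ω X s (P n)
  have hξΩ : ∀ n, ξ n ∈ Ω := fun n => hX.flowInv_mem hv hJ hs (hPΩ n)
  have hξ : ∀ n, X s (ξ n) = P n := fun n => hX.apply_flowInv hv hJ hs (hPΩ n)
  have hcauchy : CauchySeq fun n => X t (ξ n) := by
    refine Metric.cauchySeq_iff'.2 fun ε hε => ?_
    have hPc := hPlim.cauchySeq
    obtain ⟨N, hN⟩ := Metric.cauchySeq_iff'.1 hPc (ε / Real.exp (L * |t - s|))
      (div_pos hε (Real.exp_pos _))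
    refine ⟨N, fun n hn => ?_⟩
    have h1 := hL _ (hξΩ n) _ (hξΩ N) s hs hsT s hs hsT (by rw [hξ]; exact hPR n)
      (by rw [hξ]; exact hPR N) s hs hsT t ht htT
    have h2 := hN n hn
    rw [lt_div_iff₀' (Real.exp_pos _)] at h2
    rw [hξ, hξ] at h1
    rw [dist_eq_norm] at h2 ⊢
    exact h1.trans_lt h2
  obtain ⟨ζ, hζ⟩ := cauchySeq_tendsto_of_complete hcauchy
  have hζΩ : ζ ∈ Ωᶜ := by
    intro hζΩ
    have hY : ContinuousAt (flowInv Ω X t) ζ :=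
      (((hX.continuousOn_flowInv hv hJ).comp (f := fun p => (t, p)) (by fun_prop)
        fun p hp => ⟨ht, hp⟩).continuousAt (hv.isOpen.mem_nhds hζΩ) :)
    have hm := hX.flowInv_mem hv hJ ht hζΩ
    have hXc : ContinuousAt (X s) (flowInv Ω X t ζ) :=
      (hX.continuousOn_apply hv hJ hs).continuousAt (hv.isOpen.mem_nhds hm)
    have h1 : Tendsto (fun n => X s (flowInv Ω X t (X t (ξ n)))) atTop
        (𝓝 (X s (flowInv Ω X t ζ))) := hXc.tendsto.comp (hY.tendsto.comp hζ)
    simp only [hX.flowInv_apply hv hJ ht (hξΩ _), hξ] at h1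
    exact hz (tendsto_nhds_unique hPlim h1 ▸ hX.mapsTo hs hm)
  refine (Metric.infDist_le_dist_of_mem hζΩ).trans ?_
  rw [hpz]
  have hlim1 : Tendsto (fun n => dist (X t x) (X t (ξ n))) atTop (𝓝 (dist (X t x) ζ)) :=
    tendsto_const_nhds.dist hζ
  have hlim2 : Tendsto (fun n => Real.exp (L * |t - s|) * dist p (P n)) atTop
      (𝓝 (Real.exp (L * |t - s|) * dist p z)) := (tendsto_const_nhds.dist hPlim).const_mul _
  refine le_of_tendsto_of_tendsto' hlim1 hlim2 fun n => ?_
  have h1 := hL x hx _ (hξΩ n) s hs hsT s hs hsT (by rw [← hp]; linarith [norm_nonneg z₀])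
    (by rw [hξ]; exact hPR n) s hs hsT t ht htT
  rw [hξ] at h1
  rw [dist_eq_norm, dist_eq_norm]
  exact h1

theorem abs_log_sub_log_le {a b c : ℝ} (ha : 0 < a) (hb : 0 < b) (h1 : a ≤ Real.exp c * b)
    (h2 : b ≤ Real.exp c * a) : |Real.log a - Real.log b| ≤ c := by
  have h3 := Real.log_le_log ha h1
  have h4 := Real.log_le_log hb h2
  rw [Real.log_mul (Real.exp_ne_zero _) hb.ne', Real.log_exp] at h3
  rw [Real.log_mul (Real.exp_ne_zero _) ha.ne', Real.log_exp] at h4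
  exact abs_le.2 ⟨by linarith, by linarith⟩

theorem IsFlow.exists_log_infDist_le (hX : IsFlow J Ω v X) (hv : FlowField J Ω v)
    (hJ : TimeDomain J) (T R : ℝ) : ∃ L ≥ 0, ∀ x ∈ Ω, ∀ r ∈ J, r ≤ T → ‖X r x‖ ≤ R →
      ∀ s ∈ J, s ≤ T → ∀ t ∈ J, t ≤ T →
      |Real.log (Metric.infDist (X t x) Ωᶜ) - Real.log (Metric.infDist (X s x) Ωᶜ)|
        ≤ L * |t - s| := by
  obtain ⟨L, hL0, hL⟩ := hX.exists_infDist_le hv hJ T R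
  refine ⟨L, hL0, fun x hx r hr hrT hxR s hs hsT t ht htT => ?_⟩
  rcases Ωᶜ.eq_empty_or_nonempty with hemp | hne
  · simp only [hemp, Metric.infDist_empty, sub_self, abs_zero]
    positivity
  refine abs_log_sub_log_le (infDist_compl_pos hv.isOpen hne (hX.mapsTo ht hx))
    (infDist_compl_pos hv.isOpen hne (hX.mapsTo hs hx)) (hL x hx r hr hrT hxR s hs hsT t ht htT) ?_
  rw [abs_sub_comm]
  exact hL x hx r hr hrT hxR t ht htT s hs hsT

theorem IsFlow.exists_log_norm_le (hX : IsFlow J Ω v X) (hv : FlowField J Ω v)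
    (hJ : TimeDomain J) (T : ℝ) : ∃ C ≥ 0, ∀ x ∈ Ω, ∀ s ∈ J, s ≤ T → ∀ t ∈ J, t ≤ T →
      |Real.log (1 + ‖X t x‖ ^ 2) - Real.log (1 + ‖X s x‖ ^ 2)| ≤ C * |t - s| := by
  obtain ⟨C, hC0, hC⟩ := hv.exists_norm_sq_le hJ T
  refine ⟨C, hC0, fun x hx s hs hsT t ht htT => ?_⟩
  refine abs_log_sub_log_le (by positivity) (by positivity) (hC _ (hX.sol x hx) s hs hsT t ht htT) ?_
  rw [abs_sub_comm]
  exact hC _ (hX.sol x hx) t ht htT s hs hsT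

/-- The truncation of a real number to `[0, 1]`. -/
noncomputable def clamp (u : ℝ) : ℝ := max 0 (min 1 u)

theorem clamp_nonneg (u : ℝ) : 0 ≤ clamp u := le_max_left _ _

theorem clamp_le_one (u : ℝ) : clamp u ≤ 1 := max_le zero_le_one (min_le_left _ _)

theorem clamp_eq_one {u : ℝ} (h : 1 ≤ u) : clamp u = 1 := by simp [clamp, h]

theorem clamp_eq_zero {u : ℝ} (h : u ≤ 0) : clamp u = 0 := by
  simp [clamp, h]

theorem continuous_clamp : Continuous clamp := by
  unfold clamp
  fun_prop

theorem abs_clamp_sub_le (u w : ℝ) : |clamp u - clamp w| ≤ |u - w| := by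
  unfold clamp
  rw [max_comm 0, max_comm 0, min_comm 1 u, min_comm 1 w]
  refine (abs_max_sub_max_le_abs _ _ _).trans ?_
  exact (abs_min_sub_min_le_max u 1 w 1).trans (by simp)

theorem abs_mul_sub_mul_le {a a' b b' α β : ℝ} (ha : 0 ≤ a) (ha1 : a ≤ 1) (hb' : 0 ≤ b')
    (hb'1 : b' ≤ 1) (h1 : |a - a'| ≤ α) (h2 : |b - b'| ≤ β) :
    |a * b - a' * b'| ≤ α + β := by
  have e : a * b - a' * b' = a * (b - b') + (a - a') * b' := by ring
  rw [e]
  refine (abs_add_le _ _).trans ?_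
  rw [abs_mul, abs_mul, abs_of_nonneg ha, abs_of_nonneg hb']
  have h3 : a * |b - b'| ≤ 1 * β := mul_le_mul ha1 h2 (abs_nonneg _) zero_le_one
  have h4 : |a - a'| * b' ≤ α * 1 := mul_le_mul h1 hb'1 hb' ((abs_nonneg _).trans h1)
  linarith

/-- `η` is Lipschitz in time with constant `κ` along the flow `X`, up to time `T`. -/
def SlowAlong (J : Set ℝ) (Ω : Set (E d)) (T κ : ℝ) (η : E d → ℝ) (X : ℝ → E d → E d) : Prop :=
  ∀ x ∈ Ω, ∀ s ∈ J, s ≤ T → ∀ t ∈ J, t ≤ T → |η (X t x) - η (X s x)| ≤ κ * |t - s|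

theorem exists_cutoff {v₁ v₂ X₁ X₂ : ℝ → E d → E d} (hJ : TimeDomain J)
    (hv₁ : FlowField J Ω v₁) (hX₁ : IsFlow J Ω v₁ X₁)
    (hv₂ : FlowField J Ω v₂) (hX₂ : IsFlow J Ω v₂ X₂) (T : ℝ) {κ : ℝ} (hκ : 0 < κ)
    {K : Set (E d)} (hK : IsCompact K) (hKΩ : K ⊆ Ω) :
    ∃ η : E d → ℝ, ContinuousOn η Ω ∧ (∀ x, 0 ≤ η x) ∧ (∀ x, η x ≤ 1) ∧ (∀ x ∈ K, η x = 1) ∧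
      (∃ K', IsCompact K' ∧ K' ⊆ Ω ∧ ∀ x ∈ Ω, x ∉ K' → η x = 0) ∧
      SlowAlong J Ω T κ η X₁ ∧ SlowAlong J Ω T κ η X₂ := by
  have hΩ := hv₁.isOpen
  obtain ⟨C₁, hC₁0, hC₁⟩ := hX₁.exists_log_norm_le hv₁ hJ T
  obtain ⟨C₂, hC₂0, hC₂⟩ := hX₂.exists_log_norm_le hv₂ hJ T
  have hcn : Continuous fun x : E d => Real.log (1 + ‖x‖ ^ 2) :=
    Continuous.log (by fun_prop) fun x => by positivity
  obtain ⟨B₁, hB₁⟩ := hK.exists_bound_of_continuousOn hcn.continuousOn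
  have hcδ : ContinuousOn (fun x : E d => Real.log (Metric.infDist x Ωᶜ)) Ω := by
    rcases Ωᶜ.eq_empty_or_nonempty with hemp | hne
    · simp only [hemp, Metric.infDist_empty]
      exact continuousOn_const
    · exact ContinuousOn.log (Metric.continuous_infDist_pt _).continuousOn
        fun x hx => (infDist_compl_pos hΩ hne hx).ne'
  obtain ⟨B₂, hB₂⟩ := hK.exists_bound_of_continuousOn (hcδ.mono hKΩ)
  set a := min (κ / (2 * (C₁ + C₂ + 1))) (1 / (|B₁| + 1)) with ha_def
  have ha : 0 < a := lt_min (by positivity) (by positivity)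
  have haC : a * (C₁ + C₂ + 1) ≤ κ / 2 := by
    have := min_le_left (κ / (2 * (C₁ + C₂ + 1))) (1 / (|B₁| + 1))
    rw [← ha_def, le_div_iff₀ (by positivity)] at this
    linarith
  have haB : a * (|B₁| + 1) ≤ 1 := by
    have := min_le_right (κ / (2 * (C₁ + C₂ + 1))) (1 / (|B₁| + 1))
    rwa [← ha_def, le_div_iff₀ (by positivity)] at this
  set R := Real.exp (2 / a) with hR
  have hsupp : ∀ x : E d, R < ‖x‖ → clamp (2 - a * Real.log (1 + ‖x‖ ^ 2)) = 0 := by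
    intro x hx
    refine clamp_eq_zero ?_
    have h1 : R ≤ 1 + ‖x‖ ^ 2 := by nlinarith [sq_nonneg (‖x‖ - 1)]
    have h2 := Real.log_le_log (Real.exp_pos _) h1
    rw [Real.log_exp, div_le_iff₀' ha] at h2
    linarith
  obtain ⟨L₁, hL₁0, hL₁⟩ := hX₁.exists_log_infDist_le hv₁ hJ T R
  obtain ⟨L₂, hL₂0, hL₂⟩ := hX₂.exists_log_infDist_le hv₂ hJ T R
  set b := min (κ / (2 * (L₁ + L₂ + 1))) (1 / (|B₂| + 1)) with hb_def
  have hb : 0 < b := lt_min (by positivity) (by positivity)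
  have hbL : b * (L₁ + L₂ + 1) ≤ κ / 2 := by
    have := min_le_left (κ / (2 * (L₁ + L₂ + 1))) (1 / (|B₂| + 1))
    rw [← hb_def, le_div_iff₀ (by positivity)] at this
    linarith
  have hbB : b * (|B₂| + 1) ≤ 1 := by
    have := min_le_right (κ / (2 * (L₁ + L₂ + 1))) (1 / (|B₂| + 1))
    rwa [← hb_def, le_div_iff₀ (by positivity)] at this
  have hslow : ∀ (X : ℝ → E d → E d) (C L : ℝ), 0 ≤ C → 0 ≤ L → C ≤ C₁ + C₂ + 1 →
      L ≤ L₁ + L₂ + 1 →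
      (∀ x ∈ Ω, ∀ s ∈ J, s ≤ T → ∀ t ∈ J, t ≤ T →
        |Real.log (1 + ‖X t x‖ ^ 2) - Real.log (1 + ‖X s x‖ ^ 2)| ≤ C * |t - s|) →
      (∀ x ∈ Ω, ∀ r ∈ J, r ≤ T → ‖X r x‖ ≤ R → ∀ s ∈ J, s ≤ T → ∀ t ∈ J, t ≤ T →
        |Real.log (Metric.infDist (X t x) Ωᶜ) - Real.log (Metric.infDist (X s x) Ωᶜ)|
          ≤ L * |t - s|) →
      SlowAlong J Ω T κ (fun x => clamp (2 - a * Real.log (1 + ‖x‖ ^ 2)) *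
        clamp (2 + b * Real.log (Metric.infDist x Ωᶜ))) X := by
    intro X C L hC0 hL0 hCC hLL hn hδ x hx s hs hsT t ht htT
    by_cases hbig : R < ‖X s x‖ ∧ R < ‖X t x‖
    · simp only [hsupp _ hbig.1, hsupp _ hbig.2, zero_mul, sub_self, abs_zero]
      positivity
    have hbd : ∃ r ∈ J, r ≤ T ∧ ‖X r x‖ ≤ R := by
      by_cases h : R < ‖X s x‖
      · exact ⟨t, ht, htT, not_lt.1 fun h' => hbig ⟨h, h'⟩⟩
      · exact ⟨s, hs, hsT, not_lt.1 h⟩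
    obtain ⟨r, hr, hrT, hrR⟩ := hbd
    have h1 : |clamp (2 - a * Real.log (1 + ‖X t x‖ ^ 2)) -
        clamp (2 - a * Real.log (1 + ‖X s x‖ ^ 2))| ≤ κ / 2 * |t - s| := by
      refine (abs_clamp_sub_le _ _).trans ?_
      rw [show 2 - a * Real.log (1 + ‖X t x‖ ^ 2) - (2 - a * Real.log (1 + ‖X s x‖ ^ 2)) =
        -(a * (Real.log (1 + ‖X t x‖ ^ 2) - Real.log (1 + ‖X s x‖ ^ 2))) by ring, abs_neg, abs_mul,
        abs_of_pos ha]
      have h2 := mul_le_mul_of_nonneg_left (hn x hx s hs hsT t ht htT) ha.le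
      have h3 : a * C ≤ κ / 2 := (mul_le_mul_of_nonneg_left hCC ha.le).trans haC
      have h4 := mul_le_mul_of_nonneg_right h3 (abs_nonneg (t - s))
      linarith
    have h2 : |clamp (2 + b * Real.log (Metric.infDist (X t x) Ωᶜ)) -
        clamp (2 + b * Real.log (Metric.infDist (X s x) Ωᶜ))| ≤ κ / 2 * |t - s| := by
      refine (abs_clamp_sub_le _ _).trans ?_
      rw [show 2 + b * Real.log (Metric.infDist (X t x) Ωᶜ) -
        (2 + b * Real.log (Metric.infDist (X s x) Ωᶜ)) = b * (Real.log (Metric.infDist (X t x) Ωᶜ) -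
        Real.log (Metric.infDist (X s x) Ωᶜ)) by ring, abs_mul, abs_of_pos hb]
      have h2 := mul_le_mul_of_nonneg_left (hδ x hx r hr hrT hrR s hs hsT t ht htT) hb.le
      have h3 : b * L ≤ κ / 2 := (mul_le_mul_of_nonneg_left hLL hb.le).trans hbL
      have h4 := mul_le_mul_of_nonneg_right h3 (abs_nonneg (t - s))
      linarith
    refine (abs_mul_sub_mul_le (clamp_nonneg _) (clamp_le_one _) (clamp_nonneg _) (clamp_le_one _)
      h1 h2).trans (le_of_eq (by ring))
  refine ⟨fun x => clamp (2 - a * Real.log (1 + ‖x‖ ^ 2)) *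
    clamp (2 + b * Real.log (Metric.infDist x Ωᶜ)), ?_, ?_, ?_, ?_, ?_,
    hslow X₁ C₁ L₁ hC₁0 hL₁0 (by linarith) (by linarith) hC₁ hL₁,
    hslow X₂ C₂ L₂ hC₂0 hL₂0 (by linarith) (by linarith) hC₂ hL₂⟩
  · exact (continuous_clamp.comp (continuous_const.sub (continuous_const.mul hcn))).continuousOn.mul
      (continuous_clamp.comp_continuousOn (continuousOn_const.add (continuousOn_const.mul hcδ)))
  · exact fun x => mul_nonneg (clamp_nonneg _) (clamp_nonneg _)
  · exact fun x => mul_le_one₀ (clamp_le_one _) (clamp_nonneg _) (clamp_le_one _)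
  · intro x hx
    have h1 := hB₁ x hx
    have h2 := hB₂ x hx
    rw [Real.norm_eq_abs] at h1 h2
    have h3 : a * Real.log (1 + ‖x‖ ^ 2) ≤ 1 := by
      refine (mul_le_mul_of_nonneg_left ?_ ha.le).trans haB
      linarith [le_abs_self (Real.log (1 + ‖x‖ ^ 2)), le_abs_self B₁]
    have h4 : -1 ≤ b * Real.log (Metric.infDist x Ωᶜ) := by
      have : -(b * (|B₂| + 1)) ≤ b * Real.log (Metric.infDist x Ωᶜ) := by
        rw [← mul_neg]
        refine mul_le_mul_of_nonneg_left ?_ hb.le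
        linarith [neg_abs_le (Real.log (Metric.infDist x Ωᶜ)), le_abs_self B₂]
      linarith
    simp only
    rw [clamp_eq_one (by linarith), clamp_eq_one (by linarith), mul_one]
  · rcases Ωᶜ.eq_empty_or_nonempty with hemp | hne
    · refine ⟨Metric.closedBall 0 R, isCompact_closedBall _ _, ?_, fun x _ hx => ?_⟩
      · rw [compl_empty_iff.1 hemp]
        exact subset_univ _
      · rw [mem_closedBall_zero_iff, not_le] at hx
        simp only [hsupp x hx, zero_mul]
    · refine ⟨Metric.closedBall 0 R ∩ {x | Real.exp (-(2 / b)) ≤ Metric.infDist x Ωᶜ},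
        (isCompact_closedBall _ _).inter_right
          (isClosed_le continuous_const (Metric.continuous_infDist_pt _)), ?_, fun x hxΩ hx => ?_⟩
      · rintro x ⟨-, hx⟩
        by_contra hxΩ
        have : Metric.infDist x Ωᶜ = 0 := Metric.infDist_zero_of_mem hxΩ
        rw [mem_ofPred_eq, this] at hx
        exact absurd hx (not_le.2 (Real.exp_pos _))
      · by_cases hR' : R < ‖x‖
        · simp only [hsupp x hR', zero_mul]
        · have hlt : Metric.infDist x Ωᶜ < Real.exp (-(2 / b)) := by
            by_contra hcon
            exact hx ⟨mem_closedBall_zero_iff.2 (not_lt.1 hR'), not_lt.1 hcon⟩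
          have h1 := Real.log_le_log (infDist_compl_pos hΩ hne hxΩ) hlt.le
          rw [Real.log_exp] at h1
          have h2 := mul_le_mul_of_nonneg_left h1 hb.le
          rw [mul_neg, mul_div_cancel₀ _ hb.ne'] at h2
          simp only
          rw [clamp_eq_zero (u := 2 + b * Real.log (Metric.infDist x Ωᶜ)) (by linarith), mul_zero]

end Cutoff

section EntropyFunctions

/-- A convex function `h` on `(0, ∞)` with `h(1) = 0` and bounded derivative `h'` such that
`0 ≤ x h''(x) ≤ 1`. -/
structure IsEntropy (h h' h'' : ℝ → ℝ) (B : ℝ) : Prop where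
  hasDerivAt : ∀ x > 0, HasDerivAt h' (h'' x) x
  continuousOn_snd : ContinuousOn h'' (Ioi 0)
  continuousOn : ContinuousOn h (Ioi 0)
  sub_le : ∀ x > 0, ∀ y > 0, h x - h y ≤ h' x * (x - y)
  abs_le : ∀ x > 0, |h' x| ≤ B
  one : h 1 = 0
  nonneg : ∀ x > 0, 0 ≤ h x
  snd_nonneg : ∀ x > 0, 0 ≤ h'' x
  mul_snd_le : ∀ x > 0, x * h'' x ≤ 1

theorem IsEntropy.le {h h' h'' : ℝ → ℝ} {B : ℝ} (hh : IsEntropy h h' h'' B) {x : ℝ} (hx : 0 < x) :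
    h x ≤ B * (x + 1) := by
  have h1 := hh.sub_le x hx 1 one_pos
  have h2 := hh.abs_le x hx
  rw [hh.one, sub_zero] at h1
  have h3 : h' x * (x - 1) ≤ |h' x| * (x + 1) := by
    rcases abs_cases (h' x) with ⟨h4, h5⟩ | ⟨h4, h5⟩ <;> rw [h4] <;> nlinarith
  exact h1.trans (h3.trans (mul_le_mul_of_nonneg_right h2 (by linarith)))

/-- An approximation of `x log x - x + 1` with bounded derivative. -/
noncomputable def entropyApprox (a x : ℝ) : ℝ :=
  (1 - a ^ 2)⁻¹ * ((x + a) * Real.log (x + a) - (1 + a * x) * Real.log (1 + a * x) / a) +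
    Real.log (1 + a) / a

/-- The derivative of `entropyApprox`. -/
noncomputable def entropyApproxDeriv (a x : ℝ) : ℝ :=
  (1 - a ^ 2)⁻¹ * (Real.log (x + a) - Real.log (1 + a * x))

theorem hasDerivAt_entropyApprox {a x : ℝ} (ha : 0 < a) (hx : 0 < x) :
    HasDerivAt (entropyApprox a) (entropyApproxDeriv a x) x := by
  have h1 : HasDerivAt (fun x => x + a) 1 x := (hasDerivAt_id x).add_const a
  have h2 : HasDerivAt (fun x => 1 + a * x) a x := by
    simpa using ((hasDerivAt_id x).const_mul a).const_add 1
  have p1 : x + a ≠ 0 := by positivity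
  have p2 : 1 + a * x ≠ 0 := by positivity
  have h3 := ((h1.fun_mul (h1.log p1)).fun_sub ((h2.fun_mul (h2.log p2)).div_const a)).const_mul
    ((1 - a ^ 2)⁻¹)
  refine (h3.add_const (Real.log (1 + a) / a)).congr_deriv ?_
  rw [entropyApproxDeriv]
  congr 1
  field_simp
  ring

theorem monotone_entropyApproxDeriv {a x y : ℝ} (ha : 0 < a) (ha1 : a < 1) (hx : 0 < x)
    (hxy : x ≤ y) : entropyApproxDeriv a x ≤ entropyApproxDeriv a y := by
  have hy : 0 < y := hx.trans_le hxy
  have h1 : 0 < 1 - a ^ 2 := by nlinarith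
  unfold entropyApproxDeriv
  refine mul_le_mul_of_nonneg_left ?_ (inv_pos.2 h1).le
  rw [← Real.log_div (by positivity) (by positivity), ← Real.log_div (by positivity) (by positivity)]
  refine Real.log_le_log (by positivity) ?_
  rw [div_le_div_iff₀ (by positivity) (by positivity)]
  nlinarith [mul_nonneg h1.le (sub_nonneg.2 hxy)]

theorem isEntropy_entropyApprox {a : ℝ} (ha : 0 < a) (ha1 : a < 1) :
    IsEntropy (entropyApprox a) (entropyApproxDeriv a) (fun x => ((x + a) * (1 + a * x))⁻¹)
      ((1 - a ^ 2)⁻¹ * -Real.log a) := by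
  have h1 : 0 < 1 - a ^ 2 := by nlinarith
  have hone : entropyApprox a 1 = 0 := by
    have e : (1 + a * 1 : ℝ) = 1 + a := by ring
    rw [entropyApprox, e]
    field_simp
    ring
  have hsub : ∀ x > 0, ∀ y > 0,
      entropyApprox a x - entropyApprox a y ≤ entropyApproxDeriv a x * (x - y) := by
    intro x hx y hy
    rcases lt_trichotomy x y with hlt | rfl | hlt
    · obtain ⟨c, hc, hceq⟩ := exists_hasDerivAt_eq_slope (entropyApprox a) (entropyApproxDeriv a) hlt
        (fun z hz => (hasDerivAt_entropyApprox ha (hx.trans_le hz.1)).continuousAt.continuousWithinAt)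
        (fun z hz => hasDerivAt_entropyApprox ha (hx.trans hz.1))
      rw [eq_div_iff (by linarith)] at hceq
      have := monotone_entropyApproxDeriv ha ha1 hx hc.1.le
      nlinarith
    · simp
    · obtain ⟨c, hc, hceq⟩ := exists_hasDerivAt_eq_slope (entropyApprox a) (entropyApproxDeriv a) hlt
        (fun z hz => (hasDerivAt_entropyApprox ha (hy.trans_le hz.1)).continuousAt.continuousWithinAt)
        (fun z hz => hasDerivAt_entropyApprox ha (hy.trans hz.1))
      rw [eq_div_iff (by linarith)] at hceq
      have := monotone_entropyApproxDeriv ha ha1 (hy.trans hc.1) hc.2.le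
      nlinarith
  have hd1 : entropyApproxDeriv a 1 = 0 := by
    simp [entropyApproxDeriv, add_comm]
  refine ⟨fun x hx => ?_, ?_, fun x hx =>
    (hasDerivAt_entropyApprox ha hx).continuousAt.continuousWithinAt, hsub, fun x hx => ?_, hone,
    fun x hx => ?_, fun x hx => ?_, fun x hx => ?_⟩
  · have p1 : x + a ≠ 0 := by positivity
    have p2 : 1 + a * x ≠ 0 := by positivity
    have h3 : HasDerivAt (fun x => x + a) 1 x := (hasDerivAt_id x).add_const a
    have h4 : HasDerivAt (fun x => 1 + a * x) a x := by
      simpa using ((hasDerivAt_id x).const_mul a).const_add 1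
    refine (((h3.log p1).fun_sub (h4.log p2)).const_mul ((1 - a ^ 2)⁻¹)).congr_deriv ?_
    have := h1.ne'
    field_simp
    ring
  · refine ContinuousOn.inv₀ (by fun_prop) fun x hx => ?_
    have : (0 : ℝ) < x := hx
    positivity
  · rw [entropyApproxDeriv, abs_mul, abs_of_pos (inv_pos.2 h1)]
    refine mul_le_mul_of_nonneg_left ?_ (inv_pos.2 h1).le
    rw [← Real.log_div (by positivity) (by positivity), abs_le, neg_neg]
    constructor
    · refine Real.log_le_log ha ?_
      rw [le_div_iff₀ (by positivity)]
      nlinarith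
    · rw [← Real.log_inv]
      refine Real.log_le_log (by positivity) ?_
      rw [div_le_iff₀ (by positivity)]
      have : a⁻¹ * (1 + a * x) = a⁻¹ + x := by field_simp
      rw [this]
      have h2 : (1 : ℝ) ≤ a⁻¹ := (one_le_inv₀ ha).2 ha1.le
      linarith
  · have := hsub 1 one_pos x hx
    rw [hone, hd1] at this
    linarith
  · positivity
  · rw [← div_eq_mul_inv, div_le_one (by positivity)]
    nlinarith [mul_pos ha hx, mul_pos ha ha, mul_pos (mul_pos ha hx) ha, mul_pos (mul_pos ha hx) hx]

theorem tendsto_entropyApprox {x : ℝ} (hx : 0 < x) :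
    Tendsto (fun a => entropyApprox a x) (𝓝[>] 0) (𝓝 (InformationTheory.klFun x)) := by
  have hlog : ∀ c : ℝ, Tendsto (fun a : ℝ => Real.log (1 + a * c) / a) (𝓝[>] 0) (𝓝 c) := by
    intro c
    have h1 : HasDerivAt (fun a : ℝ => 1 + a * c) c 0 := by
      simpa using ((hasDerivAt_id (0 : ℝ)).mul_const c).const_add 1
    have h2 : HasDerivAt (fun a : ℝ => Real.log (1 + a * c)) c 0 := by
      simpa using h1.log (by simp)
    have h3 := (hasDerivAt_iff_tendsto_slope.1 h2).mono_left
      (nhdsWithin_mono 0 fun a (ha : 0 < a) => ha.ne')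
    refine h3.congr' (Eventually.of_forall fun a => ?_)
    simp [slope, div_eq_inv_mul]
  have hc : ∀ f : ℝ → ℝ, ContinuousAt f 0 → Tendsto f (𝓝[>] 0) (𝓝 (f 0)) := fun f hf =>
    hf.tendsto.mono_left nhdsWithin_le_nhds
  have t1 : Tendsto (fun a : ℝ => (1 - a ^ 2)⁻¹) (𝓝[>] 0) (𝓝 1) := by
    have := hc (fun a : ℝ => (1 - a ^ 2)⁻¹) (ContinuousAt.inv₀ (by fun_prop) (by simp))
    simpa using this
  have t2 : Tendsto (fun a : ℝ => (x + a) * Real.log (x + a)) (𝓝[>] 0) (𝓝 (x * Real.log x)) := by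
    have := hc (fun a : ℝ => (x + a) * Real.log (x + a))
      (ContinuousAt.mul (by fun_prop) (ContinuousAt.log (by fun_prop) (by simpa using hx.ne')))
    simpa using this
  have t3 : Tendsto (fun a : ℝ => (1 + a * x) * (Real.log (1 + a * x) / a)) (𝓝[>] 0)
      (𝓝 (1 * x)) := by
    have := hc (fun a : ℝ => 1 + a * x) (by fun_prop)
    simp only [zero_mul, add_zero] at this
    exact this.mul (hlog x)
  have t4 : Tendsto (fun a : ℝ => Real.log (1 + a) / a) (𝓝[>] 0) (𝓝 1) := by
    simpa using hlog 1
  have := (t1.mul (t2.sub t3)).add t4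
  rw [show 1 * (x * Real.log x - 1 * x) + 1 = InformationTheory.klFun x by
    rw [InformationTheory.klFun_apply]; ring] at this
  refine this.congr fun a => ?_
  rw [entropyApprox, mul_div_assoc]

end EntropyFunctions

section TwoFlows

variable {d : ℕ} {J : Set ℝ} {Ω : Set (E d)} {v X G v' X' G' : ℝ → E d → E d}
  {M M' : ℝ → E d → E d →L[ℝ] E d} {I I' : ℝ → E d → ℝ} {ρ₀ : E d → ℝ}

theorem isProbabilityMeasure_densityMeasure (hΩ : IsOpen Ω) {ρ : E d → ℝ}
    (hpos : ∀ x ∈ Ω, 0 < ρ x) (hint : ∫ x in Ω, ρ x = 1) :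
    IsProbabilityMeasure (densityMeasure Ω ρ) := by
  have hi : Integrable ρ (volume.restrict Ω) := by
    by_contra h
    rw [integral_undef h] at hint
    exact zero_ne_one hint
  constructor
  rw [densityMeasure, withDensity_apply _ MeasurableSet.univ, Measure.restrict_univ,
    ← ofReal_integral_eq_lintegral_ofReal hi, hint, ENNReal.ofReal_one]
  exact (ae_restrict_iff' hΩ.measurableSet).2 (Eventually.of_forall fun x hx => (hpos x hx).le)

theorem ae_mem_densityMeasure (hΩ : IsOpen Ω) (ρ : E d → ℝ) :
    ∀ᵐ x ∂(densityMeasure Ω ρ), x ∈ Ω :=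
  (densityMeasure_ac ρ).ae_le (ae_restrict_mem hΩ.measurableSet)

theorem aestronglyMeasurable_densityMeasure (hΩ : IsOpen Ω) {ρ f : E d → ℝ}
    (hf : ContinuousOn f Ω) : AEStronglyMeasurable f (densityMeasure Ω ρ) :=
  (aemeasurable_densityMeasure hΩ hf).aestronglyMeasurable

/-- The density of one transported measure relative to another. -/
noncomputable def relDensity (Ω : Set (E d)) (X : ℝ → E d → E d) (I : ℝ → E d → ℝ)
    (X' : ℝ → E d → E d) (I' : ℝ → E d → ℝ) (ρ₀ : E d → ℝ) (t : ℝ) (p : E d) : ℝ :=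
  flowDensity Ω X I ρ₀ t p / flowDensity Ω X' I' ρ₀ t p

theorem relDensity_pos (h1 : Transport J Ω ρ₀ v X G M I) (h2 : Transport J Ω ρ₀ v' X' G' M' I')
    {t : ℝ} (ht : t ∈ J) {p : E d} (hp : p ∈ Ω) : 0 < relDensity Ω X I X' I' ρ₀ t p :=
  div_pos (h1.flowDensity_pos ht hp) (h2.flowDensity_pos ht hp)

theorem hasFDerivAt_relDensity (h1 : Transport J Ω ρ₀ v X G M I)
    (h2 : Transport J Ω ρ₀ v' X' G' M' I') {t : ℝ} (ht : t ∈ J) {p : E d} (hp : p ∈ Ω) :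
    HasFDerivAt (relDensity Ω X I X' I' ρ₀ t) (relDensity Ω X I X' I' ρ₀ t p •
      innerSL ℝ (G t (flowInv Ω X t p) - G' t (flowInv Ω X' t p))) p := by
  have h3 := ((h1.hasGradientAt_log_flowDensity ht hp).hasFDerivAt.sub
    (h2.hasGradientAt_log_flowDensity ht hp).hasFDerivAt).exp
  have e : ∀ q ∈ Ω, relDensity Ω X I X' I' ρ₀ t q = Real.exp
      (Real.log (flowDensity Ω X I ρ₀ t q) - Real.log (flowDensity Ω X' I' ρ₀ t q)) := by
    intro q hq
    rw [Real.exp_sub, Real.exp_log (h1.flowDensity_pos ht hq),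
      Real.exp_log (h2.flowDensity_pos ht hq), relDensity]
  refine (h3.congr_of_eventuallyEq ?_).congr_fderiv ?_
  · filter_upwards [h1.field.isOpen.mem_nhds hp] with q hq
    exact e q hq
  · rw [e p hp, map_sub]
    rfl

theorem continuousOn_relDensity (h1 : Transport J Ω ρ₀ v X G M I)
    (h2 : Transport J Ω ρ₀ v' X' G' M' I') :
    ContinuousOn (fun p : ℝ × E d => relDensity Ω X I X' I' ρ₀ p.1 p.2) (J ×ˢ Ω) :=
  h1.flowDensity_C1.continuousOn.div h2.flowDensity_C1.continuousOn
    fun _ hp => (h2.flowDensity_pos hp.1 hp.2).ne'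

theorem continuousOn_slice {H : Type*} [TopologicalSpace H] {f : ℝ → E d → H}
    (hf : ContinuousOn (fun p : ℝ × E d => f p.1 p.2) (J ×ˢ Ω)) {t : ℝ} (ht : t ∈ J) :
    ContinuousOn (f t) Ω :=
  hf.comp (f := fun x => (t, x)) (by fun_prop) fun _ hx => ⟨ht, hx⟩

theorem Transport.mapsTo_flowInv (h : Transport J Ω ρ₀ v X G M I) {t : ℝ} (ht : t ∈ J) :
    MapsTo (flowInv Ω X t) Ω Ω := fun _ hp => h.flow.flowInv_mem h.field h.time ht hp

theorem Transport.continuousOn_apply (h : Transport J Ω ρ₀ v X G M I) {t : ℝ} (ht : t ∈ J) :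
    ContinuousOn (X t) Ω := h.flow.continuousOn_apply h.field h.time ht

theorem Transport.continuousOn_flowInv_apply (h : Transport J Ω ρ₀ v X G M I) {t : ℝ}
    (ht : t ∈ J) : ContinuousOn (flowInv Ω X t) Ω :=
  continuousOn_slice (h.flow.continuousOn_flowInv h.field h.time) ht

theorem flowDensity_eq_mul_relDensity
    (h2 : Transport J Ω ρ₀ v' X' G' M' I') {t : ℝ} (ht : t ∈ J) {p : E d} (hp : p ∈ Ω) :
    flowDensity Ω X I ρ₀ t p = flowDensity Ω X' I' ρ₀ t p * relDensity Ω X I X' I' ρ₀ t p := by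
  rw [relDensity, mul_div_cancel₀ _ (h2.flowDensity_pos ht hp).ne']

/-- In Lagrangian coordinates of `X'`, the relative density is the density of the push-forward
under `(X'_t)⁻¹ ∘ X_t`. -/
theorem withDensity_relDensity (h1 : Transport J Ω ρ₀ v X G M I)
    (h2 : Transport J Ω ρ₀ v' X' G' M' I') {t : ℝ} (ht : t ∈ J) :
    (densityMeasure Ω ρ₀).withDensity
        (fun z => ENNReal.ofReal (relDensity Ω X I X' I' ρ₀ t (X' t z))) =
      (densityMeasure Ω ρ₀).map (fun x => flowInv Ω X' t (X t x)) := by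
  have hΩ := h1.field.isOpen
  have hrel := continuousOn_slice (continuousOn_relDensity h1 h2) ht
  have hX := h1.continuousOn_apply ht
  have hX' := h2.continuousOn_apply ht
  have hY' := h2.continuousOn_flowInv_apply ht
  have hXm := h1.flow.mapsTo ht
  have hX'm := h2.flow.mapsTo ht
  have hm : AEMeasurable (fun z => ENNReal.ofReal (relDensity Ω X I X' I' ρ₀ t (X' t z)))
      (densityMeasure Ω ρ₀) :=
    (aemeasurable_densityMeasure hΩ (hrel.comp hX' hX'm)).ennreal_ofReal
  have hZ : AEMeasurable (fun x => flowInv Ω X' t (X t x)) (densityMeasure Ω ρ₀) :=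
    aemeasurable_densityMeasure hΩ (hY'.comp hX hXm)
  refine Measure.ext_of_lintegral _ fun g hg => ?_
  rw [lintegral_map' hg.aemeasurable hZ,
    lintegral_withDensity_eq_lintegral_mul_non_measurable₀ _ hm
      (Eventually.of_forall fun _ => ENNReal.ofReal_lt_top)]
  have hgY : ∀ ρ : E d → ℝ, AEMeasurable (fun p => g (flowInv Ω X' t p)) (densityMeasure Ω ρ) :=
    fun ρ => hg.comp_aemeasurable (aemeasurable_densityMeasure hΩ hY')
  have hgY' : ∀ ρ : E d → ℝ, AEMeasurable (fun p => ENNReal.ofReal (relDensity Ω X I X' I' ρ₀ t p) *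
      g (flowInv Ω X' t p)) (densityMeasure Ω ρ) :=
    fun ρ => (aemeasurable_densityMeasure hΩ hrel).ennreal_ofReal.mul (hgY ρ)
  have e1 : ∫⁻ x, g (flowInv Ω X' t (X t x)) ∂(densityMeasure Ω ρ₀) =
      ∫⁻ p, g (flowInv Ω X' t p) ∂(densityMeasure Ω (flowDensity Ω X I ρ₀ t)) := by
    rw [← h1.map_eq_flowDensity ht, lintegral_map'
      (by rw [h1.map_eq_flowDensity ht]; exact hgY _) (aemeasurable_densityMeasure hΩ hX)]
  have e2 : ∫⁻ z, ((fun z => ENNReal.ofReal (relDensity Ω X I X' I' ρ₀ t (X' t z))) * g) z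
        ∂(densityMeasure Ω ρ₀) =
      ∫⁻ p, ENNReal.ofReal (relDensity Ω X I X' I' ρ₀ t p) * g (flowInv Ω X' t p)
        ∂(densityMeasure Ω (flowDensity Ω X' I' ρ₀ t)) := by
    rw [← h2.map_eq_flowDensity ht, lintegral_map'
      (by rw [h2.map_eq_flowDensity ht]; exact hgY' _) (aemeasurable_densityMeasure hΩ hX')]
    refine lintegral_congr_ae ?_
    filter_upwards [ae_mem_densityMeasure hΩ ρ₀] with z hz
    rw [h2.flow.flowInv_apply h2.field h2.time ht hz]
    rfl
  rw [e1, e2, lintegral_densityMeasure hΩ (continuousOn_slice h1.flowDensity_C1.continuousOn ht),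
    lintegral_densityMeasure hΩ (continuousOn_slice h2.flowDensity_C1.continuousOn ht)]
  refine setLIntegral_congr_fun hΩ.measurableSet fun p hp => ?_
  rw [flowDensity_eq_mul_relDensity (X := X) (I := I) h2 ht hp,
    ENNReal.ofReal_mul (h2.flowDensity_pos ht hp).le, mul_assoc]

theorem integral_mul_relDensity (h1 : Transport J Ω ρ₀ v X G M I)
    (h2 : Transport J Ω ρ₀ v' X' G' M' I') [IsFiniteMeasure (densityMeasure Ω ρ₀)] {t : ℝ}
    (ht : t ∈ J) {φ : E d → ℝ} (hφ : ContinuousOn φ Ω) {C : ℝ} (hC : ∀ x ∈ Ω, |φ x| ≤ C) :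
    Integrable (fun z => φ z * relDensity Ω X I X' I' ρ₀ t (X' t z)) (densityMeasure Ω ρ₀) ∧
    Integrable (fun x => φ (flowInv Ω X' t (X t x))) (densityMeasure Ω ρ₀) ∧
    ∫ z, φ z * relDensity Ω X I X' I' ρ₀ t (X' t z) ∂(densityMeasure Ω ρ₀) =
      ∫ x, φ (flowInv Ω X' t (X t x)) ∂(densityMeasure Ω ρ₀) := by
  have hΩ := h1.field.isOpen
  have hrel := continuousOn_slice (continuousOn_relDensity h1 h2) ht
  have hX := h1.continuousOn_apply ht
  have hX' := h2.continuousOn_apply ht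
  have hY' := h2.continuousOn_flowInv_apply ht
  have hXm := h1.flow.mapsTo ht
  have hX'm := h2.flow.mapsTo ht
  have hm : AEMeasurable (fun z => ENNReal.ofReal (relDensity Ω X I X' I' ρ₀ t (X' t z)))
      (densityMeasure Ω ρ₀) :=
    (aemeasurable_densityMeasure hΩ (hrel.comp hX' hX'm)).ennreal_ofReal
  have hZ : AEMeasurable (fun x => flowInv Ω X' t (X t x)) (densityMeasure Ω ρ₀) :=
    aemeasurable_densityMeasure hΩ (hY'.comp hX hXm)
  have hφY : ContinuousOn (fun x => φ (flowInv Ω X' t (X t x))) Ω :=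
    hφ.comp (hY'.comp hX hXm) fun x hx => h2.mapsTo_flowInv ht (hXm hx)
  have hφm : AEStronglyMeasurable φ ((densityMeasure Ω ρ₀).map (fun x => flowInv Ω X' t (X t x))) := by
    rw [← withDensity_relDensity h1 h2 ht]
    exact (aestronglyMeasurable_densityMeasure hΩ hφ).mono_ac (withDensity_absolutelyContinuous _ _)
  have hint : Integrable (fun x => φ (flowInv Ω X' t (X t x))) (densityMeasure Ω ρ₀) := by
    refine Integrable.of_bound (aestronglyMeasurable_densityMeasure hΩ hφY) C ?_
    filter_upwards [ae_mem_densityMeasure hΩ ρ₀] with x hx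
    exact hC _ (h2.mapsTo_flowInv ht (hXm hx))
  have e : ∀ᵐ z ∂(densityMeasure Ω ρ₀), (ENNReal.ofReal (relDensity Ω X I X' I' ρ₀ t
      (X' t z))).toReal • φ z = φ z * relDensity Ω X I X' I' ρ₀ t (X' t z) := by
    filter_upwards [ae_mem_densityMeasure hΩ ρ₀] with z hz
    rw [ENNReal.toReal_ofReal (relDensity_pos h1 h2 ht (hX'm hz)).le, smul_eq_mul, mul_comm]
  refine ⟨?_, hint, ?_⟩
  · have h3 : Integrable φ ((densityMeasure Ω ρ₀).map (fun x => flowInv Ω X' t (X t x))) :=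
      (integrable_map_measure hφm hZ).2 hint
    rw [← withDensity_relDensity h1 h2 ht, integrable_withDensity_iff_integrable_smul₀' hm
      (Eventually.of_forall fun _ => ENNReal.ofReal_lt_top)] at h3
    exact h3.congr e
  · rw [← integral_map hZ hφm, ← withDensity_relDensity h1 h2 ht,
      integral_withDensity_eq_integral_toReal_smul₀ hm
        (Eventually.of_forall fun _ => ENNReal.ofReal_lt_top)]
    exact (integral_congr_ae e).symm

end TwoFlows

section EntropyBound

variable {d : ℕ} {J : Set ℝ} {Ω K : Set (E d)} {v X G v' X' G' : ℝ → E d → E d}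
  {M M' : ℝ → E d → E d →L[ℝ] E d} {I I' : ℝ → E d → ℝ} {ρ₀ : E d → ℝ}
  {h h' h'' : ℝ → ℝ} {B T κ : ℝ} {η : E d → ℝ}

/-- `η` is a continuous function on `Ω` with values in `[0, 1]` and support in the compact set
`K ⊆ Ω`. -/
structure IsCutoff (Ω K : Set (E d)) (η : E d → ℝ) : Prop where
  isCompact : IsCompact K
  subset : K ⊆ Ω
  continuousOn : ContinuousOn η Ω
  nonneg : ∀ x, 0 ≤ η x
  le_one : ∀ x, η x ≤ 1
  eq_zero : ∀ x ∈ Ω, x ∉ K → η x = 0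

theorem IsCutoff.norm_mul_le (hη : IsCutoff Ω K η) {a C : ℝ} (hC : 0 ≤ C) {x : E d}
    (hx : x ∈ Ω) (ha : x ∈ K → ‖a‖ ≤ C) : ‖η x * a‖ ≤ C := by
  by_cases hxK : x ∈ K
  · rw [norm_mul, Real.norm_eq_abs, abs_of_nonneg (hη.nonneg x)]
    exact (mul_le_mul (hη.le_one x) (ha hxK) (norm_nonneg _) zero_le_one).trans_eq (one_mul C)
  · rw [hη.eq_zero x hx hxK, zero_mul, norm_zero]
    exact hC

theorem Transport.continuousOn_integral_cutoff (h1 : Transport J Ω ρ₀ v X G M I)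
    [IsFiniteMeasure (densityMeasure Ω ρ₀)] (hη : IsCutoff Ω K η) (hT : T ∈ J) {g : ℝ → E d → ℝ}
    (hg : ContinuousOn (fun p : ℝ × E d => g p.1 p.2) (J ×ˢ Ω)) :
    ContinuousOn (fun t => ∫ x, η (X t x) * g t (X t x) ∂(densityMeasure Ω ρ₀)) (Icc 0 T) ∧
    ∀ t ∈ J, Integrable (fun x => η (X t x) * g t (X t x)) (densityMeasure Ω ρ₀) := by
  have hΩ := h1.field.isOpen
  have hsub : ∀ {T}, T ∈ J → Icc 0 T ⊆ J := fun hT => h1.time.Icc_subset hT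
  have hbd : ∀ {T}, T ∈ J → ∃ C, 0 ≤ C ∧ ∀ t ∈ Icc 0 T, ∀ x ∈ K, ‖g t x‖ ≤ C := by
    intro T hT
    obtain ⟨C, hC⟩ := (isCompact_Icc.prod hη.isCompact).exists_bound_of_continuousOn
      (hg.mono (prod_mono (hsub hT) hη.subset))
    exact ⟨max C 0, le_max_right _ _, fun t ht x hx => (hC (t, x) ⟨ht, hx⟩).trans (le_max_left _ _)⟩
  have hcont : ContinuousOn (fun p : ℝ × E d => η (X p.1 p.2) * g p.1 (X p.1 p.2)) (J ×ˢ Ω) :=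
    (hη.continuousOn.comp (h1.flow.continuousOn h1.field h1.time)
      fun p hp => h1.flow.mapsTo hp.1 hp.2).mul
      (h1.flow.continuousOn_comp h1.field h1.time (f := g) hg)
  have hmeas : ∀ t ∈ J, AEStronglyMeasurable (fun x => η (X t x) * g t (X t x))
      (densityMeasure Ω ρ₀) := fun t ht => aestronglyMeasurable_densityMeasure hΩ
    (continuousOn_slice (f := fun t x => η (X t x) * g t (X t x)) hcont ht)
  have hle : ∀ {T}, T ∈ J → ∃ C, ∀ t ∈ Icc 0 T, ∀ᵐ x ∂(densityMeasure Ω ρ₀),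
      ‖η (X t x) * g t (X t x)‖ ≤ C := by
    intro T hT
    obtain ⟨C, hC0, hC⟩ := hbd hT
    refine ⟨C, fun t ht => ?_⟩
    filter_upwards [ae_mem_densityMeasure hΩ ρ₀] with x hx
    exact hη.norm_mul_le hC0 (h1.flow.mapsTo (hsub hT ht) hx) (hC t ht _)
  constructor
  · obtain ⟨C, hC⟩ := hle hT
    refine continuousOn_of_dominated (bound := fun _ => C) (fun t ht => hmeas t (hsub hT ht)) hC
      (integrable_const C) ?_
    filter_upwards [ae_mem_densityMeasure hΩ ρ₀] with x hx
    exact hcont.comp (f := fun t => (t, x)) (by fun_prop) fun t ht => ⟨hsub hT ht, hx⟩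
  · intro t ht
    obtain ⟨C, hC⟩ := hle ht
    exact Integrable.of_bound (hmeas t ht) C (hC t ⟨h1.time.nonneg t ht, le_rfl⟩)

theorem integrable_entropy (hh : IsEntropy h h' h'' B) (h1 : Transport J Ω ρ₀ v X G M I)
    (h2 : Transport J Ω ρ₀ v' X' G' M' I') [IsProbabilityMeasure (densityMeasure Ω ρ₀)] {t : ℝ}
    (ht : t ∈ J) :
    Integrable (fun z => h (relDensity Ω X I X' I' ρ₀ t (X' t z))) (densityMeasure Ω ρ₀) ∧
    ∫ z, h (relDensity Ω X I X' I' ρ₀ t (X' t z)) ∂(densityMeasure Ω ρ₀) ≤ 2 * B := by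
  have hΩ := h1.field.isOpen
  obtain ⟨i1, -, e⟩ := integral_mul_relDensity h1 h2 ht (φ := fun _ => 1) (C := 1)
    continuousOn_const (by simp)
  simp only [one_mul, integral_const, probReal_univ, smul_eq_mul] at i1 e
  have i2 : Integrable (fun z => B * (relDensity Ω X I X' I' ρ₀ t (X' t z) + 1))
      (densityMeasure Ω ρ₀) := (i1.add (integrable_const 1)).const_mul B
  have hle : ∀ᵐ z ∂(densityMeasure Ω ρ₀), h (relDensity Ω X I X' I' ρ₀ t (X' t z)) ≤
      B * (relDensity Ω X I X' I' ρ₀ t (X' t z) + 1) := by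
    filter_upwards [ae_mem_densityMeasure hΩ ρ₀] with z hz
    exact hh.le (relDensity_pos h1 h2 ht (h2.flow.mapsTo ht hz))
  have hm : AEStronglyMeasurable (fun z => h (relDensity Ω X I X' I' ρ₀ t (X' t z)))
      (densityMeasure Ω ρ₀) := by
    refine aestronglyMeasurable_densityMeasure hΩ (hh.continuousOn.comp
      ((continuousOn_slice (continuousOn_relDensity h1 h2) ht).comp (h2.continuousOn_apply ht)
        (h2.flow.mapsTo ht)) fun z hz => ?_)
    exact relDensity_pos h1 h2 ht (h2.flow.mapsTo ht hz)
  have i3 : Integrable (fun z => h (relDensity Ω X I X' I' ρ₀ t (X' t z)))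
      (densityMeasure Ω ρ₀) := by
    refine i2.mono' hm ?_
    filter_upwards [hle, ae_mem_densityMeasure hΩ ρ₀] with z hz hzΩ
    rwa [Real.norm_eq_abs, abs_of_nonneg (hh.nonneg _ (relDensity_pos h1 h2 ht
      (h2.flow.mapsTo ht hzΩ)))]
  refine ⟨i3, (integral_mono_ae i3 i2 hle).trans_eq ?_⟩
  rw [integral_const_mul, integral_add i1 (integrable_const 1), e, integral_const]
  simp only [probReal_univ, smul_eq_mul]
  ring

theorem continuousOn_entropy_deriv (hh : IsEntropy h h' h'' B) (h1 : Transport J Ω ρ₀ v X G M I)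
    (h2 : Transport J Ω ρ₀ v' X' G' M' I') :
    ContinuousOn (fun p : ℝ × E d => h' (relDensity Ω X I X' I' ρ₀ p.1 p.2)) (J ×ˢ Ω) :=
  ContinuousOn.comp (t := Ioi 0)
    (fun x hx => (hh.hasDerivAt x hx).continuousAt.continuousWithinAt)
    (continuousOn_relDensity h1 h2) fun _ hp => relDensity_pos h1 h2 hp.1 hp.2

/-- The increment of the localized relative entropy, in terms of the motion of particles. -/
theorem entropy_increment_le (hh : IsEntropy h h' h'' B) (h1 : Transport J Ω ρ₀ v X G M I)
    (h2 : Transport J Ω ρ₀ v' X' G' M' I') [IsProbabilityMeasure (densityMeasure Ω ρ₀)]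
    (hη : IsCutoff Ω K η) (hs1 : SlowAlong J Ω T κ η X) (hs2 : SlowAlong J Ω T κ η X')
    (hκ : 0 ≤ κ) {t τ : ℝ} (ht : t ∈ J) (hτ : τ ∈ J) (htτ : t ≤ τ) (hτT : τ ≤ T) :
    (∫ z, η (X' τ z) * h (relDensity Ω X I X' I' ρ₀ τ (X' τ z)) ∂(densityMeasure Ω ρ₀)) -
      ∫ z, η (X' t z) * h (relDensity Ω X I X' I' ρ₀ t (X' t z)) ∂(densityMeasure Ω ρ₀) ≤
    4 * κ * B * (τ - t) + ∫ x, η (X t x) * (h' (relDensity Ω X I X' I' ρ₀ τ (X τ x)) -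
      h' (relDensity Ω X I X' I' ρ₀ τ (X' τ (flowInv Ω X' t (X t x))))) ∂(densityMeasure Ω ρ₀) := by
  have hΩ := h1.field.isOpen
  have hB : 0 ≤ B := (abs_nonneg _).trans (hh.abs_le 1 one_pos)
  set μ := densityMeasure Ω ρ₀
  set f := relDensity Ω X I X' I' ρ₀ with hf
  have htT : t ≤ T := htτ.trans hτT
  have fpos : ∀ {s}, s ∈ J → ∀ {p}, p ∈ Ω → 0 < f s p := fun hs _ hp => relDensity_pos h1 h2 hs hp
  have hhc : ContinuousOn (fun p : ℝ × E d => h (f p.1 p.2)) (J ×ˢ Ω) :=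
    hh.continuousOn.comp (continuousOn_relDensity h1 h2) fun _ hp => fpos hp.1 hp.2
  have iH := (h2.continuousOn_integral_cutoff hη ht (g := fun t p => h (f t p)) hhc).2
  have ηX' : ContinuousOn (fun z => η (X' t z)) Ω :=
    hη.continuousOn.comp (h2.continuousOn_apply ht) (h2.flow.mapsTo ht)
  have ηX : ContinuousOn (fun z => η (X t z)) Ω :=
    hη.continuousOn.comp (h1.continuousOn_apply ht) (h1.flow.mapsTo ht)
  have hψ := continuousOn_slice (f := fun t p => h' (f t p)) (continuousOn_entropy_deriv hh h1 h2) hτ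
  have ψX' : ContinuousOn (fun z => h' (f τ (X' τ z))) Ω :=
    hψ.comp (h2.continuousOn_apply hτ) (h2.flow.mapsTo hτ)
  have ψX : ContinuousOn (fun z => h' (f τ (X τ z))) Ω :=
    hψ.comp (h1.continuousOn_apply hτ) (h1.flow.mapsTo hτ)
  have ηle : ∀ x, |η x| ≤ 1 := fun x => by
    rw [abs_of_nonneg (hη.nonneg x)]
    exact hη.le_one x
  have hφ : ∀ z ∈ Ω, |η (X' t z) * h' (f τ (X' τ z))| ≤ B := by
    intro z hz
    rw [abs_mul]
    exact (mul_le_mul (ηle _) (hh.abs_le _ (fpos hτ (h2.flow.mapsTo hτ hz))) (abs_nonneg _)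
      zero_le_one).trans_eq (one_mul B)
  obtain ⟨a1, a2, a3⟩ := integral_mul_relDensity h1 h2 hτ
    (φ := fun z => η (X' t z) * h' (f τ (X' τ z))) (ηX'.mul ψX') hφ
  obtain ⟨b1, b2, b3⟩ := integral_mul_relDensity h1 h2 ht
    (φ := fun z => η (X' t z) * h' (f τ (X' τ z))) (ηX'.mul ψX') hφ
  obtain ⟨c1, c2⟩ := integrable_entropy hh h1 h2 hτ
  simp only [← hf] at a1 a3 b1 b3 c1 c2
  have s1 : (∫ z, η (X' τ z) * h (f τ (X' τ z)) ∂μ) - ∫ z, η (X' t z) * h (f t (X' t z)) ∂μ ≤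
      κ * (τ - t) * (∫ z, h (f τ (X' τ z)) ∂μ) +
      ((∫ z, η (X' t z) * h' (f τ (X' τ z)) * f τ (X' τ z) ∂μ) -
        ∫ z, η (X' t z) * h' (f τ (X' τ z)) * f t (X' t z) ∂μ) := by
    have i1 : Integrable (fun z => η (X' t z) * h' (f τ (X' τ z)) * f τ (X' τ z) -
        η (X' t z) * h' (f τ (X' τ z)) * f t (X' t z)) μ := a1.sub b1
    rw [← integral_sub (iH τ hτ) (iH t ht), ← integral_sub a1 b1, ← integral_const_mul,
      ← integral_add (c1.const_mul _) i1]
    refine integral_mono_ae ((iH τ hτ).sub (iH t ht)) ((c1.const_mul _).add i1) ?_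
    filter_upwards [ae_mem_densityMeasure hΩ ρ₀] with z hz
    have p1 := fpos hτ (h2.flow.mapsTo hτ hz)
    have p2 := fpos ht (h2.flow.mapsTo ht hz)
    have q1 := hs2 z hz t ht htT τ hτ hτT
    rw [abs_of_nonneg (sub_nonneg.2 htτ)] at q1
    have q2 := mul_le_mul_of_nonneg_right ((le_abs_self _).trans q1) (hh.nonneg _ p1)
    have q3 := mul_le_mul_of_nonneg_left (hh.sub_le _ p1 _ p2) (hη.nonneg (X' t z))
    nlinarith
  have iR : Integrable (fun x => η (X t x) * h' (f τ (X τ x))) μ := by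
    refine Integrable.of_bound (aestronglyMeasurable_densityMeasure hΩ (ηX.mul ψX)) B ?_
    filter_upwards [ae_mem_densityMeasure hΩ ρ₀] with x hx
    rw [norm_mul, Real.norm_eq_abs, Real.norm_eq_abs]
    exact (mul_le_mul (ηle _) (hh.abs_le _ (fpos hτ (h1.flow.mapsTo hτ hx))) (abs_nonneg _)
      zero_le_one).trans_eq (one_mul B)
  have e2 : (∫ x, η (X' t (flowInv Ω X' t (X t x))) *
        h' (f τ (X' τ (flowInv Ω X' t (X t x)))) ∂μ) =
      ∫ x, η (X t x) * h' (f τ (X' τ (flowInv Ω X' t (X t x)))) ∂μ := by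
    refine integral_congr_ae ?_
    filter_upwards [ae_mem_densityMeasure hΩ ρ₀] with x hx
    rw [h2.flow.apply_flowInv h2.field h2.time ht (h1.flow.mapsTo ht hx)]
  have b2' : Integrable (fun x => η (X t x) * h' (f τ (X' τ (flowInv Ω X' t (X t x))))) μ := by
    refine b2.congr ?_
    filter_upwards [ae_mem_densityMeasure hΩ ρ₀] with x hx
    rw [h2.flow.apply_flowInv h2.field h2.time ht (h1.flow.mapsTo ht hx)]
  have s2 : (∫ x, η (X' t (flowInv Ω X' τ (X τ x))) *
        h' (f τ (X' τ (flowInv Ω X' τ (X τ x)))) ∂μ) ≤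
      2 * κ * B * (τ - t) + ∫ x, η (X t x) * h' (f τ (X τ x)) ∂μ := by
    have : 2 * κ * B * (τ - t) = ∫ x, 2 * κ * B * (τ - t) ∂μ := by simp [μ]
    rw [this, ← integral_add (integrable_const _) iR]
    refine integral_mono_ae a2 ((integrable_const _).add iR) ?_
    filter_upwards [ae_mem_densityMeasure hΩ ρ₀] with x hx
    have hp := h1.flow.mapsTo hτ hx
    have hz := h2.mapsTo_flowInv hτ hp
    have q1 := hs2 _ hz τ hτ hτT t ht htT
    have q2 := hs1 x hx t ht htT τ hτ hτT
    have q3 := hh.abs_le _ (fpos hτ hp)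
    rw [h2.flow.apply_flowInv h2.field h2.time hτ hp] at q1 ⊢
    rw [abs_sub_comm t τ, abs_of_nonneg (sub_nonneg.2 htτ)] at q1
    rw [abs_of_nonneg (sub_nonneg.2 htτ)] at q2
    have q4 : |η (X' t (flowInv Ω X' τ (X τ x))) - η (X t x)| ≤ 2 * κ * (τ - t) := by
      have := abs_sub_le (η (X' t (flowInv Ω X' τ (X τ x)))) (η (X τ x)) (η (X t x))
      linarith
    have q5 := mul_le_mul q4 q3 (abs_nonneg _) ((abs_nonneg _).trans q4)
    rw [← abs_mul] at q5
    have q6 := (le_abs_self _).trans q5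
    nlinarith
  simp only [mul_sub]
  rw [integral_sub iR b2', ← e2]
  rw [a3, b3] at s1
  have s3 := mul_le_mul_of_nonneg_left c2 (mul_nonneg hκ (sub_nonneg.2 htτ))
  linarith

end EntropyBound

section EntropyDissipation

variable {d : ℕ} {J : Set ℝ} {Ω K : Set (E d)} {v X G v' X' G' : ℝ → E d → E d}
  {M M' : ℝ → E d → E d →L[ℝ] E d} {I I' : ℝ → E d → ℝ} {ρ₀ : E d → ℝ}
  {h h' h'' : ℝ → ℝ} {B T κ : ℝ} {η : E d → ℝ}

theorem FlowField.exists_speed_le (hv : FlowField J Ω v) (hJ : TimeDomain J) (T R : ℝ) :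
    ∃ V ≥ 0, ∀ y, IsSol J Ω v y → ∀ s ∈ J, s ≤ T → ‖y s‖ ≤ R → ∀ t ∈ J, t ≤ T →
      ‖y t - y s‖ ≤ V * |t - s| := by
  obtain ⟨R', hR'0, hR'⟩ := hv.exists_norm_le hJ T R
  obtain ⟨C, hC⟩ := hv.growth T
  refine ⟨max C 0 * (1 + R'), by positivity, fun y hy s hs hsT hR t ht htT => ?_⟩
  have hconv : Convex ℝ (J ∩ Iic T) := hJ.ordConnected.convex.inter (convex_Iic T)
  refine hconv.norm_image_sub_le_of_norm_hasDerivWithin_le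
    (fun u hu => ((hy u hu.1).2.mono inter_subset_left)) (fun u hu => ?_) ⟨hs, hsT⟩ ⟨ht, htT⟩
  refine (hC u hu.1 hu.2 _ (hy u hu.1).1).trans ?_
  exact mul_le_mul (le_max_left _ _) (by linarith [hR' y hy s hs hsT hR u hu.1 hu.2])
    (by positivity) (le_max_right _ _)

/-- The derivative of `h' ∘ f` for the relative density `f`. -/
noncomputable def entropyFlux (Ω : Set (E d)) (X G : ℝ → E d → E d) (I : ℝ → E d → ℝ)
    (X' G' : ℝ → E d → E d) (I' : ℝ → E d → ℝ) (ρ₀ : E d → ℝ) (h'' : ℝ → ℝ) (t : ℝ) (p : E d) :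
    E d →L[ℝ] ℝ :=
  h'' (relDensity Ω X I X' I' ρ₀ t p) • (relDensity Ω X I X' I' ρ₀ t p •
      innerSL ℝ (G t (flowInv Ω X t p) - G' t (flowInv Ω X' t p)))

theorem hasFDerivAt_entropy_deriv (hh : IsEntropy h h' h'' B) (h1 : Transport J Ω ρ₀ v X G M I)
    (h2 : Transport J Ω ρ₀ v' X' G' M' I') {t : ℝ} (ht : t ∈ J) {p : E d} (hp : p ∈ Ω) :
    HasFDerivAt (fun q => h' (relDensity Ω X I X' I' ρ₀ t q))
      (entropyFlux Ω X G I X' G' I' ρ₀ h'' t p) p :=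
  (hh.hasDerivAt _ (relDensity_pos h1 h2 ht hp)).comp_hasFDerivAt p
    (hasFDerivAt_relDensity h1 h2 ht hp)

theorem continuousOn_entropyFlux (hh : IsEntropy h h' h'' B) (h1 : Transport J Ω ρ₀ v X G M I)
    (h2 : Transport J Ω ρ₀ v' X' G' M' I') :
    ContinuousOn (fun p : ℝ × E d => entropyFlux Ω X G I X' G' I' ρ₀ h'' p.1 p.2) (J ×ˢ Ω) :=
  (hh.continuousOn_snd.comp (continuousOn_relDensity h1 h2)
    fun _ hp => relDensity_pos h1 h2 hp.1 hp.2).smul ((continuousOn_relDensity h1 h2).smul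
    ((innerSL ℝ).continuous.comp_continuousOn
      (h1.continuousOn_score_flowInv.sub h2.continuousOn_score_flowInv)))

theorem entropyFlux_le (hh : IsEntropy h h' h'' B) (h1 : Transport J Ω ρ₀ v X G M I)
    (h2 : Transport J Ω ρ₀ v' X' G' M' I') {t : ℝ} (ht : t ∈ J) {p : E d} (hp : p ∈ Ω) {w : E d}
    {r : ℝ} (hr : 0 ≤ r) (hle : inner ℝ (G t (flowInv Ω X t p) - G' t (flowInv Ω X' t p)) w ≤ r) :
    entropyFlux Ω X G I X' G' I' ρ₀ h'' t p w ≤ r := by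
  have hf := relDensity_pos h1 h2 ht hp
  rw [entropyFlux, smul_apply, smul_apply, innerSL_apply_apply, smul_eq_mul, smul_eq_mul,
    ← mul_assoc]
  have h3 := hh.mul_snd_le _ hf
  have h4 := mul_nonneg hf.le (hh.snd_nonneg _ hf)
  rw [mul_comm (h'' _)]
  calc _ ≤ _ * r := mul_le_mul_of_nonneg_left hle h4
    _ ≤ 1 * r := mul_le_mul_of_nonneg_right h3 hr
    _ = r := one_mul r

/-- Two curves that leave a point of a compact set with bounded speed stay in `Ω` for a short time,
and a `C¹` function changes by at most a multiple of the elapsed time between them. -/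
theorem exists_norm_sub_le_of_speed {F : ℝ → E d → ℝ} {F' : ℝ → E d → E d →L[ℝ] ℝ}
    (hΩ : IsOpen Ω) {A : Set ℝ} (hA : IsCompact A) (hK : IsCompact K) (hKΩ : K ⊆ Ω)
    (hF : ∀ t ∈ A, ∀ x ∈ Ω, HasFDerivAt (F t) (F' t x) x)
    (hF' : ContinuousOn (fun p : ℝ × E d => F' p.1 p.2) (A ×ˢ Ω)) {V : ℝ} (hV : 0 ≤ V) :
    ∃ C ≥ 0, ∃ δ > 0, ∀ t ∈ A, ∀ p ∈ K, ∀ u, 0 ≤ u → u < δ → ∀ y z, ‖y - p‖ ≤ V * u →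
      ‖z - p‖ ≤ V * u → ‖F t y - F t z‖ ≤ C * u := by
  obtain ⟨r, hr, hsub⟩ := hK.exists_cthickening_subset_open hΩ hKΩ
  obtain ⟨C, hC⟩ := (hA.prod hK.cthickening).exists_bound_of_continuousOn
    (hF'.mono (prod_mono subset_rfl hsub))
  refine ⟨max C 0 * (2 * V), by positivity, r / (V + 1), by positivity,
    fun t ht p hp u hu hur y z hy hz => ?_⟩
  have hu' : V * u ≤ r := by
    rw [lt_div_iff₀ (by positivity)] at hur
    nlinarith
  have hball : Metric.closedBall p (V * u) ⊆ Metric.cthickening r K :=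
    (Metric.closedBall_subset_closedBall hu').trans (Metric.closedBall_subset_cthickening hp r)
  have := (convex_closedBall p (V * u)).norm_image_sub_le_of_norm_hasFDerivWithin_le
    (f := F t) (f' := F' t) (C := max C 0) (x := z) (y := y)
    (fun q hq => (hF t ht q (hsub (hball hq))).hasFDerivWithinAt)
    (fun q hq => (hC (t, q) ⟨ht, hball hq⟩).trans (le_max_left _ _))
    (mem_closedBall_iff_norm.2 hz) (mem_closedBall_iff_norm.2 hy)
  refine this.trans ?_
  rw [mul_assoc]
  refine mul_le_mul_of_nonneg_left ?_ (le_max_right _ _)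
  calc ‖y - z‖ = ‖(y - p) - (z - p)‖ := by rw [sub_sub_sub_cancel_right]
    _ ≤ ‖y - p‖ + ‖z - p‖ := norm_sub_le _ _
    _ ≤ 2 * V * u := by linarith

/-- The rate of change of the localized relative entropy. -/
theorem tendsto_entropy_increment (hh : IsEntropy h h' h'' B) (h1 : Transport J Ω ρ₀ v X G M I)
    (h2 : Transport J Ω ρ₀ v' X' G' M' I') [IsProbabilityMeasure (densityMeasure Ω ρ₀)]
    (hη : IsCutoff Ω K η) {t : ℝ} (ht : 0 ≤ t) (hT : T ∈ J) (htT : t < T) :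
    Tendsto (fun τ => ∫ x, (τ - t)⁻¹ * (η (X t x) * (h' (relDensity Ω X I X' I' ρ₀ τ (X τ x)) -
      h' (relDensity Ω X I X' I' ρ₀ τ (X' τ (flowInv Ω X' t (X t x)))))) ∂(densityMeasure Ω ρ₀))
      (𝓝[>] t) (𝓝 (∫ x, η (X t x) * entropyFlux Ω X G I X' G' I' ρ₀ h'' t (X t x)
        (v t (X t x) - v' t (X t x)) ∂(densityMeasure Ω ρ₀))) := by
  have hΩ := h1.field.isOpen
  have hJ := h1.time
  have hsub := hJ.Icc_subset hT
  have htJ : t ∈ J := hsub ⟨ht, htT.le⟩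
  have hIoc : Ioc t T ⊆ J := fun τ hτ => hsub ⟨ht.trans hτ.1.le, hτ.2⟩
  obtain ⟨R, hR⟩ := hη.isCompact.isBounded.exists_norm_le
  obtain ⟨V₁, hV₁0, hV₁⟩ := h1.field.exists_speed_le hJ T R
  obtain ⟨V₂, hV₂0, hV₂⟩ := h2.field.exists_speed_le hJ T R
  set V := max V₁ V₂
  obtain ⟨C, hC0, δ, hδ, hC⟩ := exists_norm_sub_le_of_speed hΩ (A := Icc 0 T) (V := V)
    isCompact_Icc hη.isCompact hη.subset
    (fun t ht x hx => hasFDerivAt_entropy_deriv hh h1 h2 (hsub ht) hx)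
    ((continuousOn_entropyFlux hh h1 h2).mono (prod_mono hsub subset_rfl))
    (hV₁0.trans (le_max_left _ _))
  have hev : ∀ᶠ τ in 𝓝[>] t, τ ∈ Ioc t T ∧ τ - t < δ := by
    filter_upwards [Ioc_mem_nhdsGT htT, Ioo_mem_nhdsGT (show t < t + δ by linarith)] with τ h3 h4
    exact ⟨h3, by linarith [h4.2]⟩
  refine tendsto_integral_filter_of_dominated_convergence (fun _ => C) ?_ ?_ (integrable_const C) ?_
  · filter_upwards [hev] with τ hτ
    have hτJ := hIoc hτ.1
    have hψ := continuousOn_slice (f := fun t p => h' (relDensity Ω X I X' I' ρ₀ t p))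
      (continuousOn_entropy_deriv hh h1 h2) hτJ
    refine aestronglyMeasurable_densityMeasure hΩ (continuousOn_const.mul ((hη.continuousOn.comp
      (h1.continuousOn_apply htJ) (h1.flow.mapsTo htJ)).mul (ContinuousOn.sub ?_ ?_)))
    · exact hψ.comp (h1.continuousOn_apply hτJ) (h1.flow.mapsTo hτJ)
    · exact hψ.comp ((h2.continuousOn_apply hτJ).comp ((h2.continuousOn_flowInv_apply htJ).comp
        (h1.continuousOn_apply htJ) (h1.flow.mapsTo htJ))
        ((h2.mapsTo_flowInv htJ).comp (h1.flow.mapsTo htJ)))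
        ((h2.flow.mapsTo hτJ).comp ((h2.mapsTo_flowInv htJ).comp (h1.flow.mapsTo htJ)))
  · filter_upwards [hev] with τ hτ
    have hτJ := hIoc hτ.1
    have hτ0 : 0 < τ - t := sub_pos.2 hτ.1.1
    filter_upwards [ae_mem_densityMeasure hΩ ρ₀] with x hx
    have hp := h1.flow.mapsTo htJ hx
    rw [mul_left_comm]
    refine hη.norm_mul_le hC0 hp fun hpK => ?_
    have hz := h2.mapsTo_flowInv htJ hp
    have hzt := h2.flow.apply_flowInv h2.field hJ htJ hp
    have y1 := hV₁ _ (h1.flow.sol x hx) t htJ htT.le (hR _ hpK) τ hτJ hτ.1.2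
    have y2 := hV₂ _ (h2.flow.sol _ hz) t htJ htT.le (by rw [hzt]; exact hR _ hpK) τ hτJ hτ.1.2
    rw [abs_of_pos hτ0] at y1 y2
    rw [hzt] at y2
    have := hC τ ⟨ht.trans hτ.1.1.le, hτ.1.2⟩ _ hpK (τ - t) hτ0.le hτ.2 _ _
      (y1.trans (mul_le_mul_of_nonneg_right (le_max_left _ _) hτ0.le))
      (y2.trans (mul_le_mul_of_nonneg_right (le_max_right _ _) hτ0.le))
    rw [norm_mul, norm_inv, Real.norm_of_nonneg hτ0.le, inv_mul_le_iff₀ hτ0, mul_comm]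
    exact this
  · filter_upwards [ae_mem_densityMeasure hΩ ρ₀] with x hx
    have hp := h1.flow.mapsTo htJ hx
    have hz := h2.mapsTo_flowInv htJ hp
    have hzt := h2.flow.apply_flowInv h2.field hJ htJ hp
    have d1 := hasDerivWithinAt_sub_of_C1 hΩ
      (fun t ht x hx => hasFDerivAt_entropy_deriv hh h1 h2 ht hx)
      (continuousOn_entropyFlux hh h1 h2) htJ (z := fun τ => X τ x) hp (h1.flow.sol x hx t htJ).2
    have d2 := hasDerivWithinAt_sub_of_C1 hΩ
      (fun t ht x hx => hasFDerivAt_entropy_deriv hh h1 h2 ht hx)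
      (continuousOn_entropyFlux hh h1 h2) htJ (z := fun τ => X' τ (flowInv Ω X' t (X t x)))
      (h2.flow.mapsTo htJ hz) (h2.flow.sol _ hz t htJ).2
    simp only [hzt] at d2
    have d3 := ((d1.fun_sub d2).const_mul (η (X t x))).mono_of_mem_nhdsWithin
      (mem_of_superset (Ioc_mem_nhdsGT htT) hIoc)
    rw [hasDerivWithinAt_iff_tendsto_slope' self_notMem_Ioi] at d3
    rw [map_sub]
    refine d3.congr fun τ => ?_
    simp only [slope_def_field, hzt]
    ring

end EntropyDissipation

section KullbackLeibler

variable {d : ℕ} {J : Set ℝ} {Ω K : Set (E d)} {v X G v' X' G' : ℝ → E d → E d}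
  {M M' : ℝ → E d → E d →L[ℝ] E d} {I I' : ℝ → E d → ℝ} {ρ₀ : E d → ℝ}
  {h h' h'' : ℝ → ℝ} {B T κ : ℝ} {η : E d → ℝ} {r : ℝ → E d → ℝ}

theorem relDensity_zero (h1 : Transport J Ω ρ₀ v X G M I) (h2 : Transport J Ω ρ₀ v' X' G' M' I')
    {x : E d} (hx : x ∈ Ω) : relDensity Ω X I X' I' ρ₀ 0 x = 1 := by
  rw [relDensity, h1.flowDensity_zero hx, h2.flowDensity_zero hx, div_self (h1.ρ₀_pos x hx).ne']

theorem integral_cutoff_entropy_le (hh : IsEntropy h h' h'' B) (h1 : Transport J Ω ρ₀ v X G M I)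
    (h2 : Transport J Ω ρ₀ v' X' G' M' I') [IsProbabilityMeasure (densityMeasure Ω ρ₀)]
    (hη : IsCutoff Ω K η) (hs1 : SlowAlong J Ω T κ η X) (hs2 : SlowAlong J Ω T κ η X')
    (hκ : 0 ≤ κ) (hT : T ∈ J) (hr : ContinuousOn (fun p : ℝ × E d => r p.1 p.2) (J ×ˢ Ω))
    (hr0 : ∀ t ∈ J, ∀ p ∈ Ω, 0 ≤ r t p)
    (hle : ∀ t ∈ J, ∀ p ∈ Ω, inner ℝ (G t (flowInv Ω X t p) - G' t (flowInv Ω X' t p))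
      (v t p - v' t p) ≤ r t p) :
    ∫ z, η (X' T z) * h (relDensity Ω X I X' I' ρ₀ T (X' T z)) ∂(densityMeasure Ω ρ₀) ≤
      4 * κ * B * T + ∫ t in 0..T, ∫ x, η (X t x) * r t (X t x) ∂(densityMeasure Ω ρ₀) := by
  have hΩ := h1.field.isOpen
  have hT0 := h1.time.nonneg T hT
  have hsub := h1.time.Icc_subset hT
  have hhc : ContinuousOn (fun p : ℝ × E d => h (relDensity Ω X I X' I' ρ₀ p.1 p.2)) (J ×ˢ Ω) :=
    hh.continuousOn.comp (continuousOn_relDensity h1 h2)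
      fun _ hp => relDensity_pos h1 h2 hp.1 hp.2
  obtain ⟨cH, -⟩ := h2.continuousOn_integral_cutoff hη hT
    (g := fun t p => h (relDensity Ω X I X' I' ρ₀ t p)) hhc
  obtain ⟨cR, iR⟩ := h1.continuousOn_integral_cutoff hη hT (g := r) hr
  have hvc : ContinuousOn (fun p : ℝ × E d => v p.1 p.2 - v' p.1 p.2) (J ×ˢ Ω) :=
    h1.field.C2.continuousOn.sub h2.field.C2.continuousOn
  obtain ⟨-, iF⟩ := h1.continuousOn_integral_cutoff hη hT
    (g := fun t p => entropyFlux Ω X G I X' G' I' ρ₀ h'' t p (v t p - v' t p))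
    ((continuousOn_entropyFlux hh h1 h2).clm_apply hvc)
  set R := fun t => ∫ x, η (X t x) * r t (X t x) ∂(densityMeasure Ω ρ₀) with hRdef
  have hRi : ∀ t ∈ Icc 0 T, IntervalIntegrable R volume 0 t := fun t ht =>
    (cR.mono (by rw [uIcc_of_le ht.1]; exact Icc_subset_Icc_right ht.2)).intervalIntegrable
  have hder : ∀ t ∈ Ico 0 T, HasDerivWithinAt (fun t => 4 * κ * B * t + ∫ s in 0..t, R s)
      (4 * κ * B + R t) (Ici t) t := by
    intro t ht
    have hc : ContinuousWithinAt R (Ioi t) t :=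
      (cR t ⟨ht.1, ht.2.le⟩).mono_of_mem_nhdsWithin
        (mem_of_superset (Ioc_mem_nhdsGT ht.2) fun s hs => ⟨ht.1.trans hs.1.le, hs.2⟩)
    have hm : StronglyMeasurableAtFilter R (𝓝[>] t) :=
      ⟨Icc 0 T, mem_of_superset (Ioc_mem_nhdsGT ht.2) fun s hs => ⟨ht.1.trans hs.1.le, hs.2⟩,
        cR.aestronglyMeasurable measurableSet_Icc⟩
    have d2 := intervalIntegral.integral_hasDerivWithinAt_right (hRi t ⟨ht.1, ht.2.le⟩)
      (s := Ici t) (t := Ioi t) hm hc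
    have d1 : HasDerivWithinAt (fun t => 4 * κ * B * t) (4 * κ * B) (Ici t) t := by
      simpa using (hasDerivWithinAt_id t (Ici t)).const_mul (4 * κ * B)
    exact d1.add d2
  refine image_le_of_liminf_slope_right_le_deriv_boundary (a := 0) (b := T)
    (B := fun t => 4 * κ * B * t + ∫ s in 0..t, R s) cH ?_ ?_ hder ?_ ⟨hT0, le_rfl⟩
  · rw [intervalIntegral.integral_same, mul_zero, add_zero]
    refine (integral_congr_ae (g := fun _ => (0 : ℝ)) ?_).trans_le (by simp)
    filter_upwards [ae_mem_densityMeasure hΩ ρ₀] with z hz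
    rw [relDensity_zero h1 h2 (h2.flow.mapsTo h2.time.zero_mem hz), hh.one, mul_zero]
  · refine ContinuousOn.add (by fun_prop) ?_
    have := intervalIntegral.continuousOn_primitive_interval
      (f := R) (μ := volume) (a := 0) (b := T) (by rw [uIcc_of_le hT0]; exact cR.integrableOn_Icc)
    rwa [uIcc_of_le hT0] at this
  · intro t ht q hq
    have htJ : t ∈ J := hsub ⟨ht.1, ht.2.le⟩
    have hlim := tendsto_entropy_increment hh h1 h2 hη ht.1 hT ht.2
    have hflux : ∫ x, η (X t x) * entropyFlux Ω X G I X' G' I' ρ₀ h'' t (X t x)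
        (v t (X t x) - v' t (X t x)) ∂(densityMeasure Ω ρ₀) ≤ R t := by
      refine integral_mono_ae (iF t htJ) (iR t htJ) ?_
      filter_upwards [ae_mem_densityMeasure hΩ ρ₀] with x hx
      have hp := h1.flow.mapsTo htJ hx
      exact mul_le_mul_of_nonneg_left (entropyFlux_le hh h1 h2 htJ hp (hr0 t htJ _ hp)
        (hle t htJ _ hp)) (hη.nonneg _)
    refine Eventually.frequently ?_
    filter_upwards [hlim.eventually (gt_mem_nhds (show _ < q - 4 * κ * B by linarith)),
      Ioc_mem_nhdsGT ht.2] with τ h3 hτ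
    have hτ0 : 0 < τ - t := sub_pos.2 hτ.1
    have h4 := entropy_increment_le hh h1 h2 hη hs1 hs2 hκ htJ (hsub ⟨ht.1.trans hτ.1.le, hτ.2⟩)
      hτ.1.le hτ.2
    rw [integral_const_mul, inv_mul_lt_iff₀ hτ0] at h3
    rw [slope_def_field, div_lt_iff₀ hτ0]
    linarith

theorem lintegral_entropy_le (hh : IsEntropy h h' h'' B) (h1 : Transport J Ω ρ₀ v X G M I)
    (h2 : Transport J Ω ρ₀ v' X' G' M' I') [IsProbabilityMeasure (densityMeasure Ω ρ₀)]
    (hT : T ∈ J) (hr : ContinuousOn (fun p : ℝ × E d => r p.1 p.2) (J ×ˢ Ω))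
    (hr0 : ∀ t ∈ J, ∀ p ∈ Ω, 0 ≤ r t p)
    (hle : ∀ t ∈ J, ∀ p ∈ Ω, inner ℝ (G t (flowInv Ω X t p) - G' t (flowInv Ω X' t p))
      (v t p - v' t p) ≤ r t p) :
    ∫⁻ z, ENNReal.ofReal (h (relDensity Ω X I X' I' ρ₀ T (X' T z))) ∂(densityMeasure Ω ρ₀) ≤
      ∫⁻ t in Icc 0 T, ∫⁻ x, ENNReal.ofReal (r t (X t x)) ∂(densityMeasure Ω ρ₀) := by
  have hΩ := h1.field.isOpen
  have hT0 := h1.time.nonneg T hT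
  have hsub := h1.time.Icc_subset hT
  have hB : 0 ≤ B := (abs_nonneg _).trans (hh.abs_le 1 one_pos)
  set Λ := ∫⁻ t in Icc 0 T, ∫⁻ x, ENNReal.ofReal (r t (X t x)) ∂(densityMeasure Ω ρ₀)
  have hhc : ContinuousOn (fun p : ℝ × E d => h (relDensity Ω X I X' I' ρ₀ p.1 p.2)) (J ×ˢ Ω) :=
    hh.continuousOn.comp (continuousOn_relDensity h1 h2)
      fun _ hp => relDensity_pos h1 h2 hp.1 hp.2
  have hκ : ∀ K, IsCompact K → K ⊆ Ω → ∀ κ > 0,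
      ∫⁻ z in K, ENNReal.ofReal (h (relDensity Ω X I X' I' ρ₀ T (X' T z))) ∂(densityMeasure Ω ρ₀) ≤
        ENNReal.ofReal (4 * κ * B * T) + Λ := by
    intro K hK hKΩ κ hκ
    obtain ⟨η, e1, e2, e3, e4, ⟨K', e5, e6, e7⟩, e8, e9⟩ := exists_cutoff h1.time h1.field h1.flow
      h2.field h2.flow T hκ (K := X' T '' K)
      (hK.image_of_continuousOn ((h2.continuousOn_apply hT).mono hKΩ))
      (image_subset_iff.2 fun z hz => h2.flow.mapsTo hT (hKΩ hz))
    have hη : IsCutoff Ω K' η := ⟨e5, e6, e1, e2, e3, e7⟩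
    have key := integral_cutoff_entropy_le hh h1 h2 hη e8 e9 hκ.le hT hr hr0 hle
    obtain ⟨-, iH⟩ := h2.continuousOn_integral_cutoff hη hT
      (g := fun t p => h (relDensity Ω X I X' I' ρ₀ t p)) hhc
    obtain ⟨cR, iR⟩ := h1.continuousOn_integral_cutoff hη hT (g := r) hr
    calc ∫⁻ z in K, ENNReal.ofReal (h (relDensity Ω X I X' I' ρ₀ T (X' T z))) ∂(densityMeasure Ω ρ₀)
        ≤ ∫⁻ z in K, ENNReal.ofReal (η (X' T z) * h (relDensity Ω X I X' I' ρ₀ T (X' T z)))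
            ∂(densityMeasure Ω ρ₀) := by
          refine setLIntegral_mono_ae' hK.measurableSet (Eventually.of_forall fun z hz => ?_)
          rw [e4 _ (mem_image_of_mem _ hz), one_mul]
      _ ≤ ∫⁻ z, ENNReal.ofReal (η (X' T z) * h (relDensity Ω X I X' I' ρ₀ T (X' T z)))
            ∂(densityMeasure Ω ρ₀) := setLIntegral_le_lintegral _ _
      _ = ENNReal.ofReal (∫ z, η (X' T z) * h (relDensity Ω X I X' I' ρ₀ T (X' T z))
            ∂(densityMeasure Ω ρ₀)) := by
          refine (ofReal_integral_eq_lintegral_ofReal (iH T hT) ?_).symm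
          filter_upwards [ae_mem_densityMeasure hΩ ρ₀] with z hz
          exact mul_nonneg (e2 _) (hh.nonneg _ (relDensity_pos h1 h2 hT (h2.flow.mapsTo hT hz)))
      _ ≤ ENNReal.ofReal (4 * κ * B * T + ∫ t in 0..T, ∫ x, η (X t x) * r t (X t x)
            ∂(densityMeasure Ω ρ₀)) := ENNReal.ofReal_le_ofReal key
      _ ≤ ENNReal.ofReal (4 * κ * B * T) + ENNReal.ofReal (∫ t in 0..T, ∫ x, η (X t x) * r t (X t x)
            ∂(densityMeasure Ω ρ₀)) := ENNReal.ofReal_add_le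
      _ ≤ ENNReal.ofReal (4 * κ * B * T) + Λ := by
          gcongr
          rw [intervalIntegral.integral_of_le hT0, ← integral_Icc_eq_integral_Ioc,
            ofReal_integral_eq_lintegral_ofReal cR.integrableOn_Icc]
          · refine setLIntegral_mono_ae' measurableSet_Icc (Eventually.of_forall fun t ht => ?_)
            rw [ofReal_integral_eq_lintegral_ofReal (iR t (hsub ht))]
            · refine lintegral_mono_ae ?_
              filter_upwards [ae_mem_densityMeasure hΩ ρ₀] with x hx
              exact ENNReal.ofReal_le_ofReal (mul_le_of_le_one_left
                (hr0 t (hsub ht) _ (h1.flow.mapsTo (hsub ht) hx)) (e3 _))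
            · filter_upwards [ae_mem_densityMeasure hΩ ρ₀] with x hx
              exact mul_nonneg (e2 _) (hr0 t (hsub ht) _ (h1.flow.mapsTo (hsub ht) hx))
          · refine (ae_restrict_iff' measurableSet_Icc).2 (Eventually.of_forall fun t ht => ?_)
            refine integral_nonneg_of_ae ?_
            filter_upwards [ae_mem_densityMeasure hΩ ρ₀] with x hx
            exact mul_nonneg (e2 _) (hr0 t (hsub ht) _ (h1.flow.mapsTo (hsub ht) hx))
  have hcomp : ∀ K, IsCompact K → K ⊆ Ω →
      ∫⁻ z in K, ENNReal.ofReal (h (relDensity Ω X I X' I' ρ₀ T (X' T z)))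
        ∂(densityMeasure Ω ρ₀) ≤ Λ := by
    intro K hK hKΩ
    have hlim : Tendsto (fun κ : ℝ => ENNReal.ofReal (4 * κ * B * T) + Λ) (𝓝[>] 0) (𝓝 (0 + Λ)) := by
      refine Tendsto.add ?_ tendsto_const_nhds
      have : Tendsto (fun κ : ℝ => 4 * κ * B * T) (𝓝[>] 0) (𝓝 (4 * 0 * B * T)) :=
        (Continuous.tendsto (by fun_prop) 0).mono_left nhdsWithin_le_nhds
      simpa using ENNReal.tendsto_ofReal this
    rw [zero_add] at hlim
    exact ge_of_tendsto hlim (eventually_nhdsWithin_of_forall fun κ hκ0 => hκ K hK hKΩ κ hκ0)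
  obtain ⟨U, hU, hUΩ, hUn, hUm⟩ := hΩ.exists_iUnion_isClosed
  have hcover : ⋃ n : ℕ, U n ∩ Metric.closedBall 0 n = Ω := by
    rw [← hUn]
    refine Subset.antisymm (iUnion_mono fun n => inter_subset_left) fun x hx => ?_
    obtain ⟨n, hn⟩ := mem_iUnion.1 hx
    obtain ⟨m, hm⟩ := exists_nat_ge ‖x‖
    refine mem_iUnion.2 ⟨max n m, hUm (le_max_left _ _) hn, mem_closedBall_zero_iff.2 (hm.trans ?_)⟩
    exact_mod_cast le_max_right n m
  have hmono : Monotone fun n : ℕ => U n ∩ Metric.closedBall (0 : E d) n := fun m n hmn =>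
    inter_subset_inter (hUm hmn) (Metric.closedBall_subset_closedBall (by exact_mod_cast hmn))
  rw [← Measure.restrict_eq_self_of_ae_mem (ae_mem_densityMeasure hΩ ρ₀), ← hcover,
    setLIntegral_iUnion_of_directed _ hmono.directed_le]
  refine iSup_le fun n => ?_
  rw [hcover]
  exact hcomp _ ((isCompact_closedBall _ _).inter_left (hU n)) (inter_subset_left.trans (hUΩ n))

/-- The Kullback-Leibler divergence in Lagrangian coordinates. -/
theorem klDiv_map_eq (h1 : Transport J Ω ρ₀ v X G M I) (h2 : Transport J Ω ρ₀ v' X' G' M' I')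
    [IsProbabilityMeasure (densityMeasure Ω ρ₀)] {t : ℝ} (ht : t ∈ J) :
    InformationTheory.klDiv ((densityMeasure Ω ρ₀).map (X t)) ((densityMeasure Ω ρ₀).map (X' t)) =
      ∫⁻ z, ENNReal.ofReal (InformationTheory.klFun (relDensity Ω X I X' I' ρ₀ t (X' t z)))
        ∂(densityMeasure Ω ρ₀) := by
  have hΩ := h1.field.isOpen
  have hrel := continuousOn_slice (continuousOn_relDensity h1 h2) ht
  have hmX' : AEMeasurable (X' t) (densityMeasure Ω ρ₀) :=
    aemeasurable_densityMeasure hΩ (h2.continuousOn_apply ht)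
  have hmX : AEMeasurable (X t) (densityMeasure Ω ρ₀) :=
    aemeasurable_densityMeasure hΩ (h1.continuousOn_apply ht)
  have : IsProbabilityMeasure ((densityMeasure Ω ρ₀).map (X t)) :=
    Measure.isProbabilityMeasure_map hmX
  have : IsProbabilityMeasure ((densityMeasure Ω ρ₀).map (X' t)) :=
    Measure.isProbabilityMeasure_map hmX'
  have hν := h2.map_eq_flowDensity ht
  have hm : AEMeasurable (fun p => ENNReal.ofReal (relDensity Ω X I X' I' ρ₀ t p))
      ((densityMeasure Ω ρ₀).map (X' t)) := by
    rw [hν]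
    exact (aemeasurable_densityMeasure hΩ hrel).ennreal_ofReal
  have hμ : (densityMeasure Ω ρ₀).map (X t) = ((densityMeasure Ω ρ₀).map (X' t)).withDensity
      (fun p => ENNReal.ofReal (relDensity Ω X I X' I' ρ₀ t p)) := by
    refine Measure.ext_of_lintegral _ fun g hg => ?_
    rw [lintegral_withDensity_eq_lintegral_mul_non_measurable₀ _ hm
      (Eventually.of_forall fun _ => ENNReal.ofReal_lt_top), h1.map_eq_flowDensity ht, hν,
      lintegral_densityMeasure hΩ (continuousOn_slice h1.flowDensity_C1.continuousOn ht),
      lintegral_densityMeasure hΩ (continuousOn_slice h2.flowDensity_C1.continuousOn ht)]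
    refine setLIntegral_congr_fun hΩ.measurableSet fun p hp => ?_
    rw [flowDensity_eq_mul_relDensity (X := X) (I := I) h2 ht hp,
      ENNReal.ofReal_mul (h2.flowDensity_pos ht hp).le, mul_assoc]
    rfl
  have hac : (densityMeasure Ω ρ₀).map (X t) ≪ (densityMeasure Ω ρ₀).map (X' t) := by
    rw [hμ]
    exact withDensity_absolutelyContinuous _ _
  have hkl : AEMeasurable (fun p => ENNReal.ofReal (InformationTheory.klFun
      (relDensity Ω X I X' I' ρ₀ t p))) ((densityMeasure Ω ρ₀).map (X' t)) := by
    rw [hν]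
    exact (aemeasurable_densityMeasure hΩ
      (InformationTheory.continuous_klFun.comp_continuousOn hrel)).ennreal_ofReal
  rw [InformationTheory.klDiv_eq_lintegral_klFun_of_ac hac, ← lintegral_map' hkl hmX']
  refine lintegral_congr_ae ?_
  have hmem : ∀ᵐ p ∂((densityMeasure Ω ρ₀).map (X' t)), p ∈ Ω := by
    rw [hν]
    exact ae_mem_densityMeasure hΩ _
  have hrn := Measure.rnDeriv_withDensity₀ _ hm
  rw [← hμ] at hrn
  filter_upwards [hrn, hmem] with p hp hpΩ
  rw [hp, ENNReal.toReal_ofReal (relDensity_pos h1 h2 ht hpΩ).le]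

theorem klDiv_map_le (h1 : Transport J Ω ρ₀ v X G M I)
    (h2 : Transport J Ω ρ₀ v' X' G' M' I') [IsProbabilityMeasure (densityMeasure Ω ρ₀)]
    (hT : T ∈ J) (hr : ContinuousOn (fun p : ℝ × E d => r p.1 p.2) (J ×ˢ Ω))
    (hr0 : ∀ t ∈ J, ∀ p ∈ Ω, 0 ≤ r t p)
    (hle : ∀ t ∈ J, ∀ p ∈ Ω, inner ℝ (G t (flowInv Ω X t p) - G' t (flowInv Ω X' t p))
      (v t p - v' t p) ≤ r t p) :
    InformationTheory.klDiv ((densityMeasure Ω ρ₀).map (X T)) ((densityMeasure Ω ρ₀).map (X' T)) ≤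
      ∫⁻ t in Icc 0 T, ∫⁻ x, ENNReal.ofReal (r t (X t x)) ∂(densityMeasure Ω ρ₀) := by
  have hΩ := h1.field.isOpen
  rw [klDiv_map_eq h1 h2 hT]
  set Λ := ∫⁻ t in Icc 0 T, ∫⁻ x, ENNReal.ofReal (r t (X t x)) ∂(densityMeasure Ω ρ₀)
  have ha0 : ∀ n : ℕ, (0 : ℝ) < ((n : ℝ) + 2)⁻¹ := fun n => by positivity
  have ha1 : ∀ n : ℕ, ((n : ℝ) + 2)⁻¹ < 1 := fun n =>
    inv_lt_one_of_one_lt₀ (by linarith [n.cast_nonneg (α := ℝ)])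
  have hlim : Tendsto (fun n : ℕ => ((n : ℝ) + 2)⁻¹) atTop (𝓝[>] 0) :=
    tendsto_nhdsWithin_iff.2 ⟨tendsto_inv_atTop_zero.comp
      (tendsto_atTop_add_const_right _ _ tendsto_natCast_atTop_atTop), Eventually.of_forall ha0⟩
  have hle' : ∀ n : ℕ, ∫⁻ z, ENNReal.ofReal (entropyApprox ((n : ℝ) + 2)⁻¹
      (relDensity Ω X I X' I' ρ₀ T (X' T z))) ∂(densityMeasure Ω ρ₀) ≤ Λ := fun n =>
    lintegral_entropy_le (isEntropy_entropyApprox (ha0 n) (ha1 n)) h1 h2 hT hr hr0 hle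
  have hm : ∀ n : ℕ, AEMeasurable (fun z => ENNReal.ofReal (entropyApprox ((n : ℝ) + 2)⁻¹
      (relDensity Ω X I X' I' ρ₀ T (X' T z)))) (densityMeasure Ω ρ₀) := by
    intro n
    refine (aemeasurable_densityMeasure hΩ ((isEntropy_entropyApprox (ha0 n)
      (ha1 n)).continuousOn.comp ((continuousOn_slice (continuousOn_relDensity h1 h2) hT).comp
      (h2.continuousOn_apply hT) (h2.flow.mapsTo hT)) fun z hz => ?_)).ennreal_ofReal
    exact relDensity_pos h1 h2 hT (h2.flow.mapsTo hT hz)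
  calc _ = ∫⁻ z, liminf (fun n : ℕ => ENNReal.ofReal (entropyApprox ((n : ℝ) + 2)⁻¹
        (relDensity Ω X I X' I' ρ₀ T (X' T z)))) atTop ∂(densityMeasure Ω ρ₀) := by
        refine lintegral_congr_ae ?_
        filter_upwards [ae_mem_densityMeasure hΩ ρ₀] with z hz
        exact (ENNReal.tendsto_ofReal ((tendsto_entropyApprox (relDensity_pos h1 h2 hT
          (h2.flow.mapsTo hT hz))).comp hlim)).liminf_eq.symm
    _ ≤ liminf (fun n : ℕ => ∫⁻ z, ENNReal.ofReal (entropyApprox ((n : ℝ) + 2)⁻¹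
        (relDensity Ω X I X' I' ρ₀ T (X' T z))) ∂(densityMeasure Ω ρ₀)) atTop :=
        lintegral_liminf_le' hm
    _ ≤ liminf (fun _ : ℕ => Λ) atTop := liminf_le_liminf (Eventually.of_forall hle')
    _ = Λ := liminf_const _

end KullbackLeibler

section Application

variable {d : ℕ} {J J' : Set ℝ} {Ω : Set (E d)} {b : ℝ → E d → E d}
  {D : ℝ → E d → E d →L[ℝ] E d} {ρ₀ : E d → ℝ} {ρs : ℝ → E d → ℝ} {s X G : ℝ → E d → E d} {T : ℝ}

theorem Standing.flowField (h : Standing Ω b D ρ₀ ρs) (hJ : J ⊆ Ici 0)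
    (hs : Admissible J Ω b D s) : FlowField J Ω (velocity b D s) :=
  ⟨h.isOpen, CkInSpace.velocity h.isOpen (h.b_C2.mono_time hJ) (h.D_C2.mono_time hJ) hs.s_C2,
    hs.growth, hs.lipschitz, hs.noExit⟩

theorem Admissible.mono_time (hs : Admissible J Ω b D s) (hJ : J' ⊆ J) : Admissible J' Ω b D s where
  s_C2 := hs.s_C2.mono_time hJ
  growth T := by
    obtain ⟨C, hC⟩ := hs.growth T
    exact ⟨C, fun t ht => hC t (hJ ht)⟩
  lipschitz T R := by
    obtain ⟨L, hL⟩ := hs.lipschitz T R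
    exact ⟨L, fun t ht => hL t (hJ ht)⟩
  noExit a c y hac hsub := hs.noExit a c y hac (hsub.trans hJ)

theorem Standing.score_C2 (h : Standing Ω b D ρ₀ ρs) :
    CkInSpace (Ici 0) Ω 2 (fun t => score (ρs t)) :=
  CkInSpace.score h.isOpen h.ρs_C3 fun t ht x hx => (h.ρs_pos t ht x hx).ne'

theorem Standing.exists_norm_score_le (h : Standing Ω b D ρ₀ ρs) (T : ℝ) :
    ∃ C ≥ 0, ∀ t ∈ Ici (0 : ℝ), t ≤ T → ∀ x ∈ Ω, ‖score (ρs t) x‖ ≤ C * (1 + ‖x‖) := by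
  rcases Ω.eq_empty_or_nonempty with rfl | ⟨x₀, hx₀⟩
  · exact ⟨0, le_rfl, fun t _ _ x hx => hx.elim⟩
  obtain ⟨K, hK0, hK⟩ := h.ρs_smooth
  have hc : ContinuousOn (fun t => score (ρs t) x₀) (Icc 0 T) :=
    h.score_C2.continuousOn.comp (f := fun t => (t, x₀)) (by fun_prop) fun t ht => ⟨ht.1, hx₀⟩
  obtain ⟨C, hC⟩ := isCompact_Icc.exists_bound_of_continuousOn hc
  refine ⟨max C 0 + K * (1 + ‖x₀‖), by positivity, fun t ht htT x hx => ?_⟩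
  have h1 := (hC t ⟨ht, htT⟩).trans (le_max_left C 0)
  have h2 := hK t ht x hx x₀ hx₀
  have h3 := norm_le_norm_add_norm_sub' (score (ρs t) x) (score (ρs t) x₀)
  have h4 := mul_le_mul_of_nonneg_left (norm_sub_le x x₀) hK0.le
  have h5 : 0 ≤ max C 0 * ‖x‖ := by positivity
  have h6 : 0 ≤ K * (1 + ‖x₀‖ * ‖x‖) := by positivity
  nlinarith

/-- The exact score is admissible. -/
theorem Standing.admissible_score (h : Standing Ω b D ρ₀ ρs) :
    Admissible (Ici 0) Ω b D (fun t => score (ρs t)) where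
  s_C2 := h.score_C2
  noExit := h.confined
  growth T := by
    obtain ⟨C, hC0, hC⟩ := h.exists_norm_score_le T
    obtain ⟨C₁, hC₁⟩ := h.b_bounded
    obtain ⟨C₂, hC₂⟩ := h.D_bounded
    refine ⟨C₁ + C₂ * C, fun t ht htT x hx => ?_⟩
    have h1 := hC₁ t ht x hx
    have h2 := hC₂ t ht x hx
    have h0 : 0 ≤ C₁ * ‖x‖ := mul_nonneg ((norm_nonneg _).trans h1) (norm_nonneg _)
    calc ‖velocity b D (fun t => score (ρs t)) t x‖ ≤ ‖b t x‖ + ‖D t x (score (ρs t) x)‖ :=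
          norm_sub_le _ _
      _ ≤ C₁ + C₂ * (C * (1 + ‖x‖)) := add_le_add h1 ((D t x).le_of_opNorm_le_of_le h2
          (hC t ht htT x hx))
      _ ≤ (C₁ + C₂ * C) * (1 + ‖x‖) := by nlinarith
  lipschitz T R := by
    obtain ⟨C, hC0, hC⟩ := h.exists_norm_score_le T
    obtain ⟨C₂, hC₂⟩ := h.D_bounded
    obtain ⟨K, hK0, hK⟩ := h.ρs_smooth
    obtain ⟨L₁, hL₁⟩ := h.b_lipschitz T R
    obtain ⟨L₂, hL₂⟩ := h.D_lipschitz T R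
    refine ⟨L₁ + (C₂ * K + max L₂ 0 * (C * (1 + R))), fun t ht htT x hx y hy hxR hyR => ?_⟩
    have h1 := hL₁ t ht htT x hx y hy hxR hyR
    have h2 : ‖D t x - D t y‖ ≤ max L₂ 0 * ‖x - y‖ :=
      (hL₂ t ht htT x hx y hy hxR hyR).trans
        (mul_le_mul_of_nonneg_right (le_max_left _ _) (norm_nonneg _))
    have h3 : ‖score (ρs t) y‖ ≤ C * (1 + R) :=
      (hC t ht htT y hy).trans (mul_le_mul_of_nonneg_left (by linarith) hC0)
    have e : velocity b D (fun t => score (ρs t)) t x - velocity b D (fun t => score (ρs t)) t y =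
        (b t x - b t y) - (D t x (score (ρs t) x - score (ρs t) y) +
          (D t x - D t y) (score (ρs t) y)) := by
      simp only [velocity, map_sub, sub_apply]
      abel
    rw [e]
    calc _ ≤ ‖b t x - b t y‖ + (‖D t x (score (ρs t) x - score (ρs t) y)‖ +
          ‖(D t x - D t y) (score (ρs t) y)‖) :=
          (norm_sub_le _ _).trans (add_le_add le_rfl (norm_add_le _ _))
      _ ≤ L₁ * ‖x - y‖ + (C₂ * (K * ‖x - y‖) + max L₂ 0 * ‖x - y‖ * (C * (1 + R))) :=
          add_le_add h1 (add_le_add ((D t x).le_of_opNorm_le_of_le (hC₂ t ht x hx) (hK t ht x hx y hy))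
            ((D t x - D t y).le_of_opNorm_le_of_le h2 h3))
      _ = _ := by ring

/-- The Fokker-Planck equation is the transport equation for its probability flow. -/
theorem Standing.solvesTE (h : Standing Ω b D ρ₀ ρs) :
    SolvesTE (Ici 0) Ω (velocity b D (fun t => score (ρs t))) ρs := by
  intro t ht x hx
  have heq : (fun y => ρs t y • b t y - D t y (gradient (ρs t) y)) =ᶠ[𝓝 x]
      fun y => ρs t y • velocity b D (fun t => score (ρs t)) t y := by
    filter_upwards [h.isOpen.mem_nhds hx] with y hy
    have h0 := (h.ρs_pos t ht y hy).ne'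
    have hd : DifferentiableAt ℝ (ρs t) y :=
      ((h.ρs_C3.of_le (m := 1) (by norm_num)).hasFDerivAt h.isOpen ht hy).differentiableAt
    rw [velocity, score_eq hd h0, smul_sub, ← map_smul, smul_inv_smul₀ h0]
  have := h.ρs_fpe t ht x hx
  rwa [divergence, heq.fderiv_eq] at this

theorem Standing.isProbabilityMeasure (h : Standing Ω b D ρ₀ ρs) :
    IsProbabilityMeasure (densityMeasure Ω ρ₀) :=
  isProbabilityMeasure_densityMeasure h.isOpen h.ρ₀_pos h.ρ₀_integral

theorem Standing.exists_solvesXG (h : Standing Ω b D ρ₀ ρs) (hJ : TimeDomain J) (hJ0 : J ⊆ Ici 0)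
    (hs : Admissible J Ω b D s) : ∃ X G, SolvesXG J Ω ρ₀ (velocity b D s) X G := by
  have hv := h.flowField hJ0 hs
  obtain ⟨X, hX⟩ := hv.exists_isFlow hJ
  obtain ⟨G, hG0, hG⟩ := hX.exists_isScoreSol hv hJ (score ρ₀)
  exact ⟨X, G, fun t ht x hx => hX.mapsTo ht hx, hX.init, fun t ht x hx => (hX.sol x hx t ht).2,
    hG0, hG⟩

theorem Standing.exists_transport (h : Standing Ω b D ρ₀ ρs) (hJ : TimeDomain J) (hJ0 : J ⊆ Ici 0)
    (hs : Admissible J Ω b D s) (hXG : SolvesXG J Ω ρ₀ (velocity b D s) X G) :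
    ∃ M I, Transport J Ω ρ₀ (velocity b D s) X G M I :=
  (h.flowField hJ0 hs).exists_transport hJ
    ⟨hXG.X_init, fun x hx t ht => ⟨hXG.X_mem t ht x hx, hXG.X_ode t ht x hx⟩⟩ hXG.G_init hXG.G_ode
    (h.ρ₀_C3.of_le (by norm_num)) h.ρ₀_pos

theorem densityMeasure_congr (hΩ : IsOpen Ω) {ρ ρ' : E d → ℝ} (hρ : EqOn ρ ρ' Ω) :
    densityMeasure Ω ρ = densityMeasure Ω ρ' := by
  refine withDensity_congr_ae ?_
  filter_upwards [ae_restrict_mem hΩ.measurableSet] with x hx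
  rw [hρ hx]

theorem score_congr (hΩ : IsOpen Ω) {ρ ρ' : E d → ℝ} (hρ : EqOn ρ ρ' Ω) {x : E d} (hx : x ∈ Ω) :
    score ρ x = score ρ' x := by
  have : (fun y => Real.log (ρ y)) =ᶠ[𝓝 x] fun y => Real.log (ρ' y) := by
    filter_upwards [hΩ.mem_nhds hx] with y hy
    rw [hρ hy]
  rw [score, score, gradient, gradient, this.fderiv_eq]

/-- Along the probability flow, the density is the solution of the Fokker-Planck equation. -/
theorem Standing.transport_exact (h : Standing Ω b D ρ₀ ρs) (hJ : TimeDomain J) (hJ0 : J ⊆ Ici 0)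
    (hXG : SolvesXG J Ω ρ₀ (velocity b D (fun t => score (ρs t))) X G) :
    (∃ M I, Transport J Ω ρ₀ (velocity b D (fun t => score (ρs t))) X G M I) ∧
    (∀ t ∈ J, ∀ x ∈ Ω, G t x = score (ρs t) (X t x)) ∧
    ∀ t ∈ J, (densityMeasure Ω ρ₀).map (X t) = densityMeasure Ω (ρs t) := by
  obtain ⟨M, I, h1⟩ := h.exists_transport hJ hJ0 (h.admissible_score.mono_time hJ0) hXG
  have hTE : SolvesTE J Ω (velocity b D (fun t => score (ρs t))) ρs := fun t ht x hx =>
    (h.solvesTE t (hJ0 ht) x hx).mono hJ0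
  have heq : ∀ t ∈ J, EqOn (ρs t) (flowDensity Ω X I ρ₀ t) Ω := fun t ht p hp =>
    h1.eq_flowDensity_of_solvesTE ((h.ρs_C3.of_le (by norm_num)).mono_time hJ0) h.ρs_init hTE ht hp
  refine ⟨⟨M, I, h1⟩, fun t ht x hx => ?_, fun t ht => ?_⟩
  · have hp := h1.flow.mapsTo ht hx
    rw [score_congr h.isOpen (heq t ht) hp, h1.score_flowDensity ht hp,
      h1.flow.flowInv_apply h1.field hJ ht hx]
  · rw [h1.map_eq_flowDensity ht, densityMeasure_congr h.isOpen (heq t ht)]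

theorem inner_le_half_of_isPositive {A : E d →L[ℝ] E d} (hA : A.IsPositive) (a e : E d) :
    inner ℝ a (A (-a - e)) ≤ 2⁻¹ * inner ℝ e (A e) := by
  have h1 := hA.inner_nonneg_right (a + e)
  have h2 := hA.inner_nonneg_right a
  have h3 : inner ℝ e (A a) = inner ℝ a (A e) := by
    rw [← hA.inner_left_eq_inner_right, real_inner_comm]
  simp only [map_add, map_sub, map_neg, inner_add_left, inner_add_right, inner_sub_right,
    inner_neg_right] at h1 ⊢
  linarith

theorem eq_zero_of_inner_eq_zero {A : E d →L[ℝ] E d} (hA : A.IsPositive) {e : E d}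
    (he : inner ℝ e (A e) = 0) : A e = 0 := by
  have h3 : inner ℝ (A e) (A e) = inner ℝ e (A (A e)) := hA.inner_left_eq_inner_right _ _
  have key : ∀ l : ℝ, 0 ≤ inner ℝ (A e) (A (A e)) * (l * l) + -2 * ‖A e‖ ^ 2 * l + 0 := by
    intro l
    have h1 := hA.inner_nonneg_right (e - l • A e)
    simp only [map_sub, map_smul, inner_sub_left, inner_sub_right, inner_smul_left,
      inner_smul_right, he, ← h3, real_inner_self_eq_norm_sq] at h1
    simp at h1
    linarith
  have := discrim_le_zero key
  rw [discrim] at this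
  have h4 : ‖A e‖ ^ 2 = 0 := by nlinarith [sq_nonneg (‖A e‖ ^ 2)]
  exact norm_eq_zero.1 (pow_eq_zero_iff (by norm_num) |>.1 h4)

theorem loss_eq (h : Standing Ω b D ρ₀ ρs) :
    ∫⁻ t in Icc 0 T, ∫⁻ x, ENNReal.ofReal (2⁻¹ * inner ℝ (s t (X t x) - G t x)
      (D t (X t x) (s t (X t x) - G t x))) ∂(densityMeasure Ω ρ₀) =
    2⁻¹ * loss Ω D ρ₀ T s X G := by
  have h2 : ENNReal.ofReal 2⁻¹ = 2⁻¹ := by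
    rw [ENNReal.ofReal_inv_of_pos two_pos, ENNReal.ofReal_ofNat]
  rw [loss, ← lintegral_const_mul' _ _ (by simp)]
  refine lintegral_congr fun t => ?_
  rw [lintegral_densityMeasure h.isOpen h.ρ₀_C3.continuousOn, ← lintegral_const_mul' _ _ (by simp)]
  refine setLIntegral_congr_fun h.isOpen.measurableSet fun x hx => ?_
  rw [← h2, ← ENNReal.ofReal_mul (h.ρ₀_pos x hx).le, ← ENNReal.ofReal_mul (by norm_num)]
  ring_nf

/-- The loss controls the divergence from the solution of the Fokker-Planck equation. -/
theorem Standing.klDiv_le (h : Standing Ω b D ρ₀ ρs) (hJ : TimeDomain J) (hJ0 : J ⊆ Ici 0)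
    (hs : Admissible J Ω b D s) (hXG : SolvesXG J Ω ρ₀ (velocity b D s) X G) (hT : T ∈ J) :
    InformationTheory.klDiv ((densityMeasure Ω ρ₀).map (X T)) (densityMeasure Ω (ρs T)) ≤
      2⁻¹ * loss Ω D ρ₀ T s X G := by
  have := h.isProbabilityMeasure
  obtain ⟨M, I, h1⟩ := h.exists_transport hJ hJ0 hs hXG
  obtain ⟨X', G', hXG'⟩ := h.exists_solvesXG hJ hJ0 (h.admissible_score.mono_time hJ0)
  obtain ⟨⟨M', I', h2⟩, hG', hmap⟩ := h.transport_exact hJ hJ0 hXG'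
  have hec : ContinuousOn (fun p : ℝ × E d => s p.1 p.2 - G p.1 (flowInv Ω X p.1 p.2)) (J ×ˢ Ω) :=
    hs.s_C2.continuousOn.sub h1.continuousOn_score_flowInv
  have hDc : ContinuousOn (fun p : ℝ × E d => D p.1 p.2) (J ×ˢ Ω) :=
    (h.D_C2.mono_time hJ0).continuousOn
  have key := klDiv_map_le (r := fun t p => 2⁻¹ * inner ℝ (s t p - G t (flowInv Ω X t p))
    (D t p (s t p - G t (flowInv Ω X t p)))) h1 h2 hT
    (continuousOn_const.mul (hec.inner (𝕜 := ℝ) (hDc.clm_apply hec)))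
    (fun t ht p hp => mul_nonneg (by norm_num) ((h.D_psd t (hJ0 ht) p hp).inner_nonneg_right _))
    (fun t ht p hp => ?_)
  · rw [hmap T hT] at key
    refine key.trans_eq ((setLIntegral_congr_fun measurableSet_Icc fun t ht => ?_).trans (loss_eq h))
    have htJ := hJ.Icc_subset hT ht
    refine lintegral_congr_ae ?_
    filter_upwards [ae_mem_densityMeasure h.isOpen ρ₀] with x hx
    rw [h1.flow.flowInv_apply h1.field hJ htJ hx]
  · have hq := h2.mapsTo_flowInv ht hp
    rw [hG' t ht _ hq, h2.flow.apply_flowInv h2.field hJ ht hp]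
    refine le_trans (le_of_eq ?_) (inner_le_half_of_isPositive (h.D_psd t (hJ0 ht) p hp)
      (G t (flowInv Ω X t p) - score (ρs t) p) _)
    congr 1
    simp only [velocity, map_sub, map_neg]
    abel

/-- The exact score has zero loss. -/
theorem Standing.loss_exact (h : Standing Ω b D ρ₀ ρs) (hT : 0 ≤ T)
    (hXG : SolvesXG (Icc 0 T) Ω ρ₀ (velocity b D (fun t => score (ρs t))) X G) :
    loss Ω D ρ₀ T (fun t => score (ρs t)) X G = 0 := by
  obtain ⟨-, hG, -⟩ := h.transport_exact (timeDomain_Icc hT) (fun t ht => ht.1) hXG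
  rw [loss, setLIntegral_congr_fun (g := fun _ => 0) measurableSet_Icc, lintegral_zero]
  intro t ht
  beta_reduce
  rw [setLIntegral_congr_fun (g := fun _ => 0) h.isOpen.measurableSet, lintegral_zero]
  intro x hx
  simp only [hG t ht x hx, sub_self, inner_zero_left, zero_mul, ENNReal.ofReal_zero]

/-- A nonnegative continuous function with vanishing iterated integral vanishes. -/
theorem eq_zero_of_lintegral_eq_zero (hT : 0 < T) (hΩ : IsOpen Ω) {q : ℝ → E d → ℝ}
    (hq : ContinuousOn (fun p : ℝ × E d => q p.1 p.2) (Icc 0 T ×ˢ Ω))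
    (hq0 : ∀ t ∈ Icc 0 T, ∀ x ∈ Ω, 0 ≤ q t x)
    (hint : ∫⁻ t in Icc 0 T, ∫⁻ x in Ω, ENNReal.ofReal (q t x) = 0) {t : ℝ} (ht : t ∈ Icc 0 T)
    {x : E d} (hx : x ∈ Ω) : q t x = 0 := by
  by_contra hne
  have hpos : 0 < q t x := lt_of_le_of_ne (hq0 t ht x hx) (Ne.symm hne)
  have hev := (hq (t, x) ⟨ht, hx⟩).eventually (lt_mem_nhds (half_lt_self hpos))
  rw [nhdsWithin_prod_eq, hΩ.nhdsWithin_eq hx, eventually_prod_iff] at hev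
  obtain ⟨pa, hpa, pb, hpb, hab⟩ := hev
  obtain ⟨A, hAo, htA, hA⟩ := mem_nhdsWithin.1 hpa
  obtain ⟨U, hU, hUo, hxU⟩ := eventually_nhds_iff.1 (hpb.and (hΩ.mem_nhds hx))
  have hne : (A ∩ Ioo 0 T).Nonempty := by
    refine mem_closure_iff.1 ?_ A hAo htA
    rwa [closure_Ioo hT.ne]
  have hA0 : 0 < volume (A ∩ Ioo 0 T) := (hAo.inter isOpen_Ioo).measure_pos volume hne
  have hU0 : 0 < volume U := hUo.measure_pos volume ⟨x, hxU⟩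
  have hle : ENNReal.ofReal (q t x / 2) * volume U * volume (A ∩ Ioo 0 T) ≤ 0 := by
    rw [← hint, ← setLIntegral_const]
    refine (setLIntegral_mono_ae' (hAo.inter isOpen_Ioo).measurableSet
      (Eventually.of_forall fun τ hτ => ?_)).trans
      (lintegral_mono_set (inter_subset_right.trans Ioo_subset_Icc_self))
    rw [← setLIntegral_const]
    refine (setLIntegral_mono_ae' hUo.measurableSet (Eventually.of_forall fun y hy => ?_)).trans
      (lintegral_mono_set fun y hy => (hU y hy).2)
    exact ENNReal.ofReal_le_ofReal
      (hab (hA ⟨hτ.1, Ioo_subset_Icc_self hτ.2⟩) (hU y hy).1).le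
  exact absurd hle (not_le.2 (ENNReal.mul_pos (ENNReal.mul_pos
    (ENNReal.ofReal_pos.2 (half_pos hpos)).ne' hU0.ne').ne' hA0.ne'))

theorem densityMeasure_injOn (hΩ : IsOpen Ω) {ρ ρ' : E d → ℝ} (hc : ContinuousOn ρ Ω)
    (hc' : ContinuousOn ρ' Ω) (hpos : ∀ x ∈ Ω, 0 < ρ x) (hpos' : ∀ x ∈ Ω, 0 < ρ' x)
    (heq : densityMeasure Ω ρ = densityMeasure Ω ρ') : EqOn ρ ρ' Ω := by
  have h1 := (withDensity_eq_iff_of_sigmaFinite (aemeasurable_ofReal_of_continuousOn hΩ hc)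
    (aemeasurable_ofReal_of_continuousOn hΩ hc')).1 heq
  refine Measure.eqOn_open_of_ae_eq (μ := volume) ?_ hΩ hc hc'
  filter_upwards [h1, ae_restrict_mem hΩ.measurableSet] with x hx hxΩ
  exact (ENNReal.ofReal_eq_ofReal_iff (hpos x hxΩ).le (hpos' x hxΩ).le).1 hx

theorem Standing.of_isMinimizer (h : Standing Ω b D ρ₀ ρs) (hT : 0 < T)
    (hmin : IsMinimizer Ω b D ρ₀ T s X G) :
    (∀ t ∈ Icc 0 T, ∀ x ∈ Ω, D t x (s t x) = D t x (score (ρs t) x)) ∧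
    ∀ t ∈ Icc 0 T, (densityMeasure Ω ρ₀).map (X t) = densityMeasure Ω (ρs t) := by
  obtain ⟨⟨hs, hXG⟩, hle⟩ := hmin
  have hJ := timeDomain_Icc hT.le
  have hJ0 : Icc 0 T ⊆ Ici (0 : ℝ) := fun t ht => ht.1
  have := h.isProbabilityMeasure
  have hs' := h.admissible_score.mono_time hJ0
  obtain ⟨X', G', hXG'⟩ := h.exists_solvesXG hJ hJ0 hs'
  obtain ⟨⟨M', I', h2⟩, -, hmap⟩ := h.transport_exact hJ hJ0 hXG'
  obtain ⟨M, I, h1⟩ := h.exists_transport hJ hJ0 hs hXG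
  have hloss : loss Ω D ρ₀ T s X G = 0 :=
    le_antisymm ((hle _ X' G' ⟨hs', hXG'⟩).trans_eq (h.loss_exact hT.le hXG')) zero_le
  have hmeas : ∀ t ∈ Icc 0 T, (densityMeasure Ω ρ₀).map (X t) = densityMeasure Ω (ρs t) := by
    intro t ht
    have hkl := h.klDiv_le hJ hJ0 hs hXG ht
    have hlt : loss Ω D ρ₀ t s X G ≤ loss Ω D ρ₀ T s X G :=
      lintegral_mono_set (Icc_subset_Icc_right ht.2)
    rw [le_antisymm (hlt.trans_eq hloss) zero_le, mul_zero] at hkl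
    have : IsProbabilityMeasure ((densityMeasure Ω ρ₀).map (X t)) := Measure.isProbabilityMeasure_map
      (aemeasurable_densityMeasure h.isOpen (h1.continuousOn_apply ht))
    have : IsProbabilityMeasure (densityMeasure Ω (ρs t)) := by
      rw [← hmap t ht]
      exact Measure.isProbabilityMeasure_map
        (aemeasurable_densityMeasure h.isOpen (h2.continuousOn_apply ht))
    exact InformationTheory.klDiv_eq_zero_iff.1 (le_antisymm hkl zero_le)
  refine ⟨fun t ht p hp => ?_, hmeas⟩
  have heq : EqOn (flowDensity Ω X I ρ₀ t) (ρs t) Ω :=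
    densityMeasure_injOn h.isOpen (continuousOn_slice h1.flowDensity_C1.continuousOn ht)
      (continuousOn_slice h.ρs_C3.continuousOn (hJ0 ht)) (fun x hx => h1.flowDensity_pos ht hx)
      (h.ρs_pos t (hJ0 ht)) ((h1.map_eq_flowDensity ht).symm.trans (hmeas t ht))
  have hx := h1.mapsTo_flowInv ht hp
  have hXx := h1.flow.apply_flowInv h1.field hJ ht hp
  have hG : G t (flowInv Ω X t p) = score (ρs t) p := by
    rw [← h1.score_flowDensity ht hp, score_congr h.isOpen heq hp]
  have hec : ContinuousOn (fun p : ℝ × E d => s p.1 (X p.1 p.2) - G p.1 p.2) (Icc 0 T ×ˢ Ω) :=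
    (h1.flow.continuousOn_comp h1.field hJ (f := s) hs.s_C2.continuousOn).sub h1.continuousOn_score
  have hDc : ContinuousOn (fun p : ℝ × E d => D p.1 (X p.1 p.2)) (Icc 0 T ×ˢ Ω) :=
    h1.flow.continuousOn_comp h1.field hJ (f := D) (h.D_C2.mono_time hJ0).continuousOn
  have hρc : ContinuousOn (fun p : ℝ × E d => ρ₀ p.2) (Icc 0 T ×ˢ Ω) :=
    h.ρ₀_C3.continuousOn.comp continuousOn_snd fun p hp => hp.2
  have hq := eq_zero_of_lintegral_eq_zero hT h.isOpen (q := fun t x =>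
    inner ℝ (s t (X t x) - G t x) (D t (X t x) (s t (X t x) - G t x)) * ρ₀ x)
    ((hec.inner (𝕜 := ℝ) (hDc.clm_apply hec)).mul hρc)
    (fun t ht x hx => mul_nonneg ((h.D_psd t (hJ0 ht) _ (h1.flow.mapsTo ht hx)).inner_nonneg_right _)
      (h.ρ₀_pos x hx).le) hloss ht hx
  have hz := (mul_eq_zero.1 hq).resolve_right (h.ρ₀_pos _ hx).ne'
  rw [hXx, hG] at hz
  have := eq_zero_of_inner_eq_zero (h.D_psd t (hJ0 ht) p hp) hz
  rwa [map_sub, sub_eq_zero] at this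

end Application

end SBTM

theorem proposition2 {d : ℕ} (Ω : Set (SBTM.E d)) (b : ℝ → SBTM.E d → SBTM.E d)
    (D : ℝ → SBTM.E d → SBTM.E d →L[ℝ] SBTM.E d) (ρ₀ : SBTM.E d → ℝ)
    (ρs : ℝ → SBTM.E d → ℝ) (h : SBTM.Standing Ω b D ρ₀ ρs) :
    -- for every admissible `s`, the system for `(X, G)` has a solution for all `t ≥ 0`
    (∀ s : ℝ → SBTM.E d → SBTM.E d, SBTM.Admissible (Ici 0) Ω b D s →
      ∃ X G : ℝ → SBTM.E d → SBTM.E d,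
        SBTM.SolvesXG (Ici 0) Ω ρ₀ (SBTM.velocity b D s) X G) ∧
    -- every solution has the asserted properties
    (∀ s X G : ℝ → SBTM.E d → SBTM.E d, SBTM.Admissible (Ici 0) Ω b D s →
      SBTM.SolvesXG (Ici 0) Ω ρ₀ (SBTM.velocity b D s) X G →
      (∃ ρ : ℝ → SBTM.E d → ℝ,
        SBTM.CkInSpace (Ici 0) Ω 1 ρ ∧
        (∀ t ∈ Ici (0 : ℝ), ∀ x ∈ Ω, 0 < ρ t x) ∧
        (∀ x ∈ Ω, ρ 0 x = ρ₀ x) ∧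
        (∀ t ∈ Ici (0 : ℝ),
          (SBTM.densityMeasure Ω ρ₀).map (X t) = SBTM.densityMeasure Ω (ρ t)) ∧
        SBTM.SolvesTE (Ici 0) Ω (SBTM.velocity b D s) ρ ∧
        (∀ t ∈ Ici (0 : ℝ), ∀ x ∈ Ω, G t x = SBTM.score (ρ t) (X t x))) ∧
      (∀ T : ℝ, 0 ≤ T →
        InformationTheory.klDiv ((SBTM.densityMeasure Ω ρ₀).map (X T))
            (SBTM.densityMeasure Ω (ρs T))
          ≤ 2⁻¹ * SBTM.loss Ω D ρ₀ T s X G)) ∧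
    -- minimizers of the constrained problem on `[0, T]`
    (∀ T : ℝ, 0 < T → ∀ s X G : ℝ → SBTM.E d → SBTM.E d,
      SBTM.IsMinimizer Ω b D ρ₀ T s X G →
      (∀ t ∈ Icc 0 T, ∀ x ∈ Ω, D t x (s t x) = D t x (SBTM.score (ρs t) x)) ∧
      (∀ t ∈ Icc 0 T,
        (SBTM.densityMeasure Ω ρ₀).map (X t) = SBTM.densityMeasure Ω (ρs t))) := by
  refine ⟨fun s hs => h.exists_solvesXG SBTM.timeDomain_Ici subset_rfl hs,
    fun s X G hs hXG => ⟨?_, fun T hT =>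
      h.klDiv_le SBTM.timeDomain_Ici subset_rfl hs hXG hT⟩,
    fun T hT s X G hmin => h.of_isMinimizer hT hmin⟩
  obtain ⟨M, I, h1⟩ := h.exists_transport SBTM.timeDomain_Ici subset_rfl hs hXG
  refine ⟨SBTM.flowDensity Ω X I ρ₀, h1.flowDensity_C1, fun t ht x hx => h1.flowDensity_pos ht hx,
    fun x hx => h1.flowDensity_zero hx, fun t ht => h1.map_eq_flowDensity ht, h1.solvesTE,
    fun t ht x hx => ?_⟩
  rw [h1.score_flowDensity ht (h1.flow.mapsTo ht hx), h1.flow.flowInv_apply h1.field h1.time ht hx]
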